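/- Let $X$ be a separable real Banach space with a non-degenerate centered Gaussian (Borel) measure $\mu$. Let $X^*_\mu$ be the closure of $X^*$ in $L^2(X,\mu)$ and let $R_\mu g=\int_X g(x)\,x\,d\mu(x)\in X$ for $g\in X^*_\mu$. The Cameron--Martin space is $H=R_\mu(X^*_\mu)$; for $h\in H$ we write $\hat h$ for the unique $g\in X^*_\mu$ with $h=R_\mu g$, and $\langle h,k\rangle_H=\int_X\hat h\hat k\,d\mu$. Fix an orthonormal basis $(e_n)_n$ of $H$ and write $\|A\|_{\mathcal H_2}=(\sum_n|Ae_n|_H^2)^{1/2}$ for the Hilbert--Schmidt norm of an operator $A$ on $H$. Let $\mathscr{FC}^\infty_b(X)$ be the set of functions $f(x)=\varphi(x_1^*(x),\dots,x_m^*(x))$ with $m\in\mathbb N$, $x_i^*\in X^*$ and $\varphi:\mathbb R^m\to\mathbb R$ smooth and bounded together with all its derivatives. For such $f$, $\nabla_Hf(x)\in H$ and $\nabla_H^2f(x)$ denote the first and second derivatives along $H$. The $H$-valued smooth cylindrical functions are the elements of the linear span of the maps $x\mapsto f(x)h$, $f\in\mathscr{FC}^\infty_b(X)$, $h\in H$.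 For $\rho\in\{\mu,\nu\}$, with $\nu$ as below, $W^{1,p}(X,\rho)$ is the domain of the closure of $\nabla_H:\mathscr{FC}^\infty_b(X)\to L^p(X,\rho;H)$ in $L^p(X,\rho)$; $W^{1,p}(X,\rho;H)$ is defined in the same way from the $H$-valued smooth cylindrical functions, with derivatives in $L^p(X,\rho;\mathcal H_2)$ and norm $\|\Phi\|_{W^{1,p}(X,\rho;H)}=\|\Phi\|_{L^p(X,\rho;H)}+\|\nabla_H\Phi\|_{L^p(X,\rho;\mathcal H_2)}$; and $W^{2,p}(X,\mu)$ is the closure of $\mathscr{FC}^\infty_b(X)$ with respect to $f$, $\nabla_Hf$ and $\nabla_H^2f$ in $L^p(\mu)$. The closed operators are still denoted by $\nabla_H$, $\nabla^2_H$; $\partial_nf=\langle\nabla_Hf,e_n\rangle_H$ and $\partial_i\partial_jf=\langle\nabla_H^2f\,e_j,e_i\rangle_H$. Let $1<s<\infty$, $s'=s/(s-1)$ and $2s'\le t<\infty$. Let $w:X\to\mathbb R$ satisfy $w>0$ $\mu$-a.e., $w\in W^{1,s}(X,\mu)$ and $\log w\in W^{2,t}(X,\mu)$, and put $\nu=w\mu$.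 Assume that there is $C\ge0$ such that for every $(\xi_i)_i\in\ell_2$ $$\sum_{i}\sum_{j}\bigl(\delta_{ij}-\partial_i\partial_j\log w(x)\bigr)\xi_i\xi_j\le C\sum_i\xi_i^2\qquad\text{for }\mu\text{-a.e. }x.$$ Then every $\Phi\in W^{1,2}(X,\nu;H)$ has a divergence $\operatorname{div}_\nu\Phi\in L^2(X,\nu)$; that is, $\Phi\in L^1(X,\nu;X)$ and $\operatorname{div}_\nu\Phi\in L^1(X,\nu)$ satisfies $\int_X\partial_\Phi f\,d\nu=-\int_Xf\operatorname{div}_\nu\Phi\,d\nu$ for all $f\in\mathscr{FC}^\infty_b(X)$, where $\partial_\Phi f(x)=\lim_{\tau\to0}\tau^{-1}(f(x+\tau\Phi(x))-f(x))$. Moreover: 1. for every $f\in W^{1,2}(X,\nu)$, $\displaystyle\int_X\langle\nabla_Hf,\Phi\rangle_H\,d\nu=-\int_Xf\operatorname{div}_\nu\Phi\,d\nu$; 2. the functions $\varphi_n=\langle\Phi,e_n\rangle_H$ belong to $W^{1,2}(X,\nu)$ and $\displaystyle\operatorname{div}_\nu\Phi=\sum_n\bigl(\partial_n\varphi_n+\varphi_n\,\partial_n\log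 w-\varphi_n\hat e_n\bigr)$, the series converging (unconditionally) in $L^2(X,\nu)$; 3. $\|\operatorname{div}_\nu\Phi\|_{L^2(X,\nu)}\le\max\{\sqrt C,1\}\,\|\Phi\|_{W^{1,2}(X,\nu;H)}$. -/

import Mathlib

open MeasureTheory ProbabilityTheory Filter Topology
open scoped ENNReal ContDiff InnerProductSpace

noncomputable section

namespace WeightedGaussian

variable {X : Type*} [NormedAddCommGroup X] [NormedSpace ℝ X]
  [MeasurableSpace X] [BorelSpace X]

/-- The Cameron–Martin space `H` of a centered Gaussian measure `μ`. It is the Hilbert space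
`X*_μ`, the closure of `X*` in `L²(X, μ)`, each `g ∈ X*_μ` standing for the vector
`h = R_μ g` of `X` (see `CM.toX`); so `⟨h, k⟩_H = ∫ ĥ k̂ dμ`. -/
def CM (μ : Measure X) : Type _ :=
  (LinearMap.range (StrongDual.toLp (𝕜 := ℝ) μ 2).toLinearMap).topologicalClosure

instance (μ : Measure X) : NormedAddCommGroup (CM μ) :=
  inferInstanceAs (NormedAddCommGroup
    (LinearMap.range (StrongDual.toLp (𝕜 := ℝ) μ 2).toLinearMap).topologicalClosure)

instance (μ : Measure X) : InnerProductSpace ℝ (CM μ) :=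
  inferInstanceAs (InnerProductSpace ℝ
    (LinearMap.range (StrongDual.toLp (𝕜 := ℝ) μ 2).toLinearMap).topologicalClosure)

instance (μ : Measure X) : CompleteSpace (CM μ) :=
  inferInstanceAs (CompleteSpace
    (LinearMap.range (StrongDual.toLp (𝕜 := ℝ) μ 2).toLinearMap).topologicalClosure)

/-- The isometric inclusion `X*_μ ⊆ L²(X, μ)`. -/
def CM.hatₗᵢ (μ : Measure X) : CM μ →ₗᵢ[ℝ] Lp ℝ 2 μ :=
  (LinearMap.range (StrongDual.toLp (𝕜 := ℝ) μ 2).toLinearMap).topologicalClosure.subtypeₗᵢ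

/-- The function `ĥ ∈ X*_μ ⊆ L²(X, μ)` of `h ∈ H`. -/
def CM.hat {μ : Measure X} (h : CM μ) : X → ℝ := (CM.hatₗᵢ μ h : X → ℝ)

/-- The inclusion `H → X`, that is `h = R_μ ĥ = ∫ ĥ(x) x dμ(x)`. -/
def CM.toX {μ : Measure X} (h : CM μ) : X := ∫ x, h.hat x • x ∂μ

/-- `y*(R_μ ĥ) = ∫ y* ĥ dμ` for all `y* ∈ X*`: the vector `h` is given by the covariance. -/
lemma CM.dual_toX [CompleteSpace X] [SecondCountableTopology X] {μ : Measure X} [IsGaussian μ]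
    (h : CM μ) (L : StrongDual ℝ X) : L h.toX = ∫ x, L x * h.hat x ∂μ := by
  have hi : Integrable (fun x => h.hat x • x) μ :=
    memLp_one_iff_integrable.1 (MemLp.smul (p := 2) (q := 2) (r := 1)
      (IsGaussian.memLp_id μ 2 (by simp)) (Lp.memLp (CM.hatₗᵢ μ h)))
  rw [CM.toX, ← L.integral_comp_comm hi]
  simp [mul_comm]

/-- Distinct elements of `X*_μ` stand for distinct vectors of `X`. -/
lemma CM.toX_injective [CompleteSpace X] [SecondCountableTopology X] {μ : Measure X}
    [IsGaussian μ] : Function.Injective (CM.toX (μ := μ)) := by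
  intro h k hk
  have h2 : MemLp id 2 μ := IsGaussian.memLp_id μ 2 (by simp)
  have key : ∀ (u : CM μ) (L : StrongDual ℝ X),
      ⟪L.toLp μ 2, CM.hatₗᵢ μ u⟫_ℝ = L u.toX := by
    intro u L
    rw [CM.dual_toX, L2.inner_def]
    refine integral_congr_ae ?_
    rw [StrongDual.toLp_apply h2]
    filter_upwards [MemLp.coeFn_toLp (h2.continuousLinearMap_comp L)] with x hx
    simp only [id_eq] at hx
    simp [hx, CM.hat, mul_comm]
  have hcl : ∀ v ∈ (LinearMap.range (StrongDual.toLp (𝕜 := ℝ) μ 2).toLinearMap).topologicalClosure,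
      ⟪v, (CM.hatₗᵢ μ h - CM.hatₗᵢ μ k)⟫_ℝ = 0 := by
    intro v hv
    have hcl' : IsClosed {v : Lp ℝ 2 μ | ⟪v, (CM.hatₗᵢ μ h - CM.hatₗᵢ μ k)⟫_ℝ = 0} :=
      isClosed_eq (by fun_prop) continuous_const
    refine closure_minimal ?_ hcl' hv
    rintro _ ⟨L, rfl⟩
    change ⟪L.toLp μ 2, _⟫_ℝ = 0
    rw [inner_sub_right, key h L, key k L, hk, sub_self]
  have h0 := hcl (CM.hatₗᵢ μ (h - k)) (h - k).2
  rw [map_sub] at h0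
  exact (CM.hatₗᵢ μ).injective (sub_eq_zero.1 (inner_self_eq_zero.1 h0))

/-- `∇_H f(x)`: the limit of `(f(x + t h) - f(x)) / t`, uniform over the unit sphere of `H`, is the
Fréchet differential at `0` of `k ↦ f(x + k)` on `H`. -/
def gradH (μ : Measure X) (f : X → ℝ) (x : X) : CM μ :=
  gradient (fun k : CM μ => f (x + k.toX)) 0

/-- The derivative along `H` of an `H`-valued map, an operator on `H`. -/
def derivH {μ : Measure X} (F : X → CM μ) (x : X) : CM μ →L[ℝ] CM μ :=
  fderiv ℝ (fun k : CM μ => F (x + k.toX)) 0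

/-- `∇²_H f(x)`. -/
def hessH (μ : Measure X) (f : X → ℝ) : X → (CM μ →L[ℝ] CM μ) := derivH (gradH μ f)

/-- The Hilbert–Schmidt norm `(∑ᵢ |A eᵢ|²)^{1/2}`, possibly `∞`. -/
def hsNorm {ι E : Type*} [NormedAddCommGroup E] [InnerProductSpace ℝ E]
    (e : HilbertBasis ι ℝ E) (A : E →L[ℝ] E) : ℝ≥0∞ :=
  (∑' i, ‖A (e i)‖ₑ ^ 2) ^ (1 / 2 : ℝ)

/-- `FC_b^∞(X)`: functions `φ(x₁*(x), …, xₙ*(x))` with `φ` smooth on `ℝⁿ`, bounded together with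
all its derivatives. -/
def IsSmoothCyl (f : X → ℝ) : Prop :=
  ∃ (n : ℕ) (l : Fin n → StrongDual ℝ X) (φ : (Fin n → ℝ) → ℝ),
    ContDiff ℝ ∞ φ ∧ (∀ k : ℕ, ∃ M : ℝ, ∀ y, ‖iteratedFDeriv ℝ k φ y‖ ≤ M) ∧
      ∀ x, f x = φ (fun i => l i x)

/-- `H`-valued smooth cylindrical functions: the span of the maps `x ↦ f(x) h`. -/
def IsSmoothCylH {μ : Measure X} (F : X → CM μ) : Prop :=
  F ∈ Submodule.span ℝ {F : X → CM μ | ∃ (f : X → ℝ) (h : CM μ), IsSmoothCyl f ∧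
    F = fun x => f x • h}

/-- `f ∈ W^{1,p}(X, ρ)` with generalized gradient `G = ∇_H f`, where `H` is the Cameron–Martin
space of `μ`: the pair `(f, G)` lies in the closure in `L^p(X, ρ) × L^p(X, ρ; H)` of the graph of
`∇_H` on `FC_b^∞(X)`. Used with `ρ = μ` and with `ρ = w μ`. -/
def IsW1 (μ ρ : Measure X) (p : ℝ≥0∞) (f : X → ℝ) (G : X → CM μ) : Prop :=
  MemLp f p ρ ∧ MemLp G p ρ ∧
  ∃ F : ℕ → X → ℝ, (∀ k, IsSmoothCyl (F k)) ∧
    Tendsto (fun k => eLpNorm (fun x => f x - F k x) p ρ) atTop (𝓝 0) ∧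
    Tendsto (fun k => eLpNorm (fun x => G x - gradH μ (F k) x) p ρ) atTop (𝓝 0)

/-- `f ∈ W^{2,p}(X, μ)` with generalized gradient `G = ∇_H f` and Hessian `A = ∇²_H f`. -/
def IsW2 {ι : Type*} (μ : Measure X) (e : HilbertBasis ι ℝ (CM μ)) (p : ℝ≥0∞) (f : X → ℝ)
    (G : X → CM μ) (A : X → (CM μ →L[ℝ] CM μ)) : Prop :=
  MemLp f p μ ∧ MemLp G p μ ∧
  AEStronglyMeasurable A μ ∧ eLpNorm (fun x => hsNorm e (A x)) p μ ≠ ⊤ ∧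
  ∃ F : ℕ → X → ℝ, (∀ k, IsSmoothCyl (F k)) ∧
    Tendsto (fun k => eLpNorm (fun x => f x - F k x) p μ) atTop (𝓝 0) ∧
    Tendsto (fun k => eLpNorm (fun x => G x - gradH μ (F k) x) p μ) atTop (𝓝 0) ∧
    Tendsto (fun k => eLpNorm (fun x => hsNorm e (A x - hessH μ (F k) x)) p μ) atTop (𝓝 0)

/-- `Φ ∈ W^{1,p}(X, ρ; H)` with generalized derivative `D = ∇_H Φ` (Hilbert–Schmidt valued, with
`D(x) h = ∂_h Φ(x)`). -/
def IsW1H {ι : Type*} {μ : Measure X} (ρ : Measure X) (e : HilbertBasis ι ℝ (CM μ)) (p : ℝ≥0∞)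
    (Φ : X → CM μ) (D : X → (CM μ →L[ℝ] CM μ)) : Prop :=
  MemLp Φ p ρ ∧ AEStronglyMeasurable D ρ ∧ eLpNorm (fun x => hsNorm e (D x)) p ρ ≠ ⊤ ∧
  ∃ F : ℕ → X → CM μ, (∀ k, IsSmoothCylH (F k)) ∧
    Tendsto (fun k => eLpNorm (fun x => Φ x - F k x) p ρ) atTop (𝓝 0) ∧
    Tendsto (fun k => eLpNorm (fun x => hsNorm e (D x - derivH (F k) x)) p ρ) atTop (𝓝 0)

/-- `‖Φ‖_{W^{1,p}(X, ρ; H)}`, for a field `Φ` with generalized derivative `D`. -/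
def normW1H {ι : Type*} {μ : Measure X} (ρ : Measure X) (e : HilbertBasis ι ℝ (CM μ)) (p : ℝ≥0∞)
    (Φ : X → CM μ) (D : X → (CM μ →L[ℝ] CM μ)) : ℝ≥0∞ :=
  eLpNorm Φ p ρ + eLpNorm (fun x => hsNorm e (D x)) p ρ

/-- The weighted measure `ν = w μ`. -/
def weighted (μ : Measure X) (w : X → ℝ) : Measure X :=
  μ.withDensity (fun x => ENNReal.ofReal (w x))

/-- `g` is the divergence with respect to `ν` of the vector field `Ψ ∈ L¹(X, ν; X)`;
`lineDeriv ℝ f x (Ψ x)` is `lim (f(x + t Ψ(x)) - f(x)) / t` as `t → 0`. -/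
def HasDivergence (ν : Measure X) (Ψ : X → X) (g : X → ℝ) : Prop :=
  Integrable Ψ ν ∧ Integrable g ν ∧
  ∀ f : X → ℝ, IsSmoothCyl f →
    ∫ x, lineDeriv ℝ f x (Ψ x) ∂ν = - ∫ x, f x * g x ∂ν

end WeightedGaussian

end

set_option linter.unusedSectionVars false

open MeasureTheory ProbabilityTheory Filter Topology
open scoped ENNReal ContDiff InnerProductSpace

noncomputable section

namespace WeightedGaussian

variable {X : Type*} [NormedAddCommGroup X] [NormedSpace ℝ X]
  [MeasurableSpace X] [BorelSpace X]

/-! ### The Cameron–Martin space: inclusion in `X`, density of `X*`, Gaussian moments. -/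

section CameronMartin

variable [CompleteSpace X] [SecondCountableTopology X] {μ : Measure X} [IsGaussian μ]

/-! Write `β_h = ∂_h log w - ĥ` (`score`) and `δ_h f = ∂_h f + f β_h` (`divTerm`). Rotation
invariance of `μ ⊗ μ` gives Gaussian integration by parts along `H` (`integral_fderiv_toX`).
Applying it to `f η(log w)`, with `η` running through compactly supported approximations of `exp`,
turns it into integration by parts for `ν`: `∫ ∂_h f dν = -∫ f β_h dν` (`integral_fderiv_weighted`).
Hence `-δ_h` is the adjoint of `∂_h` in `L²(ν)`, and the cylindrical field `F = ∑ᵢ fᵢ hᵢ` has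
divergence `∑ᵢ δ_{hᵢ} fᵢ`. Hölder's inequality with `2 s' ≤ t` embeds `L^t(μ)` in `L²(ν)`, so
everything that involves `log w` or `ĥ` converges where it is needed (`eLpNorm_weighted_le`).

The heart is an energy identity. In a weak sense `∂_k β_h = ⟨∇² log w k, h⟩ - ⟨h, k⟩`, and commuting
`∂_k` with `δ_h` (`integral_divTerm_mul_divTerm`) yields `∫ (div F)² dν = ∫ tr((∇_H F)²) + ⟨(I -
∇²_H log w) F, F⟩ dν`. The trace is at most the squared Hilbert–Schmidt norm
(`ofReal_sum_inner_mul_inner_le`) and the quadratic form is at most `C |F|²`, so the `L²(ν)` norm of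
the divergence is at most `max(√C, 1)` times the `W^{1,2}` norm (`eLpNorm_cylDiv_le`).

By this estimate the divergences of cylindrical fields approximating `Φ` form a Cauchy sequence;
their limit is `div_ν Φ`, and integration by parts and the bound pass to the limit
(`exists_isDivLimit`). For the series, project `Φ` onto the span of `e_n`, `n ∈ S`: the divergence
of the projected field is the partial sum over `S` (`exists_trunc`), and the projected fields tend
to `Φ` in `W^{1,2}` along the finite sets `S` (`tendsto_normW1H_sub_trunc`). The estimate for the
difference gives unconditional convergence in `L²(ν)`. -/

lemma CM.hat_add (h k : CM μ) : (h + k).hat =ᵐ[μ] h.hat + k.hat := by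
  unfold CM.hat
  rw [map_add]
  exact Lp.coeFn_add _ _

lemma CM.hat_smul (c : ℝ) (h : CM μ) : (c • h).hat =ᵐ[μ] c • h.hat := by
  unfold CM.hat
  rw [map_smul]
  exact Lp.coeFn_smul _ _

lemma CM.memLp_two_hat (h : CM μ) : MemLp h.hat 2 μ := Lp.memLp _

lemma CM.eLpNorm_two_hat (h : CM μ) : eLpNorm h.hat 2 μ = ‖h‖ₑ := by
  rw [← (CM.hatₗᵢ μ).enorm_map h, Lp.enorm_def]
  rfl

lemma CM.integral_hat_mul_hat (h k : CM μ) : ∫ x, h.hat x * k.hat x ∂μ = ⟪h, k⟫_ℝ := by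
  rw [← (CM.hatₗᵢ μ).inner_map_map h k, L2.inner_def]
  refine integral_congr_ae (Eventually.of_forall fun x => ?_)
  simp [CM.hat, mul_comm]

lemma CM.integrable_hat_smul (h : CM μ) : Integrable (fun x => h.hat x • x) μ :=
  memLp_one_iff_integrable.1 (MemLp.smul (p := 2) (q := 2) (r := 1)
    (IsGaussian.memLp_id μ 2 (by simp)) (CM.memLp_two_hat h))

/-- Cauchy–Schwarz under the integral; the constant is finite by Fernique's theorem. -/
lemma CM.norm_toX_le (h : CM μ) : ‖h.toX‖ ≤ (eLpNorm id 2 μ).toReal * ‖h‖ := by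
  have h1 : ‖h.toX‖ₑ ≤ ‖h‖ₑ * eLpNorm (id : X → X) 2 μ := by
    calc ‖h.toX‖ₑ ≤ ∫⁻ x, ‖h.hat x • x‖ₑ ∂μ := enorm_integral_le_lintegral_enorm _
      _ = eLpNorm (h.hat • (id : X → X)) 1 μ := by
        rw [eLpNorm_one_eq_lintegral_enorm]; rfl
      _ ≤ eLpNorm h.hat 2 μ * eLpNorm (id : X → X) 2 μ :=
        eLpNorm_smul_le_mul_eLpNorm (IsGaussian.memLp_id μ 2 (by simp)).1
          (CM.memLp_two_hat h).1
      _ = _ := by rw [CM.eLpNorm_two_hat]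
  have h2 : eLpNorm (id : X → X) 2 μ ≠ ⊤ := (IsGaussian.memLp_id μ 2 (by simp)).2.ne
  have := ENNReal.toReal_mono (ENNReal.mul_ne_top (by simp) h2) h1
  simpa [mul_comm] using this

variable (μ) in
/-- The inclusion `H → X` as a continuous linear map. -/
def CM.toXL : CM μ →L[ℝ] X :=
  LinearMap.mkContinuous
    { toFun := CM.toX
      map_add' := fun h k => by
        rw [CM.toX, CM.toX, CM.toX,
          ← integral_add (CM.integrable_hat_smul h) (CM.integrable_hat_smul k)]
        refine integral_congr_ae ?_
        filter_upwards [CM.hat_add h k] with x hx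
        simp [hx, add_smul]
      map_smul' := fun c h => by
        rw [CM.toX, CM.toX, RingHom.id_apply, ← integral_smul]
        refine integral_congr_ae ?_
        filter_upwards [CM.hat_smul c h] with x hx
        simp [hx, mul_smul] }
    (eLpNorm id 2 μ).toReal CM.norm_toX_le

lemma CM.toXL_apply (h : CM μ) : CM.toXL μ h = h.toX := rfl

/-- The element of `H` given by a continuous linear functional. -/
def CM.ofDual (μ : Measure X) (L : StrongDual ℝ X) : CM μ :=
  ⟨L.toLp μ 2, Submodule.le_topologicalClosure _ ⟨L, rfl⟩⟩

lemma CM.hat_ofDual (L : StrongDual ℝ X) : (CM.ofDual μ L).hat =ᵐ[μ] L := by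
  have h2 : MemLp id 2 μ := IsGaussian.memLp_id μ 2 (by simp)
  have : CM.hatₗᵢ μ (CM.ofDual μ L) = MemLp.toLp L (h2.continuousLinearMap_comp L) := by
    rw [← StrongDual.toLp_apply h2]; rfl
  unfold CM.hat
  rw [this]
  exact MemLp.coeFn_toLp _

lemma CM.denseRange_ofDual : DenseRange (CM.ofDual μ) := by
  intro h
  rw [Metric.mem_closure_range_iff]
  intro ε hε
  have h1 : (CM.hatₗᵢ μ h) ∈ closure
      (LinearMap.range (StrongDual.toLp (𝕜 := ℝ) μ 2).toLinearMap : Set (Lp ℝ 2 μ)) := h.2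
  obtain ⟨_, ⟨L, rfl⟩, hL⟩ := Metric.mem_closure_iff.1 h1 ε hε
  refine ⟨L, ?_⟩
  rw [← (CM.hatₗᵢ μ).isometry.dist_eq]
  exact hL

lemma CM.exists_seq_ofDual (h : CM μ) :
    ∃ L : ℕ → StrongDual ℝ X, Tendsto (fun n => CM.ofDual μ (L n)) atTop (𝓝 h) := by
  obtain ⟨v, hv, hlim⟩ := mem_closure_iff_seq_limit.1 (CM.denseRange_ofDual (μ := μ) h)
  choose L hL using hv
  exact ⟨L, by simpa [hL] using hlim⟩

/-- `H` embeds isometrically in the separable space `L²(X, μ)`. Separability makes Hilbert bases of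
`H` countable and allows almost everywhere bounds to be checked on a dense sequence. -/
instance CM.secondCountableTopology : SecondCountableTopology (CM μ) :=
  haveI : SecondCountableTopology (Lp ℝ 2 μ) :=
    haveI : Fact ((2 : ℝ≥0∞) ≠ ⊤) := ⟨by simp⟩
    Lp.SecondCountableTopology
  (CM.hatₗᵢ μ).isometry.isEmbedding.secondCountableTopology

/-- An orthonormal family in a separable inner product space is countable. -/
lemma countable_of_orthonormal {ι E : Type*} [NormedAddCommGroup E] [InnerProductSpace ℝ E]
    [SecondCountableTopology E] {v : ι → E} (hv : Orthonormal ℝ v) : Countable ι := by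
  -- Distinct vectors of the family are at distance `√2 > 1`, so the balls of radius `1/2` are
  -- disjoint.
  have hdist : Pairwise (Function.onFun Disjoint fun i => Metric.ball (v i) (1 / 2)) := by
    intro i j hij
    refine Metric.ball_disjoint_ball ?_
    have h2 : ‖v i - v j‖ ^ 2 = 2 := by
      rw [norm_sub_sq_real, hv.1 i, hv.1 j, hv.2 hij]; norm_num
    rw [dist_eq_norm]
    nlinarith [norm_nonneg (v i - v j)]
  exact Pairwise.countable_of_isOpen_disjoint hdist (fun _ => Metric.isOpen_ball)
    (fun i => ⟨v i, Metric.mem_ball_self (by norm_num)⟩)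

/-- All moments of the elements of a Gaussian space are controlled by the second one. -/
lemma CM.exists_eLpNorm_hat_le (hcentered : ∀ L : StrongDual ℝ X, ∫ x, L x ∂μ = 0)
    {q : ℝ≥0∞} (hq : q ≠ ⊤) :
    ∃ c : ℝ≥0∞, c ≠ ⊤ ∧ ∀ h : CM μ, eLpNorm h.hat q μ ≤ c * ‖h‖ₑ := by
  refine ⟨eLpNorm id q (gaussianReal 0 1), (memLp_id_gaussianReal' q hq).2.ne, ?_⟩
  -- Under `μ` the functional `L` is a standard Gaussian multiplied by its norm in `L²(μ)`, so the
  -- constant is the `q`-norm of the standard Gaussian, with equality.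
  have hdual : ∀ L : StrongDual ℝ X,
      eLpNorm L q μ = eLpNorm id q (gaussianReal 0 1) * ‖CM.ofDual μ L‖ₑ := by
    intro L
    have hmap := IsGaussian.map_eq_gaussianReal (μ := μ) L
    rw [hcentered L] at hmap
    have hL : MemLp L 2 μ := IsGaussian.memLp_dual μ L 2 (by simp)
    have hvar : Var[L; μ] = ‖CM.ofDual μ L‖ ^ 2 := by
      rw [variance_of_integral_eq_zero hL.1.aemeasurable (hcentered L),
        ← real_inner_self_eq_norm_sq, ← CM.integral_hat_mul_hat]
      refine integral_congr_ae ?_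
      filter_upwards [CM.hat_ofDual (μ := μ) L] with x hx
      simp [hx, sq]
    have hscale : (gaussianReal 0 1).map (fun x => ‖CM.ofDual μ L‖ * x) =
        gaussianReal 0 (Var[L; μ]).toNNReal := by
      rw [gaussianReal_map_const_mul]
      congr 1
      · simp
      · rw [hvar, mul_one]
        ext
        simp
    have h1 : eLpNorm L q μ = eLpNorm id q (μ.map L) := by
      rw [eLpNorm_map_measure (by fun_prop) (by fun_prop)]; rfl
    rw [h1, hmap, ← hscale, eLpNorm_map_measure (by fun_prop) (by fun_prop)]
    have : (id ∘ fun x : ℝ => ‖CM.ofDual μ L‖ * x) = ‖CM.ofDual μ L‖ • (id : ℝ → ℝ) := by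
      ext; simp
    rw [this, eLpNorm_const_smul, mul_comm, enorm_norm]
  intro h
  -- Fatou's lemma along an almost everywhere convergent subsequence carries the bound to the
  -- closure of `X*`.
  obtain ⟨L, hL⟩ := CM.exists_seq_ofDual h
  have hLp : Tendsto (fun n => CM.hatₗᵢ μ (CM.ofDual μ (L n))) atTop (𝓝 (CM.hatₗᵢ μ h)) :=
    ((CM.hatₗᵢ μ).continuous.tendsto h).comp hL
  have hmeas := tendstoInMeasure_of_tendsto_Lp hLp
  obtain ⟨ns, hns, hae⟩ := hmeas.exists_seq_tendsto_ae
  refine (Lp.eLpNorm_lim_le_liminf_eLpNorm (fun n => Lp.aestronglyMeasurable _) _ hae).trans ?_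
  have hlim : Tendsto (fun n => eLpNorm id q (gaussianReal 0 1) * ‖CM.ofDual μ (L (ns n))‖ₑ)
      atTop (𝓝 (eLpNorm id q (gaussianReal 0 1) * ‖h‖ₑ)) :=
    ENNReal.Tendsto.const_mul ((continuous_enorm.tendsto h).comp (hL.comp hns.tendsto_atTop))
      (Or.inr (memLp_id_gaussianReal' q hq).2.ne)
  refine le_of_eq ?_
  rw [← hlim.liminf_eq]
  refine congrArg (fun v => liminf v atTop) (funext fun n => ?_)
  rw [← hdual]
  exact eLpNorm_congr_ae (CM.hat_ofDual (μ := μ) (L (ns n)))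

end CameronMartin

/-! ### Smooth cylindrical functions and fields, and their derivatives along `H`. -/

section Cylindrical

/-- Smooth functions that are bounded together with all their derivatives. -/
def HasBddDerivs {E : Type*} [NormedAddCommGroup E] [NormedSpace ℝ E] (φ : E → ℝ) : Prop :=
  ContDiff ℝ ∞ φ ∧ ∀ k : ℕ, ∃ M : ℝ, ∀ y, ‖iteratedFDeriv ℝ k φ y‖ ≤ M

section HasBddDerivs

variable {E F : Type*} [NormedAddCommGroup E] [NormedSpace ℝ E] [NormedAddCommGroup F]
  [NormedSpace ℝ F] {φ ψ : E → ℝ}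

lemma HasBddDerivs.exists_bound_le (hφ : HasBddDerivs φ) (n : ℕ) :
    ∃ M : ℝ, 0 ≤ M ∧ ∀ k ≤ n, ∀ y, ‖iteratedFDeriv ℝ k φ y‖ ≤ M := by
  choose M hM using hφ.2
  refine ⟨∑ k ∈ Finset.range (n + 1), |M k|, by positivity, fun k hk y => ?_⟩
  exact ((hM k y).trans (le_abs_self _)).trans
    (Finset.single_le_sum (f := fun k => |M k|) (fun _ _ => abs_nonneg _)
      (Finset.mem_range.2 (by omega)))

lemma HasBddDerivs.comp_clm (hφ : HasBddDerivs φ) (T : F →L[ℝ] E) :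
    HasBddDerivs (fun y => φ (T y)) := by
  refine ⟨hφ.1.comp T.contDiff, fun k => ?_⟩
  obtain ⟨M, hM⟩ := hφ.2 k
  refine ⟨M * ‖T‖ ^ k, fun y => ?_⟩
  have := T.iteratedFDeriv_comp_right hφ.1 y (i := k) (by exact_mod_cast le_top)
  change ‖iteratedFDeriv ℝ k (φ ∘ T) y‖ ≤ _
  rw [this]
  refine (ContinuousMultilinearMap.norm_compContinuousLinearMap_le _ _).trans ?_
  simp only [Finset.prod_const, Finset.card_univ, Fintype.card_fin]
  gcongr
  exact hM _

lemma HasBddDerivs.add (hφ : HasBddDerivs φ) (hψ : HasBddDerivs ψ) :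
    HasBddDerivs (fun y => φ y + ψ y) := by
  refine ⟨hφ.1.add hψ.1, fun k => ?_⟩
  obtain ⟨M, hM⟩ := hφ.2 k
  obtain ⟨N, hN⟩ := hψ.2 k
  refine ⟨M + N, fun y => ?_⟩
  have : iteratedFDeriv ℝ k (fun y => φ y + ψ y) y
      = iteratedFDeriv ℝ k φ y + iteratedFDeriv ℝ k ψ y :=
    iteratedFDeriv_add_apply ((hφ.1.of_le (by exact_mod_cast le_top)).contDiffAt)
      ((hψ.1.of_le (by exact_mod_cast le_top)).contDiffAt)
  rw [this]
  exact (norm_add_le _ _).trans (add_le_add (hM y) (hN y))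

lemma HasBddDerivs.mul (hφ : HasBddDerivs φ) (hψ : HasBddDerivs ψ) :
    HasBddDerivs (fun y => φ y * ψ y) := by
  refine ⟨hφ.1.mul hψ.1, fun k => ?_⟩
  obtain ⟨M, hM0, hM⟩ := hφ.exists_bound_le k
  obtain ⟨N, hN0, hN⟩ := hψ.exists_bound_le k
  refine ⟨∑ i ∈ Finset.range (k + 1), (k.choose i : ℝ) * M * N, fun y => ?_⟩
  refine (norm_iteratedFDeriv_mul_le hφ.1 hψ.1 y (n := k) (by exact_mod_cast le_top)).trans ?_
  refine Finset.sum_le_sum fun i hi => ?_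
  rw [Finset.mem_range] at hi
  have h1 := hM i (by omega) y
  have h2 := hN (k - i) (by omega) y
  gcongr

lemma HasBddDerivs.comp {η : ℝ → ℝ} (hη : HasBddDerivs η) (hφ : HasBddDerivs φ) :
    HasBddDerivs (fun y => η (φ y)) := by
  refine ⟨hη.1.comp hφ.1, fun k => ?_⟩
  obtain ⟨M, hM0, hM⟩ := hφ.exists_bound_le k
  obtain ⟨N, hN0, hN⟩ := hη.exists_bound_le k
  -- The composition estimate asks for bounds of the form `R ^ i` on the `i`-th derivative of `φ`;
  -- `R = M + 1 ≥ 1` provides them for all `i ≥ 1` at once.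
  refine ⟨k.factorial * N * (M + 1) ^ k, fun y => ?_⟩
  refine norm_iteratedFDeriv_comp_le hη.1 hφ.1 (by exact_mod_cast le_top) y
    (fun i hi => hN i hi _) (fun i h1 hi => (hM i hi y).trans ?_)
  calc M ≤ M + 1 := by linarith
    _ ≤ (M + 1) ^ i := le_self_pow₀ (by linarith) (by omega)

lemma HasBddDerivs.const (c : ℝ) : HasBddDerivs (fun _ : E => c) := by
  refine ⟨contDiff_const, fun k => ⟨|c|, fun y => ?_⟩⟩
  rcases Nat.eq_zero_or_pos k with rfl | hk
  · simp
  · rw [iteratedFDeriv_const_of_ne (by omega)]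
    simp

lemma HasBddDerivs.fderiv_apply (hφ : HasBddDerivs φ) (v : E) :
    HasBddDerivs (fun y => fderiv ℝ φ y v) := by
  have hd : ContDiff ℝ ∞ (fderiv ℝ φ) := hφ.1.fderiv_right (by simp)
  refine ⟨hd.clm_apply contDiff_const, fun k => ?_⟩
  obtain ⟨M, hM⟩ := hφ.2 (k + 1)
  refine ⟨‖v‖ * M, fun y => ?_⟩
  refine (norm_iteratedFDeriv_clm_apply_const hd.contDiffAt
    (n := k) (by exact_mod_cast le_top)).trans ?_
  rw [norm_iteratedFDeriv_fderiv]
  gcongr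
  exact hM y

lemma HasBddDerivs.of_hasCompactSupport (h : ContDiff ℝ ∞ φ) (hc : HasCompactSupport φ) :
    HasBddDerivs φ := by
  refine ⟨h, fun k => ?_⟩
  have hk : HasCompactSupport (iteratedFDeriv ℝ k φ) := hc.iteratedFDeriv k
  obtain ⟨M, hM⟩ := hk.exists_bound_of_continuous
    (h.continuous_iteratedFDeriv (by exact_mod_cast le_top))
  exact ⟨M, hM⟩

lemma HasBddDerivs.sin : HasBddDerivs Real.sin := by
  refine ⟨Real.contDiff_sin, fun k => ⟨1, fun y => ?_⟩⟩
  rw [norm_iteratedFDeriv_eq_norm_iteratedDeriv, Real.norm_eq_abs]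
  exact Real.abs_iteratedDeriv_sin_le_one k y

end HasBddDerivs

/-- Freedom in the choice of the finite-dimensional target lets two cylindrical functions be
combined through the product of their targets, without concatenating coordinates. -/
lemma isSmoothCyl_of_finiteDimensional {E : Type*} [NormedAddCommGroup E] [NormedSpace ℝ E]
    [FiniteDimensional ℝ E] (T : X →L[ℝ] E) {φ : E → ℝ} (hφ : HasBddDerivs φ) :
    IsSmoothCyl (fun x => φ (T x)) := by
  let b : E ≃L[ℝ] (Fin (Module.finrank ℝ E) → ℝ) :=
    ContinuousLinearEquiv.ofFinrankEq (by simp)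
  have h := hφ.comp_clm (b.symm : (Fin (Module.finrank ℝ E) → ℝ) →L[ℝ] E)
  refine ⟨_, fun i => (ContinuousLinearMap.proj (φ := fun _ => ℝ) i).comp
    ((b : E →L[ℝ] (Fin (Module.finrank ℝ E) → ℝ)).comp T), _, h.1, h.2, fun x => ?_⟩
  simp only [ContinuousLinearEquiv.coe_coe]
  congr 1
  exact (b.symm_apply_apply (T x)).symm

lemma IsSmoothCyl.exists_clm {f : X → ℝ} (hf : IsSmoothCyl f) :
    ∃ (n : ℕ) (T : X →L[ℝ] (Fin n → ℝ)) (φ : (Fin n → ℝ) → ℝ), HasBddDerivs φ ∧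
      f = fun x => φ (T x) := by
  obtain ⟨n, l, φ, h1, h2, h3⟩ := hf
  exact ⟨n, ContinuousLinearMap.pi l, φ, ⟨h1, h2⟩, funext h3⟩

namespace IsSmoothCyl

variable {f g : X → ℝ}

lemma add (hf : IsSmoothCyl f) (hg : IsSmoothCyl g) : IsSmoothCyl (fun x => f x + g x) := by
  obtain ⟨n, T, φ, hφ, rfl⟩ := hf.exists_clm
  obtain ⟨m, S, ψ, hψ, rfl⟩ := hg.exists_clm
  exact isSmoothCyl_of_finiteDimensional (T.prod S)
    ((hφ.comp_clm (ContinuousLinearMap.fst ℝ _ _)).add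
      (hψ.comp_clm (ContinuousLinearMap.snd ℝ _ _)))

lemma mul (hf : IsSmoothCyl f) (hg : IsSmoothCyl g) : IsSmoothCyl (fun x => f x * g x) := by
  obtain ⟨n, T, φ, hφ, rfl⟩ := hf.exists_clm
  obtain ⟨m, S, ψ, hψ, rfl⟩ := hg.exists_clm
  exact isSmoothCyl_of_finiteDimensional (T.prod S)
    ((hφ.comp_clm (ContinuousLinearMap.fst ℝ _ _)).mul
      (hψ.comp_clm (ContinuousLinearMap.snd ℝ _ _)))

lemma comp (hf : IsSmoothCyl f) {η : ℝ → ℝ} (hη : HasBddDerivs η) :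
    IsSmoothCyl (fun x => η (f x)) := by
  obtain ⟨n, T, φ, hφ, rfl⟩ := hf.exists_clm
  exact isSmoothCyl_of_finiteDimensional T (hη.comp hφ)

lemma const (c : ℝ) : IsSmoothCyl (fun _ : X => c) :=
  isSmoothCyl_of_finiteDimensional (0 : X →L[ℝ] ℝ) (HasBddDerivs.const c)

lemma const_mul (hf : IsSmoothCyl f) (c : ℝ) : IsSmoothCyl (fun x => c * f x) :=
  (const c).mul hf

lemma sum {κ : Type*} (s : Finset κ) {f : κ → X → ℝ} (hf : ∀ i ∈ s, IsSmoothCyl (f i)) :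
    IsSmoothCyl (fun x => ∑ i ∈ s, f i x) := by
  classical
  induction s using Finset.induction_on with
  | empty => simpa using const (X := X) 0
  | insert a s ha ih =>
    simp only [Finset.sum_insert ha]
    exact (hf a (by simp)).add (ih fun i hi => hf i (by simp [hi]))

lemma contDiff (hf : IsSmoothCyl f) : ContDiff ℝ ∞ f := by
  obtain ⟨n, T, φ, hφ, rfl⟩ := hf.exists_clm
  exact hφ.1.comp T.contDiff

lemma differentiable (hf : IsSmoothCyl f) : Differentiable ℝ f :=
  hf.contDiff.differentiable (by simp)

lemma continuous (hf : IsSmoothCyl f) : Continuous f := hf.contDiff.continuous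

lemma fderiv_apply (hf : IsSmoothCyl f) (v : X) : IsSmoothCyl (fun x => fderiv ℝ f x v) := by
  obtain ⟨n, T, φ, hφ, rfl⟩ := hf.exists_clm
  have : (fun x => fderiv ℝ (fun x => φ (T x)) x v) = fun x => fderiv ℝ φ (T x) (T v) := by
    ext x
    have h1 : HasFDerivAt (fun x => φ (T x)) ((fderiv ℝ φ (T x)).comp T) x :=
      ((hφ.1.differentiable (by simp)) (T x)).hasFDerivAt.comp x T.hasFDerivAt
    rw [h1.fderiv]; rfl
  rw [this]
  exact isSmoothCyl_of_finiteDimensional T (hφ.fderiv_apply (T v))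

lemma exists_bound (hf : IsSmoothCyl f) : ∃ M : ℝ, ∀ x, ‖f x‖ ≤ M := by
  obtain ⟨n, T, φ, hφ, rfl⟩ := hf.exists_clm
  obtain ⟨M, hM⟩ := hφ.2 0
  exact ⟨M, fun x => by simpa using hM (T x)⟩

lemma exists_bound_fderiv (hf : IsSmoothCyl f) : ∃ M : ℝ, 0 ≤ M ∧ ∀ x, ‖fderiv ℝ f x‖ ≤ M := by
  obtain ⟨n, T, φ, hφ, rfl⟩ := hf.exists_clm
  obtain ⟨M, hM⟩ := hφ.2 1
  have hM0 : 0 ≤ M := (norm_nonneg _).trans (hM 0)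
  refine ⟨M * ‖T‖, by positivity, fun x => ?_⟩
  have h1 : HasFDerivAt (fun x => φ (T x)) ((fderiv ℝ φ (T x)).comp T) x :=
    ((hφ.1.differentiable (by simp)) (T x)).hasFDerivAt.comp x T.hasFDerivAt
  rw [h1.fderiv]
  refine (ContinuousLinearMap.opNorm_comp_le _ _).trans ?_
  gcongr
  simpa [norm_iteratedFDeriv_one] using hM (T x)

lemma memLp [SecondCountableTopology X] (hf : IsSmoothCyl f) {ρ : Measure X} [IsFiniteMeasure ρ]
    (p : ℝ≥0∞) : MemLp f p ρ := by
  obtain ⟨M, hM⟩ := hf.exists_bound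
  exact MemLp.of_bound hf.continuous.aestronglyMeasurable M (Eventually.of_forall hM)

/-- The second derivative of a smooth function is symmetric; this cancels the second-order terms in
the energy identity. -/
lemma fderiv_fderiv_comm (hf : IsSmoothCyl f) (x v v' : X) :
    fderiv ℝ (fun y => fderiv ℝ f y v) x v' = fderiv ℝ (fun y => fderiv ℝ f y v') x v := by
  have hd : DifferentiableAt ℝ (fderiv ℝ f) x :=
    ((hf.contDiff.fderiv_right (m := ∞) (by simp)).differentiable (by simp)) x
  have h := (hf.contDiff.contDiffAt (x := x)).isSymmSndFDerivAt
    (by rw [minSmoothness_of_isRCLikeNormedField]; exact WithTop.coe_le_coe.2 (le_top (a := (2 : ℕ∞))))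
  rw [fderiv_clm_apply hd (differentiableAt_const _), fderiv_clm_apply hd (differentiableAt_const _)]
  simpa using h.eq v' v

end IsSmoothCyl

section Gradient

variable [CompleteSpace X] [SecondCountableTopology X] {μ : Measure X} [IsGaussian μ]

lemma gradH_eq {f : X → ℝ} {x : X} (hf : DifferentiableAt ℝ f x) :
    gradH μ f x = (InnerProductSpace.toDual ℝ (CM μ)).symm ((fderiv ℝ f x).comp (CM.toXL μ)) := by
  have h0 : x + CM.toXL μ 0 = x := by simp
  have h1 : HasFDerivAt (fun k : CM μ => x + CM.toXL μ k) (CM.toXL μ) 0 :=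
    (CM.toXL μ).hasFDerivAt.const_add x
  have h2 : HasFDerivAt f (fderiv ℝ f x) (x + CM.toXL μ 0) := by
    rw [h0]; exact hf.hasFDerivAt
  have h3 := h2.comp (0 : CM μ) h1
  exact congrArg _ h3.fderiv

lemma inner_gradH {f : X → ℝ} {x : X} (hf : DifferentiableAt ℝ f x) (h : CM μ) :
    ⟪gradH μ f x, h⟫_ℝ = fderiv ℝ f x h.toX := by
  rw [gradH_eq hf, InnerProductSpace.toDual_symm_apply]
  rfl

lemma gradH_eq_fun {f : X → ℝ} (hf : IsSmoothCyl f) :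
    gradH μ f = fun x =>
      (InnerProductSpace.toDual ℝ (CM μ)).symm ((fderiv ℝ f x).comp (CM.toXL μ)) :=
  funext fun x => gradH_eq (hf.differentiable x)

lemma continuous_gradH {f : X → ℝ} (hf : IsSmoothCyl f) : Continuous (gradH μ f) := by
  rw [gradH_eq_fun hf]
  have hc : Continuous (fderiv ℝ f) := hf.contDiff.continuous_fderiv (by simp)
  exact (InnerProductSpace.toDual ℝ (CM μ)).symm.continuous.comp (hc.clm_comp continuous_const)

lemma memLp_gradH {f : X → ℝ} (hf : IsSmoothCyl f) {ρ : Measure X} [IsFiniteMeasure ρ]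
    (p : ℝ≥0∞) : MemLp (gradH μ f) p ρ := by
  obtain ⟨M, hM0, hM⟩ := hf.exists_bound_fderiv
  refine MemLp.of_bound (continuous_gradH hf).aestronglyMeasurable (M * ‖CM.toXL μ‖)
    (Eventually.of_forall fun x => ?_)
  rw [gradH_eq (hf.differentiable x), LinearIsometryEquiv.norm_map]
  refine (ContinuousLinearMap.opNorm_comp_le _ _).trans ?_
  gcongr
  exact hM x

lemma inner_hessH {f : X → ℝ} (hf : IsSmoothCyl f) (x : X) (h k : CM μ) :
    ⟪hessH μ f x h, k⟫_ℝ = fderiv ℝ (fun y => fderiv ℝ f y k.toX) x h.toX := by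
  have hd : DifferentiableAt ℝ (gradH μ f) x := by
    rw [gradH_eq_fun hf]
    have h1 : DifferentiableAt ℝ (fderiv ℝ f) x :=
      ((hf.contDiff.fderiv_right (m := ∞) (by simp)).differentiable (by simp)) x
    exact ((InnerProductSpace.toDual ℝ (CM μ)).symm.toContinuousLinearEquiv.differentiableAt).comp x
      (h1.clm_comp (differentiableAt_const _))
  have h0 : x + CM.toXL μ 0 = x := by simp
  have h1 : HasFDerivAt (fun k : CM μ => x + CM.toXL μ k) (CM.toXL μ) 0 :=
    (CM.toXL μ).hasFDerivAt.const_add x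
  have h2 : HasFDerivAt (gradH μ f) (fderiv ℝ (gradH μ f) x) (x + CM.toXL μ 0) := by
    rw [h0]; exact hd.hasFDerivAt
  have h5 := h2.comp (0 : CM μ) h1
  have h3 : hessH μ f x = (fderiv ℝ (gradH μ f) x).comp (CM.toXL μ) := h5.fderiv
  have h4 : (fun y => fderiv ℝ f y k.toX) = fun y => ⟪gradH μ f y, k⟫_ℝ :=
    funext fun y => (inner_gradH (hf.differentiable y) k).symm
  rw [h3, h4, fderiv_inner_apply ℝ hd (differentiableAt_const _)]
  simp [CM.toXL_apply]

variable {κ : Type*} [Fintype κ]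

lemma derivH_sum {f : κ → X → ℝ} (hf : ∀ i, IsSmoothCyl (f i)) (h : κ → CM μ) (x : X) :
    derivH (fun x => ∑ i, f i x • h i) x =
      ∑ i, ((fderiv ℝ (f i) x).comp (CM.toXL μ)).smulRight (h i) := by
  have h0 : x + CM.toXL μ 0 = x := by simp
  have h1 : HasFDerivAt (fun k : CM μ => x + CM.toXL μ k) (CM.toXL μ) 0 :=
    (CM.toXL μ).hasFDerivAt.const_add x
  refine HasFDerivAt.fderiv ?_
  refine HasFDerivAt.fun_sum fun i _ => ?_
  have h2 : HasFDerivAt (f i) (fderiv ℝ (f i) x) (x + CM.toXL μ 0) := by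
    rw [h0]; exact (hf i).differentiable x |>.hasFDerivAt
  exact (h2.comp (0 : CM μ) h1).smul_const (h i)

lemma derivH_sum_apply {f : κ → X → ℝ} (hf : ∀ i, IsSmoothCyl (f i)) (h : κ → CM μ) (x : X)
    (k : CM μ) :
    derivH (fun x => ∑ i, f i x • h i) x k = ∑ i, fderiv ℝ (f i) x k.toX • h i := by
  rw [derivH_sum hf]
  simp [CM.toXL_apply]

lemma continuous_derivH_sum {f : κ → X → ℝ} (hf : ∀ i, IsSmoothCyl (f i)) (h : κ → CM μ) :
    Continuous (derivH (fun x => ∑ i, f i x • h i)) := by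
  have : derivH (fun x => ∑ i, f i x • h i) = fun x =>
      ∑ i, ((fderiv ℝ (f i) x).comp (CM.toXL μ)).smulRight (h i) :=
    funext fun x => derivH_sum hf h x
  rw [this]
  refine continuous_finsetSum _ fun i _ => ?_
  have hc : Continuous (fderiv ℝ (f i)) := (hf i).contDiff.continuous_fderiv (by simp)
  have hc2 : Continuous fun x => (fderiv ℝ (f i) x).comp (CM.toXL μ) :=
    hc.clm_comp continuous_const
  exact ((ContinuousLinearMap.smulRightL ℝ (CM μ) (CM μ)).flip (h i)).continuous.comp hc2

lemma IsSmoothCylH.exists_sum {F : X → CM μ} (hF : IsSmoothCylH F) :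
    ∃ (n : ℕ) (f : Fin n → X → ℝ) (h : Fin n → CM μ), (∀ i, IsSmoothCyl (f i)) ∧
      F = fun x => ∑ i, f i x • h i := by
  induction hF using Submodule.span_induction with
  | mem F hF =>
    obtain ⟨f, h, hf, rfl⟩ := hF
    exact ⟨1, fun _ => f, fun _ => h, fun _ => hf, by simp⟩
  | zero => exact ⟨0, Fin.elim0, Fin.elim0, fun i => i.elim0, by ext; simp⟩
  | add F F' _ _ ih ih' =>
    obtain ⟨n, f, h, hf, rfl⟩ := ih
    obtain ⟨m, g, k, hg, rfl⟩ := ih'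
    refine ⟨n + m, Fin.append f g, Fin.append h k, fun i => ?_, ?_⟩
    · refine Fin.addCases (fun i => ?_) (fun i => ?_) i
      · simpa using hf i
      · simpa using hg i
    · ext x
      simp [Fin.sum_univ_add]
  | smul c F _ ih =>
    obtain ⟨n, f, h, hf, rfl⟩ := ih
    refine ⟨n, f, fun i => c • h i, hf, ?_⟩
    ext x
    simp [Finset.smul_sum, smul_comm c]

end Gradient

end Cylindrical

/-! ### Gaussian integration by parts. -/

section GaussianIntegrationByParts

variable [CompleteSpace X] [SecondCountableTopology X] {μ : Measure X} [IsGaussian μ]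

/-- For independent copies `x, y` the law of the pair is invariant under rotation, so the integral
of `f(cos θ x + sin θ y) L(-sin θ x + cos θ y)` equals its value `∫ f ∫ L = 0` at `θ = 0` for every
`θ`. Its derivative at `θ = 0` is the integral of `f'(x)(y) L(y) - f(x) L(x)`, and `∫ L(y) y dμ(y)`
is the vector of `H` given by `L`. -/
lemma integral_fderiv_ofDual (hcentered : ∀ L : StrongDual ℝ X, ∫ x, L x ∂μ = 0)
    {f : X → ℝ} (hf : IsSmoothCyl f) (L : StrongDual ℝ X) :
    ∫ x, fderiv ℝ f x (CM.ofDual μ L).toX ∂μ = ∫ x, f x * L x ∂μ := by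
  obtain ⟨M₀, hM₀⟩ := hf.exists_bound
  obtain ⟨M₁, hM₁0, hM₁⟩ := hf.exists_bound_fderiv
  have hM₀0 : 0 ≤ M₀ := (norm_nonneg _).trans (hM₀ 0)
  have hfd : Continuous (fderiv ℝ f) := hf.contDiff.continuous_fderiv (by simp)
  have hfc := hf.continuous
  -- differentiate the rotated integral, which is constant
  let F : ℝ → X × X → ℝ := fun θ p =>
    f (Real.cos θ • p.1 + Real.sin θ • p.2) * L (-Real.sin θ • p.1 + Real.cos θ • p.2)
  let F' : ℝ → X × X → ℝ := fun θ p =>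
    fderiv ℝ f (Real.cos θ • p.1 + Real.sin θ • p.2) (-Real.sin θ • p.1 + Real.cos θ • p.2)
      * L (-Real.sin θ • p.1 + Real.cos θ • p.2)
    + f (Real.cos θ • p.1 + Real.sin θ • p.2) * L (-Real.cos θ • p.1 + -Real.sin θ • p.2)
  have hconst : ∀ θ, ∫ p, F θ p ∂(μ.prod μ) = 0 := by
    intro θ
    have h1 := IsGaussian.map_rotation_eq_self_of_forall_strongDual_eq_zero hcentered θ
    have h2 : ∫ p : X × X, f p.1 * L p.2 ∂(μ.prod μ) = 0 := by
      rw [integral_prod_mul f (fun y => L y), hcentered L, mul_zero]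
    rw [← h1, integral_map (by fun_prop) (by fun_prop)] at h2
    rw [← h2]
    simp only [ContinuousLinearMap.rotation_apply, F]
  have hr2 : MemLp (fun p : X × X => ‖p.1‖ + ‖p.2‖) 2 (μ.prod μ) := by
    have h0 : MemLp (id : X → X) 2 μ := IsGaussian.memLp_id μ 2 (by simp)
    exact (h0.comp_measurePreserving measurePreserving_fst).norm.add
      (h0.comp_measurePreserving measurePreserving_snd).norm
  have hcomb : ∀ (a b : ℝ) (p : X × X), |a| ≤ 1 → |b| ≤ 1 →
      ‖a • p.1 + b • p.2‖ ≤ ‖p.1‖ + ‖p.2‖ := by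
    intro a b p ha hb
    refine (norm_add_le _ _).trans ?_
    rw [norm_smul, norm_smul, Real.norm_eq_abs, Real.norm_eq_abs]
    exact add_le_add (mul_le_of_le_one_left (norm_nonneg _) ha)
      (mul_le_of_le_one_left (norm_nonneg _) hb)
  have hsin : ∀ θ, |-Real.sin θ| ≤ 1 := fun θ => by rw [abs_neg]; exact Real.abs_sin_le_one θ
  have hcos : ∀ θ, |-Real.cos θ| ≤ 1 := fun θ => by rw [abs_neg]; exact Real.abs_cos_le_one θ
  -- Rotated points have norm at most `‖x‖ + ‖y‖` whatever the angle, and this sum is square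
  -- integrable; the domination is therefore uniform in `θ`.
  let bound : X × X → ℝ := fun p =>
    M₁ * ‖L‖ * (‖p.1‖ + ‖p.2‖) ^ 2 + M₀ * ‖L‖ * (‖p.1‖ + ‖p.2‖)
  have hbound : Integrable bound (μ.prod μ) :=
    (hr2.integrable_sq.const_mul _).add ((hr2.integrable (by norm_num)).const_mul _)
  have hFmeas : ∀ θ, AEStronglyMeasurable (F θ) (μ.prod μ) := fun θ =>
    Continuous.aestronglyMeasurable (by fun_prop)
  have hF'c : Continuous (F' 0) := by
    refine Continuous.add (Continuous.mul (Continuous.clm_apply ?_ ?_) ?_) ?_ <;> fun_prop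
  have hFint : Integrable (F 0) (μ.prod μ) := by
    refine Integrable.mono' ((hr2.integrable (by norm_num)).const_mul (M₀ * ‖L‖)) (hFmeas 0)
      (Eventually.of_forall fun p => ?_)
    simp only [F, norm_mul]
    rw [mul_assoc]
    refine mul_le_mul (hM₀ _) ((L.le_opNorm _).trans ?_) (norm_nonneg _) hM₀0
    gcongr
    exact hcomb _ _ _ (hsin 0) (Real.abs_cos_le_one 0)
  have hmain := (hasDerivAt_integral_of_dominated_loc_of_deriv_le (μ := μ.prod μ) (F := F)
    (F' := F') (x₀ := (0 : ℝ)) (s := Set.univ) (bound := bound) univ_mem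
    (Eventually.of_forall hFmeas) hFint hF'c.aestronglyMeasurable
    (Eventually.of_forall fun p θ _ => ?_) hbound (Eventually.of_forall fun p θ _ => ?_))
  · have hzero : ∫ p, F' 0 p ∂(μ.prod μ) = 0 := by
      have h1 := hmain.2
      simp only [hconst] at h1
      exact h1.unique (hasDerivAt_const 0 (0 : ℝ))
    have hL : MemLp L 2 μ := IsGaussian.memLp_dual μ L 2 (by simp)
    have hA : Integrable (fun p : X × X => fderiv ℝ f p.1 p.2 * L p.2) (μ.prod μ) := by
      refine Integrable.mono' (hr2.integrable_sq.const_mul (M₁ * ‖L‖))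
        (Continuous.aestronglyMeasurable ?_) (Eventually.of_forall fun p => ?_)
      · refine Continuous.mul (Continuous.clm_apply ?_ ?_) ?_ <;> fun_prop
      · have h1 : ‖p.2‖ ≤ ‖p.1‖ + ‖p.2‖ := by linarith [norm_nonneg p.1]
        calc ‖fderiv ℝ f p.1 p.2 * L p.2‖ ≤ (M₁ * ‖p.2‖) * (‖L‖ * ‖p.2‖) := by
              rw [norm_mul]
              exact mul_le_mul ((ContinuousLinearMap.le_opNorm _ _).trans
                (by gcongr; exact hM₁ _)) (L.le_opNorm _) (norm_nonneg _) (by positivity)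
          _ = M₁ * ‖L‖ * ‖p.2‖ ^ 2 := by ring
          _ ≤ _ := by gcongr
    have hB0 : Integrable (fun x => f x * L x) μ :=
      (hf.memLp 2).integrable_mul hL
    have hB : Integrable (fun p : X × X => f p.1 * L p.1) (μ.prod μ) := hB0.comp_fst μ
    have hF0 : ∀ p, F' 0 p = fderiv ℝ f p.1 p.2 * L p.2 - f p.1 * L p.1 := by
      intro p
      simp [F', sub_eq_add_neg]
    simp only [hF0] at hzero
    rw [integral_sub hA hB, integral_prod _ hA, integral_prod _ hB, sub_eq_zero] at hzero
    simp only [integral_const, probReal_univ, one_smul] at hzero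
    rw [← hzero]
    refine integral_congr_ae (Eventually.of_forall fun x => ?_)
    simp only
    rw [CM.dual_toX]
    refine integral_congr_ae ?_
    filter_upwards [CM.hat_ofDual (μ := μ) L] with y hy
    rw [hy]
  · have hr := hcomb (-Real.sin θ) (Real.cos θ) p (hsin θ) (Real.abs_cos_le_one θ)
    have hr' := hcomb (-Real.cos θ) (-Real.sin θ) p (hcos θ) (hsin θ)
    refine (norm_add_le _ _).trans (add_le_add ?_ ?_)
    · rw [norm_mul]
      calc _ ≤ (M₁ * (‖p.1‖ + ‖p.2‖)) * (‖L‖ * (‖p.1‖ + ‖p.2‖)) := by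
            refine mul_le_mul ((ContinuousLinearMap.le_opNorm _ _).trans ?_)
              ((L.le_opNorm _).trans ?_) (norm_nonneg _) (by positivity)
            · exact mul_le_mul (hM₁ _) hr (norm_nonneg _) hM₁0
            · gcongr
        _ = _ := by ring
    · rw [norm_mul, mul_assoc]
      refine mul_le_mul (hM₀ _) ((L.le_opNorm _).trans ?_) (norm_nonneg _) hM₀0
      gcongr
  · have hc := (Real.hasDerivAt_cos θ)
    have hs := (Real.hasDerivAt_sin θ)
    have h1 : HasDerivAt (fun θ => Real.cos θ • p.1 + Real.sin θ • p.2)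
        (-Real.sin θ • p.1 + Real.cos θ • p.2) θ := (hc.smul_const p.1).add (hs.smul_const p.2)
    have h2 : HasDerivAt (fun θ => -Real.sin θ • p.1 + Real.cos θ • p.2)
        (-Real.cos θ • p.1 + -Real.sin θ • p.2) θ :=
      (hs.neg.smul_const p.1).add (hc.smul_const p.2)
    have h3 := ((hf.differentiable (Real.cos θ • p.1 + Real.sin θ • p.2)).hasFDerivAt).comp_hasDerivAt
      θ h1
    have h4 := L.hasFDerivAt.comp_hasDerivAt θ h2
    exact h3.mul h4

/-- Integration by parts along the Cameron–Martin space. -/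
lemma integral_fderiv_toX (hcentered : ∀ L : StrongDual ℝ X, ∫ x, L x ∂μ = 0)
    {f : X → ℝ} (hf : IsSmoothCyl f) (h : CM μ) :
    ∫ x, fderiv ℝ f x h.toX ∂μ = ∫ x, f x * h.hat x ∂μ := by
  have hint : ∀ x, ∀ k : CM μ, fderiv ℝ f x k.toX = ⟪k, gradH μ f x⟫_ℝ := fun x k => by
    rw [real_inner_comm, inner_gradH (hf.differentiable x)]
  have hg : Integrable (gradH μ f) μ := (memLp_gradH hf 1).integrable le_rfl
  have h1 : ∀ k : CM μ, ∫ x, fderiv ℝ f x k.toX ∂μ = ⟪k, ∫ x, gradH μ f x ∂μ⟫_ℝ := fun k => by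
    simp only [hint]
    exact integral_inner hg k
  have h2 : ∀ k : CM μ, ∫ x, f x * k.hat x ∂μ = ⟪CM.hatₗᵢ μ k, (hf.memLp (ρ := μ) 2).toLp f⟫_ℝ := by
    intro k
    rw [L2.inner_def]
    refine integral_congr_ae ?_
    filter_upwards [(hf.memLp (ρ := μ) 2).coeFn_toLp] with x hx
    simp [hx, CM.hat]
  rw [h1, h2]
  -- Both sides are now continuous linear in `h`, so it suffices to check functionals.
  refine CM.denseRange_ofDual.induction_on (p := fun h : CM μ => ⟪h, ∫ x, gradH μ f x ∂μ⟫_ℝ =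
    ⟪CM.hatₗᵢ μ h, (hf.memLp (ρ := μ) 2).toLp f⟫_ℝ) h ?_ ?_
  · refine isClosed_eq (by fun_prop) ?_
    exact ((CM.hatₗᵢ μ).continuous).inner continuous_const
  · intro L
    rw [← h1, ← h2, integral_fderiv_ofDual hcentered hf]
    refine integral_congr_ae ?_
    filter_upwards [CM.hat_ofDual (μ := μ) L] with y hy
    rw [hy]

end GaussianIntegrationByParts

/-! ### Passing to the limit in integrals of products. -/

section SquareIntegrable

variable {Ω : Type*} [MeasurableSpace Ω] {ρ : Measure Ω}

/-- Continuity of the inner product of `L²`, phrased for functions instead of classes. -/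
lemma tendsto_integral_inner {E : Type*} [NormedAddCommGroup E] [InnerProductSpace ℝ E]
    {a b : Ω → E} {as bs : ℕ → Ω → E}
    (ha : MemLp a 2 ρ) (hb : MemLp b 2 ρ) (has : ∀ k, MemLp (as k) 2 ρ)
    (hbs : ∀ k, MemLp (bs k) 2 ρ)
    (hla : Tendsto (fun k => eLpNorm (fun x => a x - as k x) 2 ρ) atTop (𝓝 0))
    (hlb : Tendsto (fun k => eLpNorm (fun x => b x - bs k x) 2 ρ) atTop (𝓝 0)) :
    Tendsto (fun k => ∫ x, ⟪as k x, bs k x⟫_ℝ ∂ρ) atTop (𝓝 (∫ x, ⟪a x, b x⟫_ℝ ∂ρ)) := by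
  have key : ∀ {u : Ω → E} {us : ℕ → Ω → E} (hu : MemLp u 2 ρ) (hus : ∀ k, MemLp (us k) 2 ρ),
      Tendsto (fun k => eLpNorm (fun x => u x - us k x) 2 ρ) atTop (𝓝 0) →
      Tendsto (fun k => (hus k).toLp (us k)) atTop (𝓝 (hu.toLp u)) := by
    intro u us hu hus hl
    rw [Lp.tendsto_Lp_iff_tendsto_eLpNorm'' us hus u hu]
    refine hl.congr fun k => ?_
    exact eLpNorm_sub_comm u (us k) 2 ρ
  have hint : ∀ {u v : Ω → E} (hu : MemLp u 2 ρ) (hv : MemLp v 2 ρ),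
      ⟪hu.toLp u, hv.toLp v⟫_ℝ = ∫ x, ⟪u x, v x⟫_ℝ ∂ρ := by
    intro u v hu hv
    rw [L2.inner_def]
    refine integral_congr_ae ?_
    filter_upwards [hu.coeFn_toLp, hv.coeFn_toLp] with x h1 h2
    rw [h1, h2]
  have := (key ha has hla).inner (𝕜 := ℝ) (key hb hbs hlb)
  simpa only [hint] using this

lemma tendsto_integral_mul {a b : Ω → ℝ} {as bs : ℕ → Ω → ℝ}
    (ha : MemLp a 2 ρ) (hb : MemLp b 2 ρ) (has : ∀ k, MemLp (as k) 2 ρ)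
    (hbs : ∀ k, MemLp (bs k) 2 ρ)
    (hla : Tendsto (fun k => eLpNorm (fun x => a x - as k x) 2 ρ) atTop (𝓝 0))
    (hlb : Tendsto (fun k => eLpNorm (fun x => b x - bs k x) 2 ρ) atTop (𝓝 0)) :
    Tendsto (fun k => ∫ x, as k x * bs k x ∂ρ) atTop (𝓝 (∫ x, a x * b x ∂ρ)) := by
  simpa [mul_comm] using tendsto_integral_inner ha hb has hbs hla hlb

lemma tendsto_integral_mul_right {a b : Ω → ℝ} {as : ℕ → Ω → ℝ}
    (ha : MemLp a 2 ρ) (hb : MemLp b 2 ρ) (has : ∀ k, MemLp (as k) 2 ρ)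
    (hla : Tendsto (fun k => eLpNorm (fun x => a x - as k x) 2 ρ) atTop (𝓝 0)) :
    Tendsto (fun k => ∫ x, as k x * b x ∂ρ) atTop (𝓝 (∫ x, a x * b x ∂ρ)) :=
  tendsto_integral_mul ha hb has (fun _ => hb) hla (by simp)

/-- A function dominated by a constant multiple of another one tends to zero along with it. -/
lemma tendsto_eLpNorm_of_le {E F : Type*} [ENorm E] [ENorm F] {a : ℕ → Ω → E}
    {b : ℕ → Ω → F} {p : ℝ≥0∞} {c : ℝ≥0∞} (hc : c ≠ ⊤)
    (hle : ∀ k, eLpNorm (a k) p ρ ≤ c * eLpNorm (b k) p ρ)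
    (hb : Tendsto (fun k => eLpNorm (b k) p ρ) atTop (𝓝 0)) :
    Tendsto (fun k => eLpNorm (a k) p ρ) atTop (𝓝 0) := by
  have h := ENNReal.Tendsto.const_mul hb (Or.inr hc)
  rw [mul_zero] at h
  exact tendsto_of_tendsto_of_tendsto_of_le_of_le tendsto_const_nhds h (fun _ => zero_le) hle

lemma eLpNorm_le_mul_of_norm_le {E F : Type*} [NormedAddCommGroup E] [NormedAddCommGroup F]
    {a : Ω → E} {b : Ω → F} {p : ℝ≥0∞} {M : ℝ} (h : ∀ x, ‖a x‖ ≤ M * ‖b x‖) :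
    eLpNorm a p ρ ≤ ENNReal.ofReal M * eLpNorm b p ρ :=
  eLpNorm_le_mul_eLpNorm_of_ae_le_mul (Eventually.of_forall h) p

end SquareIntegrable

lemma IsSmoothCyl.mul_memLp [SecondCountableTopology X] {f : X → ℝ} (hf : IsSmoothCyl f)
    {ρ : Measure X} [IsFiniteMeasure ρ] {a : X → ℝ} (ha : MemLp a 2 ρ) :
    MemLp (fun x => f x * a x) 2 ρ :=
  ha.mul' (hf.memLp ⊤)

lemma HasBddDerivs.exists_lipschitz {η : ℝ → ℝ} (hη : HasBddDerivs η) :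
    ∃ M : ℝ, ∀ a b, ‖η a - η b‖ ≤ M * ‖a - b‖ := by
  obtain ⟨M, hM⟩ := hη.2 1
  refine ⟨M, fun a b => ?_⟩
  refine Convex.norm_image_sub_le_of_norm_deriv_le (s := Set.univ)
    (fun x _ => (hη.1.differentiable (by simp)) x) (fun x _ => ?_) convex_univ trivial trivial
  have := hM x
  rwa [norm_iteratedFDeriv_eq_norm_iteratedDeriv, iteratedDeriv_one] at this

lemma HasBddDerivs.deriv {η : ℝ → ℝ} (hη : HasBddDerivs η) : HasBddDerivs (deriv η) :=
  hη.fderiv_apply 1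

lemma HasBddDerivs.exists_bound {η : ℝ → ℝ} (hη : HasBddDerivs η) :
    ∃ M : ℝ, ∀ a, ‖η a‖ ≤ M := by
  obtain ⟨M, hM⟩ := hη.2 0
  exact ⟨M, fun a => by simpa using hM a⟩

lemma HasBddDerivs.memLp_comp {Ω : Type*} [MeasurableSpace Ω] {ρ : Measure Ω} [IsFiniteMeasure ρ]
    {η : ℝ → ℝ} (hη : HasBddDerivs η) {u : Ω → ℝ} (hu : AEStronglyMeasurable u ρ) (p : ℝ≥0∞) :
    MemLp (fun x => η (u x)) p ρ := by
  obtain ⟨M, hM⟩ := hη.exists_bound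
  exact MemLp.of_bound (hη.1.continuous.comp_aestronglyMeasurable hu) M
    (Eventually.of_forall fun x => hM _)

/-! ### Smooth cutoffs of the exponential. -/

section Truncation

/-- Smooth compactly supported approximations of the exponential. -/
def expCutoff (n : ℕ) (y : ℝ) : ℝ :=
  Real.exp y * (⟨1, 2, one_pos, one_lt_two⟩ : ContDiffBump (0 : ℝ)) (y / (n + 1))

lemma hasBddDerivs_expCutoff (n : ℕ) : HasBddDerivs (expCutoff n) := by
  refine HasBddDerivs.of_hasCompactSupport ?_ ?_
  · refine Real.contDiff_exp.mul ?_
    exact (ContDiffBump.contDiff _).comp (contDiff_id.div_const _)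
  · refine HasCompactSupport.mul_left ?_
    have h := (⟨1, 2, one_pos, one_lt_two⟩ : ContDiffBump (0 : ℝ)).hasCompactSupport
    have hn : ((n : ℝ) + 1) ≠ 0 := by positivity
    exact h.comp_homeomorph (Homeomorph.mulRight₀ _ (inv_ne_zero hn))

lemma tendsto_expCutoff (y : ℝ) : Tendsto (fun n => expCutoff n y) atTop (𝓝 (Real.exp y)) := by
  let χ : ContDiffBump (0 : ℝ) := ⟨1, 2, one_pos, one_lt_two⟩
  have h0 : Tendsto (fun n : ℕ => y / ((n : ℝ) + 1)) atTop (𝓝 0) :=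
    tendsto_const_div_atTop_nhds_zero_nat y |>.comp (tendsto_add_atTop_nat 1) |>.congr
      (fun n => by simp)
  have h1 : Tendsto (fun n : ℕ => χ (y / ((n : ℝ) + 1))) atTop (𝓝 (χ 0)) :=
    (χ.continuous.tendsto 0).comp h0
  have h2 : χ 0 = 1 := χ.one_of_mem_closedBall (by simp [χ])
  rw [h2] at h1
  simpa [expCutoff, χ] using h1.const_mul (Real.exp y)

lemma abs_expCutoff_le (n : ℕ) (y : ℝ) : |expCutoff n y| ≤ Real.exp y := by
  unfold expCutoff
  rw [abs_mul, Real.abs_exp]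
  refine mul_le_of_le_one_right (Real.exp_pos y).le ?_
  rw [abs_of_nonneg (ContDiffBump.nonneg _)]
  exact ContDiffBump.le_one _

/-- Differentiating the cutoff `χ(y / (n + 1))` costs a factor `1 / (n + 1)`, so the extra term is
at most a constant times `exp y` and vanishes in the limit. At `y = log w` this is a domination by a
multiple of `w`, uniform in `n`. -/
lemma exists_deriv_expCutoff : ∃ M : ℝ, 0 ≤ M ∧
    (∀ n y, |deriv (expCutoff n) y| ≤ M * Real.exp y) ∧
    ∀ y, Tendsto (fun n => deriv (expCutoff n) y) atTop (𝓝 (Real.exp y)) := by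
  let χ : ContDiffBump (0 : ℝ) := ⟨1, 2, one_pos, one_lt_two⟩
  have hχ : HasBddDerivs χ := HasBddDerivs.of_hasCompactSupport χ.contDiff χ.hasCompactSupport
  obtain ⟨M, hM⟩ := hχ.deriv.exists_bound
  have hM0 : 0 ≤ M := (norm_nonneg _).trans (hM 0)
  have hder : ∀ (n : ℕ) (y : ℝ), deriv (expCutoff n) y =
      expCutoff n y + Real.exp y * (deriv χ (y / (n + 1)) * (1 / (n + 1))) := by
    intro n y
    have h1 : HasDerivAt (fun y => χ (y / ((n : ℝ) + 1)))
        (deriv χ (y / (n + 1)) * (1 / (n + 1))) y :=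
      HasDerivAt.comp (h₂ := fun z => χ z) y
        ((hχ.1.differentiable (by simp)) (y / (n + 1))).hasDerivAt
        ((hasDerivAt_id y).div_const _)
    exact ((Real.hasDerivAt_exp y).mul h1).deriv
  have hle : ∀ (n : ℕ) (y : ℝ), ‖deriv χ (y / (n + 1)) * (1 / (n + 1))‖ ≤ M * (1 / (n + 1)) := by
    intro n y
    rw [norm_mul]
    gcongr
    · exact hM _
    · rw [Real.norm_of_nonneg (by positivity)]
  refine ⟨1 + M, by positivity, fun n y => ?_, fun y => ?_⟩
  · rw [hder, add_mul, one_mul]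
    refine (abs_add_le _ _).trans (add_le_add (abs_expCutoff_le n y) ?_)
    rw [abs_mul, Real.abs_exp, mul_comm]
    refine mul_le_mul_of_nonneg_right ((hle n y).trans ?_) (Real.exp_pos y).le
    refine mul_le_of_le_one_right hM0 ?_
    rw [div_le_one (by positivity)]
    linarith [(Nat.cast_nonneg n : (0 : ℝ) ≤ n)]
  · simp only [hder]
    have h2 : Tendsto (fun n : ℕ => M * (1 / ((n : ℝ) + 1))) atTop (𝓝 0) := by
      simpa using tendsto_one_div_add_atTop_nhds_zero_nat.const_mul M
    have h3 := squeeze_zero_norm (fun n => hle n y) h2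
    simpa using (tendsto_expCutoff y).add (h3.const_mul (Real.exp y))

end Truncation

/-! ### The weighted measure and the embedding of `L^t(μ)` in `L²(ν)`. -/

section Weighted

variable [SecondCountableTopology X] {μ : Measure X} {w : X → ℝ} {s t : ℝ}

lemma weighted_absolutelyContinuous : weighted μ w ≪ μ := withDensity_absolutelyContinuous _ _

lemma integral_weighted (hw_pos : ∀ᵐ x ∂μ, 0 < w x) (hwm : AEStronglyMeasurable w μ)
    (g : X → ℝ) : ∫ x, g x ∂(weighted μ w) = ∫ x, w x * g x ∂μ := by
  rw [weighted, integral_withDensity_eq_integral_toReal_smul₀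
    hwm.aemeasurable.ennreal_ofReal (by simp)]
  refine integral_congr_ae ?_
  filter_upwards [hw_pos] with x hx
  simp [ENNReal.toReal_ofReal hx.le]

lemma integrable_weighted_iff (hw_pos : ∀ᵐ x ∂μ, 0 < w x) (hwm : AEStronglyMeasurable w μ)
    {g : X → ℝ} : Integrable g (weighted μ w) ↔ Integrable (fun x => w x * g x) μ := by
  rw [weighted, integrable_withDensity_iff_integrable_smul₀'
    hwm.aemeasurable.ennreal_ofReal (by simp)]
  refine integrable_congr ?_
  filter_upwards [hw_pos] with x hx
  simp [ENNReal.toReal_ofReal hx.le]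

/-- Hölder's inequality with exponents `s` and `s'` bounds `∫ w |g|² dμ` by `‖w‖_s ‖g‖²_{2s'}`; then
`2 s' ≤ t` and `μ` is a probability measure. -/
lemma eLpNorm_weighted_le [IsProbabilityMeasure μ] {E : Type*} [NormedAddCommGroup E]
    (hs : 1 < s) (ht : 2 * (s / (s - 1)) ≤ t)
    (hw : MemLp w (ENNReal.ofReal s) μ) {g : X → E} (hg : AEStronglyMeasurable g μ) :
    eLpNorm g 2 (weighted μ w) ≤
      (eLpNorm w (ENNReal.ofReal s) μ) ^ (1 / 2 : ℝ) * eLpNorm g (ENNReal.ofReal t) μ := by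
  have hs0 : 0 < s := by linarith
  set s' : ℝ := s / (s - 1) with hs'
  have hconj : s.HolderConjugate s' := Real.HolderConjugate.conjExponent hs
  have hs'0 : 0 < s' := hconj.symm.pos
  have h1 : eLpNorm g 2 (weighted μ w) =
      (∫⁻ x, ENNReal.ofReal (w x) * ‖g x‖ₑ ^ (2 : ℝ) ∂μ) ^ (1 / 2 : ℝ) := by
    rw [eLpNorm_eq_lintegral_rpow_enorm_toReal (by simp) (by simp), weighted,
      lintegral_withDensity_eq_lintegral_mul₀ hw.1.aemeasurable.ennreal_ofReal
        (hg.enorm.pow_const _)]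
    simp
  have h2 : ∫⁻ x, ENNReal.ofReal (w x) * ‖g x‖ₑ ^ (2 : ℝ) ∂μ ≤
      (∫⁻ x, ‖w x‖ₑ ^ s ∂μ) ^ (1 / s) * (∫⁻ x, (‖g x‖ₑ ^ (2 : ℝ)) ^ s' ∂μ) ^ (1 / s') := by
    refine (lintegral_mono fun x => ?_).trans (ENNReal.lintegral_mul_le_Lp_mul_Lq μ hconj
      hw.1.enorm (hg.enorm.pow_const _))
    simp only [Pi.mul_apply]
    gcongr
    exact Real.ofReal_le_enorm _
  have h3 : (∫⁻ x, ‖w x‖ₑ ^ s ∂μ) ^ (1 / s) = eLpNorm w (ENNReal.ofReal s) μ := by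
    rw [eLpNorm_eq_lintegral_rpow_enorm_toReal (by simpa using hs0) (by simp),
      ENNReal.toReal_ofReal hs0.le]
  have h4 : (∫⁻ x, (‖g x‖ₑ ^ (2 : ℝ)) ^ s' ∂μ) ^ (1 / s') =
      (eLpNorm g (ENNReal.ofReal (2 * s')) μ) ^ (2 : ℝ) := by
    rw [eLpNorm_eq_lintegral_rpow_enorm_toReal (by simpa using hs'0) ENNReal.ofReal_ne_top,
      ENNReal.toReal_ofReal (by positivity), ← ENNReal.rpow_mul]
    simp only [← ENNReal.rpow_mul]
    congr 1
    field_simp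
  rw [h1]
  calc _ ≤ (eLpNorm w (ENNReal.ofReal s) μ * (eLpNorm g (ENNReal.ofReal (2 * s')) μ) ^ (2 : ℝ))
          ^ (1 / 2 : ℝ) := by
        refine ENNReal.rpow_le_rpow ?_ (by norm_num)
        rwa [h3, h4] at h2
    _ = (eLpNorm w (ENNReal.ofReal s) μ) ^ (1 / 2 : ℝ) * eLpNorm g (ENNReal.ofReal (2 * s')) μ := by
        rw [ENNReal.mul_rpow_of_nonneg _ _ (by norm_num), ← ENNReal.rpow_mul]
        norm_num
    _ ≤ _ := by
        gcongr
        exact eLpNorm_le_eLpNorm_of_exponent_le (ENNReal.ofReal_le_ofReal ht) hg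

lemma memLp_weighted [IsProbabilityMeasure μ] {E : Type*} [NormedAddCommGroup E]
    (hs : 1 < s) (ht : 2 * (s / (s - 1)) ≤ t) (hw : MemLp w (ENNReal.ofReal s) μ)
    {g : X → E} (hg : MemLp g (ENNReal.ofReal t) μ) : MemLp g 2 (weighted μ w) := by
  refine ⟨hg.1.mono_ac weighted_absolutelyContinuous, ?_⟩
  refine (eLpNorm_weighted_le hs ht hw hg.1).trans_lt ?_
  exact ENNReal.mul_lt_top (ENNReal.rpow_lt_top_of_nonneg (by norm_num) hw.2.ne) hg.2

lemma isFiniteMeasure_weighted [IsProbabilityMeasure μ] (hs : 1 < s)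
    (hw : MemLp w (ENNReal.ofReal s) μ) : IsFiniteMeasure (weighted μ w) := by
  have h : Integrable w μ := hw.integrable (by simpa using hs.le)
  exact isFiniteMeasure_withDensity_ofReal h.2

lemma tendsto_eLpNorm_weighted [IsProbabilityMeasure μ] {E : Type*} [NormedAddCommGroup E]
    (hs : 1 < s) (ht : 2 * (s / (s - 1)) ≤ t) (hw : MemLp w (ENNReal.ofReal s) μ)
    {g : ℕ → X → E} (hg : ∀ k, AEStronglyMeasurable (g k) μ)
    (hl : Tendsto (fun k => eLpNorm (g k) (ENNReal.ofReal t) μ) atTop (𝓝 0)) :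
    Tendsto (fun k => eLpNorm (g k) 2 (weighted μ w)) atTop (𝓝 0) := by
  have h := ENNReal.Tendsto.const_mul (a := (eLpNorm w (ENNReal.ofReal s) μ) ^ (1 / 2 : ℝ)) hl
    (Or.inr (ENNReal.rpow_lt_top_of_nonneg (by norm_num) hw.2.ne).ne)
  rw [mul_zero] at h
  exact tendsto_of_tendsto_of_tendsto_of_le_of_le tendsto_const_nhds h (fun _ => zero_le)
    fun k => eLpNorm_weighted_le hs ht hw (hg k)

end Weighted

/-! ### Integration by parts for the weighted measure. -/

section WeightedIntegrationByParts

variable [CompleteSpace X] [SecondCountableTopology X] {μ : Measure X} [IsGaussian μ]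

lemma integrable_mul_of_memLp {Ω : Type*} [MeasurableSpace Ω] {ρ : Measure Ω} {a b : Ω → ℝ}
    (ha : MemLp a 2 ρ) (hb : MemLp b 2 ρ) : Integrable (fun x => a x * b x) ρ :=
  ha.integrable_mul hb

lemma IsSmoothCyl.fderiv_mul_apply {f g : X → ℝ} (hf : IsSmoothCyl f) (hg : IsSmoothCyl g)
    (x v : X) : fderiv ℝ (fun x => f x * g x) x v =
      fderiv ℝ f x v * g x + f x * fderiv ℝ g x v := by
  rw [fderiv_fun_mul (hf.differentiable x) (hg.differentiable x)]
  simp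
  ring

/-- Dominated convergence: `θ_n(log w)` tends to `w` and is at most `M w` in absolute value. It
serves both for the cutoff exponentials and for their derivatives. -/
lemma tendsto_integral_comp_log {w : X → ℝ} (hw_pos : ∀ᵐ x ∂μ, 0 < w x)
    (hwm : AEStronglyMeasurable w μ) {θ : ℕ → ℝ → ℝ} (hθc : ∀ n, Continuous (θ n)) {M : ℝ}
    (hθ : ∀ n y, |θ n y| ≤ M * Real.exp y)
    (hlim : ∀ y, Tendsto (fun n => θ n y) atTop (𝓝 (Real.exp y)))
    {b : X → ℝ} (hbm : AEStronglyMeasurable b μ) (hb : Integrable b (weighted μ w)) :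
    Tendsto (fun n => ∫ x, θ n (Real.log (w x)) * b x ∂μ) atTop
      (𝓝 (∫ x, b x ∂(weighted μ w))) := by
  rw [integral_weighted hw_pos hwm]
  have hlogm : AEStronglyMeasurable (fun x => Real.log (w x)) μ :=
    (Real.measurable_log.comp_aemeasurable hwm.aemeasurable).aestronglyMeasurable
  refine tendsto_integral_of_dominated_convergence (fun x => M * ‖w x * b x‖)
    (fun n => ((hθc n).comp_aestronglyMeasurable hlogm).mul hbm)
    (((integrable_weighted_iff hw_pos hwm).1 hb).norm.const_mul M) (fun n => ?_) ?_
  · filter_upwards [hw_pos] with x hx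
    have h1 := hθ n (Real.log (w x))
    rw [Real.exp_log hx] at h1
    rw [norm_mul, norm_mul, Real.norm_eq_abs, Real.norm_of_nonneg hx.le, ← mul_assoc]
    gcongr
  · filter_upwards [hw_pos] with x hx
    have h1 := hlim (Real.log (w x))
    rw [Real.exp_log hx] at h1
    exact h1.mul_const (b x)

lemma tendsto_eLpNorm_inner_sub {ρ : Measure X} {p : ℝ≥0∞} {G : X → CM μ} {Gs : ℕ → X → CM μ}
    (hl : Tendsto (fun k => eLpNorm (fun x => G x - Gs k x) p ρ) atTop (𝓝 0)) (h : CM μ) :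
    Tendsto (fun k => eLpNorm (fun x => ⟪G x, h⟫_ℝ - ⟪Gs k x, h⟫_ℝ) p ρ) atTop (𝓝 0) := by
  refine tendsto_eLpNorm_of_le (c := ENNReal.ofReal ‖h‖) ENNReal.ofReal_ne_top (fun k => ?_) hl
  refine eLpNorm_le_mul_of_norm_le fun x => ?_
  rw [← inner_sub_left, mul_comm]
  exact norm_inner_le_norm _ _

lemma tendsto_eLpNorm_smoothCyl_mul {ρ : Measure X} {p : ℝ≥0∞} {f : X → ℝ} (hf : IsSmoothCyl f)
    {a : X → ℝ} {as : ℕ → X → ℝ}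
    (hl : Tendsto (fun k => eLpNorm (fun x => a x - as k x) p ρ) atTop (𝓝 0)) :
    Tendsto (fun k => eLpNorm (fun x => f x * a x - f x * as k x) p ρ) atTop (𝓝 0) := by
  obtain ⟨M, hM⟩ := hf.exists_bound
  refine tendsto_eLpNorm_of_le (c := ENNReal.ofReal M) ENNReal.ofReal_ne_top (fun k => ?_) hl
  refine eLpNorm_le_mul_of_norm_le fun x => ?_
  rw [← mul_sub, norm_mul]
  gcongr
  exact hM x

/-- If `F_k` are cylindrical and tend to `u`, then `f η(F_k)` is cylindrical and Gaussian
integration by parts applies to it. Bounded derivatives make `η` and `η'` Lipschitz, so all factors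
converge in `L²(μ)`. -/
lemma integral_comp_mul_fderiv (hcentered : ∀ L : StrongDual ℝ X, ∫ x, L x ∂μ = 0)
    {u : X → ℝ} {G : X → CM μ} {p : ℝ≥0∞} (hp : 2 ≤ p) (hu : IsW1 μ μ p u G)
    {η : ℝ → ℝ} (hη : HasBddDerivs η) {f : X → ℝ} (hf : IsSmoothCyl f) (h : CM μ) :
    ∫ x, η (u x) * (fderiv ℝ f x h.toX - f x * h.hat x) ∂μ
      + ∫ x, deriv η (u x) * (f x * ⟪G x, h⟫_ℝ) ∂μ = 0 := by
  obtain ⟨hum, hGm, F, hF, hFu, hFG⟩ := hu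
  have hFu2 : Tendsto (fun k => eLpNorm (fun x => u x - F k x) 2 μ) atTop (𝓝 0) :=
    tendsto_of_tendsto_of_tendsto_of_le_of_le tendsto_const_nhds hFu (fun _ => zero_le)
      fun k => eLpNorm_le_eLpNorm_of_exponent_le hp
        (hum.1.sub (hF k).continuous.aestronglyMeasurable)
  have hFG2 : Tendsto (fun k => eLpNorm (fun x => G x - gradH μ (F k) x) 2 μ) atTop (𝓝 0) :=
    tendsto_of_tendsto_of_tendsto_of_le_of_le tendsto_const_nhds hFG (fun _ => zero_le)
      fun k => eLpNorm_le_eLpNorm_of_exponent_le hp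
        (hGm.1.sub (continuous_gradH (hF k)).aestronglyMeasurable)
  have hcomp : ∀ {θ : ℝ → ℝ}, HasBddDerivs θ →
      Tendsto (fun k => eLpNorm (fun x => θ (u x) - θ (F k x)) 2 μ) atTop (𝓝 0) := by
    intro θ hθ
    obtain ⟨M, hM⟩ := hθ.exists_lipschitz
    exact tendsto_eLpNorm_of_le (c := ENNReal.ofReal M) ENNReal.ofReal_ne_top
      (fun k => eLpNorm_le_mul_of_norm_le fun x => hM _ _) hFu2
  have hb : MemLp (fun x => fderiv ℝ f x h.toX - f x * h.hat x) 2 μ :=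
    ((hf.fderiv_apply _).memLp 2).sub (hf.mul_memLp h.memLp_two_hat)
  have hG2 : MemLp (fun x => ⟪G x, h⟫_ℝ) 2 μ := (hGm.mono_exponent hp).inner_const h
  have hGk2 : ∀ k, MemLp (fun x => ⟪gradH μ (F k) x, h⟫_ℝ) 2 μ := fun k =>
    (memLp_gradH (hF k) 2).inner_const h
  have hm1 : ∀ {θ : ℝ → ℝ}, HasBddDerivs θ → ∀ k, MemLp (fun x => θ (F k x)) 2 μ :=
    fun hθ k => hθ.memLp_comp (hF k).continuous.aestronglyMeasurable 2
  have hl1 := tendsto_integral_mul_right (hη.memLp_comp hum.1 2) hb (hm1 hη) (hcomp hη)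
  have hl2 := tendsto_integral_mul (hη.deriv.memLp_comp hum.1 2) (hf.mul_memLp hG2)
    (hm1 hη.deriv) (fun k => hf.mul_memLp (hGk2 k)) (hcomp hη.deriv)
    (tendsto_eLpNorm_smoothCyl_mul hf (tendsto_eLpNorm_inner_sub hFG2 h))
  refine tendsto_nhds_unique (hl1.add hl2) ?_
  refine tendsto_const_nhds.congr fun k => ?_
  have hfk : IsSmoothCyl (fun x => f x * η (F k x)) := hf.mul ((hF k).comp hη)
  have hibp := integral_fderiv_toX hcentered hfk h
  have hder : ∀ x, fderiv ℝ (fun x => f x * η (F k x)) x h.toX =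
      η (F k x) * fderiv ℝ f x h.toX + deriv η (F k x) * (f x * ⟪gradH μ (F k) x, h⟫_ℝ) := by
    intro x
    have h2 : HasFDerivAt (fun x => η (F k x)) (deriv η (F k x) • fderiv ℝ (F k) x) x :=
      ((hη.1.differentiable (by simp)) (F k x)).hasDerivAt.comp_hasFDerivAt x
        ((hF k).differentiable x).hasFDerivAt
    rw [hf.fderiv_mul_apply ((hF k).comp hη), h2.fderiv, inner_gradH ((hF k).differentiable x)]
    simp
    ring
  have i1 := integrable_mul_of_memLp (hm1 hη k) hb
  have i2 := integrable_mul_of_memLp (hm1 hη.deriv k) (hf.mul_memLp (hGk2 k))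
  have i3 : Integrable (fun x => f x * η (F k x) * h.hat x) μ :=
    (hfk.memLp 2).integrable_mul h.memLp_two_hat
  have i4 : Integrable (fun x => fderiv ℝ (fun x => f x * η (F k x)) x h.toX) μ :=
    ((hfk.fderiv_apply _).memLp 1).integrable le_rfl
  rw [← integral_add i1 i2]
  rw [← sub_eq_zero, ← integral_sub i4 i3] at hibp
  rw [← hibp]
  refine integral_congr_ae (Eventually.of_forall fun x => ?_)
  simp only [hder]
  ring

/-- The logarithmic derivative `∂_h log w - ĥ` of `w μ` along `h ∈ H`, where `G = ∇_H log w`. -/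
def score (G : X → CM μ) (h : CM μ) (x : X) : ℝ := ⟪G x, h⟫_ℝ - h.hat x

section

variable {w : X → ℝ} {s t : ℝ} {G : X → CM μ}

lemma two_le_of_conjExponent (hs : 1 < s) (ht : 2 * (s / (s - 1)) ≤ t) : 2 ≤ t := by
  have : 1 ≤ s / (s - 1) := by
    rw [one_le_div (by linarith)]; linarith
  linarith

lemma memLp_hat_weighted (hcentered : ∀ L : StrongDual ℝ X, ∫ x, L x ∂μ = 0)
    (hs : 1 < s) (ht : 2 * (s / (s - 1)) ≤ t) (hw : MemLp w (ENNReal.ofReal s) μ) (h : CM μ) :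
    MemLp h.hat 2 (weighted μ w) := by
  obtain ⟨c, hc, hle⟩ := CM.exists_eLpNorm_hat_le hcentered (q := ENNReal.ofReal t) (by simp)
  exact memLp_weighted hs ht hw ⟨h.memLp_two_hat.1,
    (hle h).trans_lt (ENNReal.mul_lt_top hc.lt_top (by simp))⟩

lemma memLp_score (hcentered : ∀ L : StrongDual ℝ X, ∫ x, L x ∂μ = 0)
    (hs : 1 < s) (ht : 2 * (s / (s - 1)) ≤ t) (hw : MemLp w (ENNReal.ofReal s) μ)
    (hG : MemLp G (ENNReal.ofReal t) μ) (h : CM μ) : MemLp (score G h) 2 (weighted μ w) :=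
  ((memLp_weighted hs ht hw hG).inner_const h).sub (memLp_hat_weighted hcentered hs ht hw h)

/-- Integration by parts for `w μ`. -/
lemma integral_fderiv_weighted (hcentered : ∀ L : StrongDual ℝ X, ∫ x, L x ∂μ = 0)
    (hw_pos : ∀ᵐ x ∂μ, 0 < w x) (hs : 1 < s) (ht : 2 * (s / (s - 1)) ≤ t)
    (hw : MemLp w (ENNReal.ofReal s) μ)
    (hlog : IsW1 μ μ (ENNReal.ofReal t) (fun x => Real.log (w x)) G)
    {f : X → ℝ} (hf : IsSmoothCyl f) (h : CM μ) :
    ∫ x, fderiv ℝ f x h.toX ∂(weighted μ w) = - ∫ x, f x * score G h x ∂(weighted μ w) := by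
  have := isFiniteMeasure_weighted hs hw
  have ht2 := two_le_of_conjExponent hs ht
  have hp : (2 : ℝ≥0∞) ≤ ENNReal.ofReal t := by
    rw [← ENNReal.ofReal_ofNat]; exact ENNReal.ofReal_le_ofReal ht2
  have hhat := memLp_hat_weighted hcentered hs ht hw h
  have hGν : MemLp (fun x => ⟪G x, h⟫_ℝ) 2 (weighted μ w) :=
    (memLp_weighted hs ht hw hlog.2.1).inner_const h
  have hfd := (hf.fderiv_apply h.toX)
  have hd : Integrable (fun x => fderiv ℝ f x h.toX) (weighted μ w) :=
    (hfd.memLp 1).integrable le_rfl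
  have hb1 : Integrable (fun x => fderiv ℝ f x h.toX - f x * h.hat x) (weighted μ w) :=
    hd.sub ((hf.memLp 2).integrable_mul hhat)
  have hb2 : Integrable (fun x => f x * ⟪G x, h⟫_ℝ) (weighted μ w) :=
    (hf.memLp 2).integrable_mul hGν
  have hm1 : AEStronglyMeasurable (fun x => fderiv ℝ f x h.toX - f x * h.hat x) μ :=
    hfd.continuous.aestronglyMeasurable.sub
      (hf.continuous.aestronglyMeasurable.mul h.memLp_two_hat.1)
  have hm2 : AEStronglyMeasurable (fun x => f x * ⟪G x, h⟫_ℝ) μ :=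
    hf.continuous.aestronglyMeasurable.mul (hlog.2.1.inner_const h).1
  -- With `η = expCutoff n` and `u = log w`, both `η(u)` and `η'(u)` tend to `w`, which turns
  -- integrals against `μ` into integrals against `ν`.
  obtain ⟨M, hM0, hM, hMlim⟩ := exists_deriv_expCutoff
  have hl1 := tendsto_integral_comp_log hw_pos hw.1
    (fun n => (hasBddDerivs_expCutoff n).1.continuous) (M := 1)
    (fun n y => by simpa using abs_expCutoff_le n y) tendsto_expCutoff hm1 hb1
  have hl2 := tendsto_integral_comp_log hw_pos hw.1
    (fun n => (hasBddDerivs_expCutoff n).deriv.1.continuous) hM hMlim hm2 hb2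
  have hzero := tendsto_nhds_unique (hl1.add hl2) (tendsto_const_nhds.congr fun n =>
    (integral_comp_mul_fderiv hcentered hp hlog (hasBddDerivs_expCutoff n) hf h).symm)
  have hfs : Integrable (fun x => f x * score G h x) (weighted μ w) :=
    (hf.memLp 2).integrable_mul (memLp_score hcentered hs ht hw hlog.2.1 h)
  rw [← integral_add hb1 hb2] at hzero
  rw [← add_eq_zero_iff_eq_neg, ← integral_add hd hfs, ← hzero]
  refine integral_congr_ae (Eventually.of_forall fun x => ?_)
  simp only [score]
  ring

end

end WeightedIntegrationByParts

/-! ### Hilbert–Schmidt norms with values in `[0, ∞]`. -/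

section HilbertSchmidt

variable {ι E : Type*} [NormedAddCommGroup E] [InnerProductSpace ℝ E]
  (e : HilbertBasis ι ℝ E)

lemma tsum_enorm_inner_sq (x : E) : ∑' i, ‖⟪x, e i⟫_ℝ‖ₑ ^ 2 = ‖x‖ₑ ^ 2 := by
  have h := e.hasSum_inner_mul_inner x x
  have h1 : ∀ i, ⟪x, e i⟫_ℝ * ⟪e i, x⟫_ℝ = ‖⟪x, e i⟫_ℝ‖ ^ 2 := fun i => by
    rw [real_inner_comm x (e i), Real.norm_eq_abs, sq_abs, sq]
  simp only [h1, real_inner_self_eq_norm_sq] at h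
  have h2 : ∀ y : ℝ, ‖y‖ₑ ^ 2 = ENNReal.ofReal (‖y‖ ^ 2) := fun y => by
    rw [ENNReal.ofReal_pow (norm_nonneg _), ofReal_norm]
  simp only [h2]
  rw [← ENNReal.ofReal_tsum_of_nonneg (fun i => by positivity) h.summable, h.tsum_eq,
    ENNReal.ofReal_pow (norm_nonneg _), ofReal_norm]

lemma hsNorm_sq (A : E →L[ℝ] E) : hsNorm e A ^ 2 = ∑' i, ‖A (e i)‖ₑ ^ 2 := by
  rw [hsNorm, ← ENNReal.rpow_natCast, ← ENNReal.rpow_mul]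
  norm_num

lemma hsNorm_le_iff (A : E →L[ℝ] E) (c : ℝ≥0∞) :
    hsNorm e A ≤ c ↔ ∑' i, ‖A (e i)‖ₑ ^ 2 ≤ c ^ 2 := by
  rw [← hsNorm_sq, ENNReal.pow_le_pow_left_iff (by norm_num)]

/-- Minkowski's inequality over finite sets of basis vectors, followed by a supremum. -/
lemma hsNorm_add_le (A B : E →L[ℝ] E) : hsNorm e (A + B) ≤ hsNorm e A + hsNorm e B := by
  rw [hsNorm_le_iff, ENNReal.tsum_eq_iSup_sum]
  refine iSup_le fun S => ?_
  have hfin : ∀ C : E →L[ℝ] E, (∑ i ∈ S, ‖C (e i)‖ₑ ^ (2 : ℝ)) ^ (1 / 2 : ℝ) ≤ hsNorm e C := by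
    intro C
    refine ENNReal.rpow_le_rpow ?_ (by norm_num)
    simp only [ENNReal.rpow_ofNat]
    exact ENNReal.sum_le_tsum S
  have h1 := ENNReal.Lp_add_le S (fun i => ‖A (e i)‖ₑ) (fun i => ‖B (e i)‖ₑ)
    (p := 2) (by norm_num)
  have h2 := h1.trans (add_le_add (hfin A) (hfin B))
  have h3 := pow_le_pow_left₀ (zero_le) h2 2
  rw [← ENNReal.rpow_natCast, ← ENNReal.rpow_mul] at h3
  norm_num at h3
  refine (Finset.sum_le_sum fun i _ => ?_).trans h3
  gcongr
  exact enorm_add_le _ _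

lemma hsNorm_neg (A : E →L[ℝ] E) : hsNorm e (-A) = hsNorm e A := by
  simp [hsNorm]

lemma hsNorm_sub_le (A B : E →L[ℝ] E) : hsNorm e (A - B) ≤ hsNorm e A + hsNorm e B := by
  rw [sub_eq_add_neg, ← hsNorm_neg e B]
  exact hsNorm_add_le e A (-B)

lemma hsNorm_comp_le (P A : E →L[ℝ] E) : hsNorm e (P.comp A) ≤ ‖P‖ₑ * hsNorm e A := by
  rw [hsNorm_le_iff, mul_pow, hsNorm_sq, ← ENNReal.tsum_mul_left]
  refine ENNReal.tsum_le_tsum fun i => ?_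
  rw [← mul_pow]
  gcongr
  exact P.le_opENorm _

lemma aemeasurable_hsNorm [Countable ι] {Ω : Type*} [MeasurableSpace Ω] {ρ : Measure Ω}
    {A : Ω → (E →L[ℝ] E)} (hA : AEStronglyMeasurable A ρ) :
    AEMeasurable (fun x => hsNorm e (A x)) ρ := by
  refine AEMeasurable.pow_const ?_ _
  refine AEMeasurable.tsum fun i => ?_
  exact ((ContinuousLinearMap.apply ℝ E (e i)).continuous.comp_aestronglyMeasurable
    hA).enorm.pow_const 2

variable [CompleteSpace E]

/-- Both sides are the sum of the squared matrix entries, in the two orders of summation. -/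
lemma hsNorm_adjoint (A : E →L[ℝ] E) :
    hsNorm e (ContinuousLinearMap.adjoint A) = hsNorm e A := by
  have h : ∑' i, ‖ContinuousLinearMap.adjoint A (e i)‖ₑ ^ 2 = ∑' i, ‖A (e i)‖ₑ ^ 2 := by
    simp only [← tsum_enorm_inner_sq e, ContinuousLinearMap.adjoint_inner_left]
    rw [ENNReal.tsum_comm]
    simp only [real_inner_comm]
  rw [hsNorm, hsNorm, h]

/-- The coordinate `⟨A k, eᵢ⟩ = ⟨k, A* eᵢ⟩` is at most `‖k‖ ‖A* eᵢ‖`; sum the squares and use that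
`A` and `A*` have the same Hilbert–Schmidt norm. -/
lemma enorm_apply_le_hsNorm (A : E →L[ℝ] E) (k : E) : ‖A k‖ₑ ≤ ‖k‖ₑ * hsNorm e A := by
  have h : ‖A k‖ₑ ^ 2 ≤ (‖k‖ₑ * hsNorm e A) ^ 2 := by
    rw [mul_pow, ← hsNorm_adjoint, hsNorm_sq, ← tsum_enorm_inner_sq e, ← ENNReal.tsum_mul_left]
    refine ENNReal.tsum_le_tsum fun i => ?_
    rw [← mul_pow, ← ContinuousLinearMap.adjoint_inner_right]
    gcongr
    rw [← ofReal_norm, ← ofReal_norm, ← ofReal_norm, ← ENNReal.ofReal_mul (norm_nonneg _)]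
    exact ENNReal.ofReal_le_ofReal (norm_inner_le_norm _ _)
  exact (ENNReal.pow_le_pow_left_iff (by norm_num)).1 h

/-- The trace of the square of a finite rank operator is at most the square of its
Hilbert–Schmidt norm. -/
lemma ofReal_sum_inner_mul_inner_le {κ : Type*} [Fintype κ] (a h : κ → E) (T : E →L[ℝ] E)
    (hT : ∀ k, T k = ∑ i, ⟪a i, k⟫_ℝ • h i) :
    ENNReal.ofReal (∑ i, ∑ j, ⟪a i, h j⟫_ℝ * ⟪a j, h i⟫_ℝ) ≤ hsNorm e T ^ 2 := by
  -- The double sum is `∑ᵢ ⟨aᵢ, T hᵢ⟩ = tr T²`. Expanded in the basis it becomes `∑ₙ ⟨T eₙ, T* eₙ⟩`,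
  -- at most the mean of the squared Hilbert–Schmidt norms of `T` and `T*`.
  have h1 : ∀ i, HasSum (fun n => ⟪ContinuousLinearMap.adjoint T (a i), e n⟫_ℝ * ⟪e n, h i⟫_ℝ)
      ⟪ContinuousLinearMap.adjoint T (a i), h i⟫_ℝ := fun i => e.hasSum_inner_mul_inner _ _
  have h2 := hasSum_sum (fun i (_ : i ∈ Finset.univ) => h1 i)
  have h3 : ∑ i, ⟪ContinuousLinearMap.adjoint T (a i), h i⟫_ℝ =
      ∑ i, ∑ j, ⟪a i, h j⟫_ℝ * ⟪a j, h i⟫_ℝ := by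
    refine Finset.sum_congr rfl fun i _ => ?_
    rw [ContinuousLinearMap.adjoint_inner_left, hT, inner_sum]
    refine Finset.sum_congr rfl fun j _ => ?_
    rw [inner_smul_right, mul_comm]
  have h4 : ∀ n, ∑ i, ⟪ContinuousLinearMap.adjoint T (a i), e n⟫_ℝ * ⟪e n, h i⟫_ℝ =
      ⟪T (e n), ContinuousLinearMap.adjoint T (e n)⟫_ℝ := by
    intro n
    rw [ContinuousLinearMap.adjoint_inner_right, hT (T (e n)), sum_inner]
    refine Finset.sum_congr rfl fun i _ => ?_
    rw [ContinuousLinearMap.adjoint_inner_left, inner_smul_left, real_inner_comm (h i) (e n)]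
    rfl
  simp only [h4, h3] at h2
  have h5 : ∀ n, ‖⟪T (e n), ContinuousLinearMap.adjoint T (e n)⟫_ℝ‖ₑ ≤
      2⁻¹ * (‖T (e n)‖ₑ ^ 2 + ‖ContinuousLinearMap.adjoint T (e n)‖ₑ ^ 2) := by
    intro n
    have h6 : ‖⟪T (e n), ContinuousLinearMap.adjoint T (e n)⟫_ℝ‖ ≤
        2⁻¹ * (‖T (e n)‖ ^ 2 + ‖ContinuousLinearMap.adjoint T (e n)‖ ^ 2) := by
      refine (norm_inner_le_norm _ _).trans ?_
      nlinarith [sq_nonneg (‖T (e n)‖ - ‖ContinuousLinearMap.adjoint T (e n)‖)]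
    rw [← ofReal_norm, ← ofReal_norm, ← ofReal_norm, ← ENNReal.ofReal_pow (norm_nonneg _),
      ← ENNReal.ofReal_pow (norm_nonneg _), ← ENNReal.ofReal_add (by positivity) (by positivity)]
    refine (ENNReal.ofReal_le_ofReal h6).trans (le_of_eq ?_)
    rw [ENNReal.ofReal_mul (by norm_num), ENNReal.ofReal_inv_of_pos (by norm_num)]
    norm_num
  calc ENNReal.ofReal (∑ i, ∑ j, ⟪a i, h j⟫_ℝ * ⟪a j, h i⟫_ℝ)
      ≤ ‖∑ i, ∑ j, ⟪a i, h j⟫_ℝ * ⟪a j, h i⟫_ℝ‖ₑ := Real.ofReal_le_enorm _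
    _ = ‖∑' n, ⟪T (e n), ContinuousLinearMap.adjoint T (e n)⟫_ℝ‖ₑ := by rw [h2.tsum_eq]
    _ ≤ ∑' n, ‖⟪T (e n), ContinuousLinearMap.adjoint T (e n)⟫_ℝ‖ₑ :=
        enorm_tsum_le_tsum_enorm
    _ ≤ ∑' n, 2⁻¹ * (‖T (e n)‖ₑ ^ 2 + ‖ContinuousLinearMap.adjoint T (e n)‖ₑ ^ 2) :=
        ENNReal.tsum_le_tsum h5
    _ = 2⁻¹ * (hsNorm e T ^ 2 + hsNorm e T ^ 2) := by
        rw [ENNReal.tsum_mul_left, ENNReal.tsum_add, ← hsNorm_sq, ← hsNorm_sq, hsNorm_adjoint]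
    _ = hsNorm e T ^ 2 := by
        rw [← two_mul, ← mul_assoc, ENNReal.inv_mul_cancel (by simp) (by simp), one_mul]

end HilbertSchmidt

/-! ### The energy identity for pairs of cylindrical functions. -/

section Energy

variable [CompleteSpace X] [SecondCountableTopology X] {μ : Measure X} [IsGaussian μ]
  {ι : Type*}

/-- The standing assumptions on the weight: `w ∈ L^s(μ)` is positive and `log w ∈ W^{2,t}(μ)`
has gradient `G` and Hessian `A`, with `2 s' ≤ t`. -/
structure AdmissibleWeight (e : HilbertBasis ι ℝ (CM μ)) (w : X → ℝ) (s t : ℝ) (G : X → CM μ)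
    (A : X → (CM μ →L[ℝ] CM μ)) : Prop where
  centered : ∀ L : StrongDual ℝ X, ∫ x, L x ∂μ = 0
  pos : ∀ᵐ x ∂μ, 0 < w x
  one_lt : 1 < s
  le_exponent : 2 * (s / (s - 1)) ≤ t
  memLp : MemLp w (ENNReal.ofReal s) μ
  log : IsW2 μ e (ENNReal.ofReal t) (fun x => Real.log (w x)) G A

namespace AdmissibleWeight

variable {e : HilbertBasis ι ℝ (CM μ)} {w : X → ℝ} {s t : ℝ} {G : X → CM μ}
  {A : X → (CM μ →L[ℝ] CM μ)}

lemma isFiniteMeasure (H : AdmissibleWeight e w s t G A) : IsFiniteMeasure (weighted μ w) :=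
  isFiniteMeasure_weighted H.one_lt H.memLp

lemma memLp_score (H : AdmissibleWeight e w s t G A) (h : CM μ) :
    MemLp (score G h) 2 (weighted μ w) :=
  WeightedGaussian.memLp_score H.centered H.one_lt H.le_exponent H.memLp H.log.2.1 h

lemma memLp_hat (H : AdmissibleWeight e w s t G A) (h : CM μ) :
    MemLp h.hat 2 (weighted μ w) :=
  memLp_hat_weighted H.centered H.one_lt H.le_exponent H.memLp h

lemma memLp_grad (H : AdmissibleWeight e w s t G A) (h : CM μ) :
    MemLp (fun x => ⟪G x, h⟫_ℝ) 2 (weighted μ w) :=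
  (memLp_weighted H.one_lt H.le_exponent H.memLp H.log.2.1).inner_const h

lemma integral_fderiv (H : AdmissibleWeight e w s t G A) {f : X → ℝ} (hf : IsSmoothCyl f)
    (h : CM μ) :
    ∫ x, fderiv ℝ f x h.toX ∂(weighted μ w) = - ∫ x, f x * score G h x ∂(weighted μ w) := by
  obtain ⟨h1, h2, -, -, F, hF, h3, h4, -⟩ := H.log
  exact integral_fderiv_weighted H.centered H.pos H.one_lt H.le_exponent H.memLp
    ⟨h1, h2, F, hF, h3, h4⟩ hf h

lemma eLpNorm_inner_apply_le (B : X → (CM μ →L[ℝ] CM μ)) (ρ : Measure X) (p : ℝ≥0∞)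
    (h k : CM μ) :
    eLpNorm (fun x => ⟪B x k, h⟫_ℝ) p ρ ≤ (‖k‖₊ * ‖h‖₊ : NNReal) *
      eLpNorm (fun x => hsNorm e (B x)) p ρ := by
  refine eLpNorm_le_mul_eLpNorm_of_ae_le_mul' (Eventually.of_forall fun x => ?_) p
  have h1 : ‖⟪B x k, h⟫_ℝ‖ₑ ≤ ‖B x k‖ₑ * ‖h‖ₑ := by
    rw [← ofReal_norm, ← ofReal_norm, ← ofReal_norm, ← ENNReal.ofReal_mul (norm_nonneg _)]
    exact ENNReal.ofReal_le_ofReal (norm_inner_le_norm _ _)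
  refine h1.trans ?_
  calc ‖B x k‖ₑ * ‖h‖ₑ ≤ (‖k‖ₑ * hsNorm e (B x)) * ‖h‖ₑ := by
        gcongr; exact enorm_apply_le_hsNorm e (B x) k
    _ = _ := by
        rw [mul_right_comm]
        simp [enorm_eq_nnnorm]

lemma memLp_hess (H : AdmissibleWeight e w s t G A) (h k : CM μ) :
    MemLp (fun x => ⟪A x k, h⟫_ℝ) 2 (weighted μ w) := by
  obtain ⟨-, -, hAm, hA, -⟩ := H.log
  refine memLp_weighted H.one_lt H.le_exponent H.memLp ⟨?_, ?_⟩
  · exact ((ContinuousLinearMap.apply ℝ (CM μ) k).continuous.comp_aestronglyMeasurable hAm).inner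
      aestronglyMeasurable_const
  · exact (eLpNorm_inner_apply_le A μ _ h k).trans_lt
      (ENNReal.mul_lt_top ENNReal.coe_lt_top hA.lt_top)

/-- This is integration by parts along `k` for the product `f ∂_h log w`. It is applied to `f ∂_h
F_j`, where the cylindrical `F_j` tend to `log w` in `W^{2,t}(μ)`, so that their first and second
derivatives converge in `L²(ν)`. -/
lemma integral_grad_mul_score (H : AdmissibleWeight e w s t G A) {f : X → ℝ}
    (hf : IsSmoothCyl f) (h k : CM μ) :
    ∫ x, ⟪G x, h⟫_ℝ * (fderiv ℝ f x k.toX + f x * score G k x) ∂(weighted μ w)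
      + ∫ x, ⟪A x k, h⟫_ℝ * f x ∂(weighted μ w) = 0 := by
  have := H.isFiniteMeasure
  have hsc := H.memLp_score k
  have hGm := H.memLp_grad h
  have hAm := H.memLp_hess h k
  obtain ⟨-, hG, hAmeas, -, F, hF, -, hFG, hFA⟩ := H.log
  have hl1 : Tendsto (fun j => eLpNorm (fun x => ⟪G x, h⟫_ℝ - ⟪gradH μ (F j) x, h⟫_ℝ) 2
      (weighted μ w)) atTop (𝓝 0) :=
    tendsto_eLpNorm_weighted H.one_lt H.le_exponent H.memLp
      (fun j => (hG.inner_const h).1.sub ((memLp_gradH (hF j) 2).inner_const h).1)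
      (tendsto_eLpNorm_inner_sub hFG h)
  have hhess : ∀ j, IsSmoothCyl (fun x => ⟪hessH μ (F j) x k, h⟫_ℝ) := fun j => by
    simp only [inner_hessH (hF j)]
    exact ((hF j).fderiv_apply _).fderiv_apply _
  have hl2 : Tendsto (fun j => eLpNorm (fun x => ⟪A x k, h⟫_ℝ - ⟪hessH μ (F j) x k, h⟫_ℝ) 2
      (weighted μ w)) atTop (𝓝 0) := by
    refine tendsto_eLpNorm_weighted H.one_lt H.le_exponent H.memLp (fun j => ?_) ?_
    · exact (((ContinuousLinearMap.apply ℝ (CM μ) k).continuous.comp_aestronglyMeasurable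
        hAmeas).inner aestronglyMeasurable_const).sub (hhess j).continuous.aestronglyMeasurable
    · refine tendsto_eLpNorm_of_le (c := (‖k‖₊ * ‖h‖₊ : NNReal)) ENNReal.coe_ne_top (fun j => ?_) hFA
      have := eLpNorm_inner_apply_le (e := e) (fun x => A x - hessH μ (F j) x) μ
        (ENNReal.ofReal t) h k
      simpa only [sub_apply, inner_sub_left] using this
  have hb : MemLp (fun x => fderiv ℝ f x k.toX + f x * score G k x) 2 (weighted μ w) :=
    ((hf.fderiv_apply _).memLp 2).add (hf.mul_memLp hsc)
  have hgk : ∀ j, MemLp (fun x => ⟪gradH μ (F j) x, h⟫_ℝ) 2 (weighted μ w) :=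
    fun j => (memLp_gradH (hF j) 2).inner_const h
  have hlim := (tendsto_integral_mul_right hGm hb hgk hl1).add
    (tendsto_integral_mul_right hAm (hf.memLp 2) (fun j => (hhess j).memLp 2) hl2)
  refine tendsto_nhds_unique hlim (tendsto_const_nhds.congr fun j => ?_)
  have hd := (hF j).fderiv_apply h.toX
  have hgrad : ∀ x, ⟪gradH μ (F j) x, h⟫_ℝ = fderiv ℝ (F j) x h.toX := fun x =>
    inner_gradH ((hF j).differentiable x) h
  have hibp := H.integral_fderiv (hf.mul hd) k
  have i1 : Integrable (fun x => fderiv ℝ (fun x => f x * fderiv ℝ (F j) x h.toX) x k.toX)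
      (weighted μ w) := (((hf.mul hd).fderiv_apply _).memLp 1).integrable le_rfl
  have i2 := integrable_mul_of_memLp ((hf.mul hd).memLp 2) hsc
  have i3 := integrable_mul_of_memLp (hgk j) hb
  have i4 := integrable_mul_of_memLp ((hhess j).memLp 2) (hf.memLp (ρ := weighted μ w) 2)
  rw [← add_eq_zero_iff_eq_neg, ← integral_add i1 i2] at hibp
  rw [← integral_add i3 i4, ← hibp]
  refine integral_congr_ae (Eventually.of_forall fun x => ?_)
  simp only [hf.fderiv_mul_apply hd, hgrad, inner_hessH (hF j)]
  ring

/-- Integration by parts for `f L`. Since `L` is unbounded it need not be cylindrical; it is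
replaced by `(n + 1) sin(L / (n + 1))`, which is cylindrical, dominated by `|L| ∈ L²(ν)`, and tends
to `L` together with its derivative. -/
lemma integral_dual_mul_score (H : AdmissibleWeight e w s t G A) {f : X → ℝ}
    (hf : IsSmoothCyl f) (L : StrongDual ℝ X) (k : CM μ) :
    ∫ x, L x * (fderiv ℝ f x k.toX + f x * score G k x) ∂(weighted μ w)
      + ∫ x, L k.toX * f x ∂(weighted μ w) = 0 := by
  have := H.isFiniteMeasure
  have hsc := H.memLp_score k
  have hL : MemLp L 2 (weighted μ w) :=
    (H.memLp_hat (CM.ofDual μ L)).ae_eq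
      (weighted_absolutelyContinuous.ae_le (CM.hat_ofDual (μ := μ) L))
  have hb : MemLp (fun x => fderiv ℝ f x k.toX + f x * score G k x) 2 (weighted μ w) :=
    ((hf.fderiv_apply _).memLp 2).add (hf.mul_memLp hsc)
  have hf1 : Integrable f (weighted μ w) := (hf.memLp 1).integrable le_rfl
  -- bounded cylindrical approximations of `L`
  let S : ℕ → X → ℝ := fun n x => (n + 1) * Real.sin (L x / (n + 1))
  have hn : ∀ n : ℕ, ((n : ℝ) + 1) ≠ 0 := fun n => by positivity
  have hS : ∀ n, IsSmoothCyl (S n) := fun n => by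
    have h1 : IsSmoothCyl (fun x => Real.sin (((n + 1 : ℝ)⁻¹ • L) x)) :=
      isSmoothCyl_of_finiteDimensional ((n + 1 : ℝ)⁻¹ • L) HasBddDerivs.sin
    have h2 := h1.const_mul (n + 1 : ℝ)
    convert h2 using 3 with x
    simp [div_eq_inv_mul]
  have hSd : ∀ n x, fderiv ℝ (S n) x k.toX = Real.cos (L x / (n + 1)) * L k.toX := by
    intro n x
    have h1 : HasFDerivAt (fun x => L x / ((n : ℝ) + 1)) (((n : ℝ) + 1)⁻¹ • (L : X →L[ℝ] ℝ)) x := by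
      simpa [div_eq_mul_inv] using L.hasFDerivAt.mul_const (((n : ℝ) + 1)⁻¹)
    have h2 := (h1.sin).const_mul ((n : ℝ) + 1)
    rw [h2.fderiv]
    simp only [smul_apply, smul_eq_mul]
    field_simp [hn n]
  have h0 : ∀ x, Tendsto (fun n : ℕ => L x / ((n : ℝ) + 1)) atTop (𝓝 0) := fun x =>
    tendsto_const_div_atTop_nhds_zero_nat (L x) |>.comp (tendsto_add_atTop_nat 1) |>.congr
      (fun n => by simp)
  have hSle : ∀ n x, |S n x| ≤ |L x| := by
    intro n x
    simp only [S, abs_mul]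
    calc |(n : ℝ) + 1| * |Real.sin (L x / (n + 1))| ≤ |(n : ℝ) + 1| * |L x / (n + 1)| := by
          exact mul_le_mul_of_nonneg_left Real.abs_sin_le_abs (abs_nonneg _)
      _ = |L x| := by
          rw [abs_div]; field_simp
  -- The limit is the derivative of `r ↦ sin(L x · r)` at `0`, taken along `r = 1 / (n + 1)`.
  have hSlim : ∀ x, Tendsto (fun n => S n x) atTop (𝓝 (L x)) := by
    intro x
    have h1 : HasDerivAt (fun r => Real.sin (L x * r)) (L x) 0 := by
      have := (Real.hasDerivAt_sin (L x * 0)).comp (0 : ℝ) ((hasDerivAt_id (0 : ℝ)).const_mul (L x))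
      simpa [Function.comp_def] using this
    have h2 := h1.tendsto_slope_zero_right.comp
      (tendsto_inv_atTop_nhdsGT_zero.comp (tendsto_natCast_atTop_atTop.comp
        (tendsto_add_atTop_nat 1)))
    refine h2.congr fun n => ?_
    simp [S, div_eq_mul_inv]
  have hl1 : Tendsto (fun n => ∫ x, S n x * (fderiv ℝ f x k.toX + f x * score G k x)
      ∂(weighted μ w)) atTop
      (𝓝 (∫ x, L x * (fderiv ℝ f x k.toX + f x * score G k x) ∂(weighted μ w))) := by
    refine tendsto_integral_of_dominated_convergence
      (fun x => ‖L x * (fderiv ℝ f x k.toX + f x * score G k x)‖)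
      (fun n => (hS n).continuous.aestronglyMeasurable.mul hb.1)
      (integrable_mul_of_memLp hL hb).norm (fun n => Eventually.of_forall fun x => ?_)
      (Eventually.of_forall fun x => (hSlim x).mul_const _)
    simpa only [Real.norm_eq_abs, abs_mul] using mul_le_mul_of_nonneg_right (hSle n x)
      (abs_nonneg (fderiv ℝ f x k.toX + f x * score G k x))
  have hl2 : Tendsto (fun n : ℕ => ∫ x, Real.cos (L x / (n + 1)) * L k.toX * f x
      ∂(weighted μ w)) atTop (𝓝 (∫ x, L k.toX * f x ∂(weighted μ w))) := by
    refine tendsto_integral_of_dominated_convergence (fun x => ‖L k.toX * f x‖)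
      (fun n => ?_) (hf1.const_mul _).norm (fun n => Eventually.of_forall fun x => ?_)
      (Eventually.of_forall fun x => ?_)
    · have := hf.continuous
      exact Continuous.aestronglyMeasurable (by fun_prop)
    · rw [mul_assoc, norm_mul]
      exact mul_le_of_le_one_left (norm_nonneg _) (Real.abs_cos_le_one _)
    · have h1 := (Real.continuous_cos.tendsto 0).comp (h0 x)
      rw [Real.cos_zero] at h1
      simpa [mul_assoc] using h1.mul_const (L k.toX * f x)
  refine tendsto_nhds_unique (hl1.add hl2) (tendsto_const_nhds.congr fun n => ?_)
  have hibp := H.integral_fderiv (hf.mul (hS n)) k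
  have i1 : Integrable (fun x => fderiv ℝ (fun x => f x * S n x) x k.toX)
      (weighted μ w) := (((hf.mul (hS n)).fderiv_apply _).memLp 1).integrable le_rfl
  have i2 := integrable_mul_of_memLp ((hf.mul (hS n)).memLp 2) hsc
  have i3 := integrable_mul_of_memLp ((hS n).memLp 2) hb
  have i4 : Integrable (fun x => Real.cos (L x / (n + 1)) * L k.toX * f x) (weighted μ w) := by
    simp only [← hSd]
    exact integrable_mul_of_memLp (((hS n).fderiv_apply _).memLp 2) (hf.memLp 2)
  rw [← add_eq_zero_iff_eq_neg, ← integral_add i1 i2] at hibp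
  rw [← integral_add i3 i4, ← hibp]
  refine integral_congr_ae (Eventually.of_forall fun x => ?_)
  simp only [hf.fderiv_mul_apply (hS n), hSd]
  ring

/-- Approximate `ĥ` by functionals. Convergence in `H` is only convergence in `L²(μ)`, but Gaussian
moments upgrade it to `L^t(μ)`, hence to `L²(ν)`. -/
lemma integral_hat_mul_score (H : AdmissibleWeight e w s t G A) {f : X → ℝ}
    (hf : IsSmoothCyl f) (h k : CM μ) :
    ∫ x, h.hat x * (fderiv ℝ f x k.toX + f x * score G k x) ∂(weighted μ w)
      + ⟪h, k⟫_ℝ * ∫ x, f x ∂(weighted μ w) = 0 := by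
  have := H.isFiniteMeasure
  have hb : MemLp (fun x => fderiv ℝ f x k.toX + f x * score G k x) 2 (weighted μ w) :=
    ((hf.fderiv_apply _).memLp 2).add (hf.mul_memLp (H.memLp_score k))
  obtain ⟨L, hL⟩ := CM.exists_seq_ofDual h
  obtain ⟨c, hc, hle⟩ := CM.exists_eLpNorm_hat_le H.centered (q := ENNReal.ofReal t) (by simp)
  have hl0 : Tendsto (fun n => eLpNorm (fun x => h.hat x - (CM.ofDual μ (L n)).hat x)
      (ENNReal.ofReal t) μ) atTop (𝓝 0) := by
    have h1 : Tendsto (fun n => c * ‖h - CM.ofDual μ (L n)‖ₑ) atTop (𝓝 0) := by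
      have h2 : Tendsto (fun n => h - CM.ofDual μ (L n)) atTop (𝓝 0) := by
        simpa using (tendsto_const_nhds (x := h)).sub hL
      have h3 := ENNReal.Tendsto.const_mul (a := c) ((continuous_enorm.tendsto _).comp h2)
        (Or.inr hc)
      simpa using h3
    refine tendsto_of_tendsto_of_tendsto_of_le_of_le tendsto_const_nhds h1 (fun _ => zero_le)
      fun n => ?_
    refine le_trans (le_of_eq ?_) (hle (h - CM.ofDual μ (L n)))
    refine eLpNorm_congr_ae ?_
    unfold CM.hat
    rw [map_sub]
    exact (Lp.coeFn_sub _ _).symm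
  have hl1 := tendsto_eLpNorm_weighted H.one_lt H.le_exponent H.memLp
    (fun n => h.memLp_two_hat.1.sub (CM.ofDual μ (L n)).memLp_two_hat.1) hl0
  have hlim := (tendsto_integral_mul_right (H.memLp_hat h) hb
    (fun n => H.memLp_hat (CM.ofDual μ (L n))) hl1).add
    ((hL.inner (𝕜 := ℝ) (tendsto_const_nhds (x := k))).mul_const (∫ x, f x ∂(weighted μ w)))
  refine tendsto_nhds_unique hlim (tendsto_const_nhds.congr fun n => ?_)
  rw [← H.integral_dual_mul_score hf (L n) k, integral_const_mul]
  have h1 : (L n) k.toX = ⟪CM.ofDual μ (L n), k⟫_ℝ := by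
    rw [CM.dual_toX, ← CM.integral_hat_mul_hat]
    refine integral_congr_ae ?_
    filter_upwards [CM.hat_ofDual (μ := μ) (L n)] with x hx
    rw [hx]
  rw [h1]
  congr 1
  refine integral_congr_ae ?_
  filter_upwards [weighted_absolutelyContinuous.ae_le (CM.hat_ofDual (μ := μ) (L n))] with x hx
  rw [hx]

/-- `∂_h f + f (∂_h log w - ĥ)`, the divergence of `f h` with respect to `w μ`. -/
def _root_.WeightedGaussian.divTerm (G : X → CM μ) (f : X → ℝ) (h : CM μ) (x : X) : ℝ :=
  fderiv ℝ f x h.toX + f x * score G h x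

lemma memLp_divTerm (H : AdmissibleWeight e w s t G A) {f : X → ℝ} (hf : IsSmoothCyl f)
    (h : CM μ) : MemLp (divTerm G f h) 2 (weighted μ w) :=
  have := H.isFiniteMeasure
  ((hf.fderiv_apply _).memLp 2).add (hf.mul_memLp (H.memLp_score h))

/-- The weak form of `∂_k β_h = ⟨∇² log w k, h⟩ - ⟨h, k⟩`, obtained by subtracting the identity for
`ĥ` from that for `∂_h log w`. The operator `I - ∇² log w` enters here. -/
lemma integral_score_mul_divTerm (H : AdmissibleWeight e w s t G A) {f : X → ℝ}
    (hf : IsSmoothCyl f) (h k : CM μ) :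
    ∫ x, score G h x * divTerm G f k x ∂(weighted μ w)
      = ∫ x, (⟪h, k⟫_ℝ - ⟪A x k, h⟫_ℝ) * f x ∂(weighted μ w) := by
  have := H.isFiniteMeasure
  have hf1 : Integrable f (weighted μ w) := (hf.memLp 1).integrable le_rfl
  have h1 := H.integral_grad_mul_score hf h k
  have h2 := H.integral_hat_mul_score hf h k
  have i1 := integrable_mul_of_memLp (H.memLp_grad h) (H.memLp_divTerm hf k)
  have i2 := integrable_mul_of_memLp (H.memLp_hat h) (H.memLp_divTerm hf k)
  have i3 := integrable_mul_of_memLp (H.memLp_hess h k) (hf.memLp (ρ := weighted μ w) 2)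
  simp only [score, sub_mul]
  rw [integral_sub i1 i2, integral_sub (hf1.const_mul _) i3, integral_const_mul]
  change ∫ x, ⟪G x, h⟫_ℝ * divTerm G f k x ∂(weighted μ w) + _ = 0 at h1
  change ∫ x, h.hat x * divTerm G f k x ∂(weighted μ w) + _ = 0 at h2
  linarith

/-- Integration by parts against a divergence. -/
lemma integral_mul_divTerm (H : AdmissibleWeight e w s t G A) {f g : X → ℝ}
    (hf : IsSmoothCyl f) (hg : IsSmoothCyl g) (k : CM μ) :
    ∫ x, f x * divTerm G g k x ∂(weighted μ w)
      = - ∫ x, fderiv ℝ f x k.toX * g x ∂(weighted μ w) := by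
  have := H.isFiniteMeasure
  have hibp := H.integral_fderiv (hf.mul hg) k
  have i1 : Integrable (fun x => fderiv ℝ (fun x => f x * g x) x k.toX)
      (weighted μ w) := (((hf.mul hg).fderiv_apply _).memLp 1).integrable le_rfl
  have i2 := integrable_mul_of_memLp ((hf.mul hg).memLp 2) (H.memLp_score k)
  have i3 := integrable_mul_of_memLp (hf.memLp 2) (H.memLp_divTerm hg k)
  have i4 := integrable_mul_of_memLp ((hf.fderiv_apply k.toX).memLp 2)
    (hg.memLp (ρ := weighted μ w) 2)
  rw [← add_eq_zero_iff_eq_neg, ← integral_add i1 i2] at hibp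
  rw [← add_eq_zero_iff_eq_neg, ← integral_add i3 i4, ← hibp]
  refine integral_congr_ae (Eventually.of_forall fun x => ?_)
  simp only [hf.fderiv_mul_apply hg, divTerm]
  ring

/-- Polarised energy identity: formally, move `δ_k` onto `δ_h f` as `-∂_k` and use `∂_k δ_h f = δ_h
∂_k f + f ∂_k β_h`. As `δ_h f` is not cylindrical, the product is first rearranged so that each `δ`
is paired with a cylindrical function or with `β_h`. -/
lemma integral_divTerm_mul_divTerm (H : AdmissibleWeight e w s t G A) {f g : X → ℝ}
    (hf : IsSmoothCyl f) (hg : IsSmoothCyl g) (h k : CM μ) :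
    ∫ x, divTerm G f h x * divTerm G g k x ∂(weighted μ w)
      = ∫ x, fderiv ℝ f x k.toX * fderiv ℝ g x h.toX ∂(weighted μ w)
        + ∫ x, (⟪h, k⟫_ℝ - ⟪A x k, h⟫_ℝ) * (f x * g x) ∂(weighted μ w) := by
  have := H.isFiniteMeasure
  have hfh := hf.fderiv_apply h.toX
  have hfk := hf.fderiv_apply k.toX
  have e1 := H.integral_mul_divTerm hfh hg k
  have e2 := H.integral_score_mul_divTerm (hf.mul hg) h k
  have e3 := H.integral_mul_divTerm hg hfk h
  -- `δ_h f δ_k g = ∂_h f δ_k g + β_h δ_k (f g) - g δ_h (∂_k f) + g ∂_h ∂_k f`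
  have i1 := integrable_mul_of_memLp (hfh.memLp 2) (H.memLp_divTerm hg k)
  have i2 := integrable_mul_of_memLp (H.memLp_score h) (H.memLp_divTerm (hf.mul hg) k)
  have i3 := integrable_mul_of_memLp (hg.memLp 2) (H.memLp_divTerm hfk h)
  have i4 := integrable_mul_of_memLp ((hfk.fderiv_apply h.toX).memLp 2)
    (hg.memLp (ρ := weighted μ w) 2)
  -- By symmetry, the term `-g ∂_k ∂_h f` produced by the first integration by parts cancels the
  -- last term of the decomposition.
  have hsymm : ∀ x, fderiv ℝ (fun y => fderiv ℝ f y h.toX) x k.toX =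
      fderiv ℝ (fun y => fderiv ℝ f y k.toX) x h.toX := fun x => hf.fderiv_fderiv_comm x _ _
  simp only [hsymm] at e1
  have key : ∫ x, divTerm G f h x * divTerm G g k x ∂(weighted μ w) =
      ∫ x, (((fderiv ℝ f x h.toX * divTerm G g k x
        + score G h x * divTerm G (fun x => f x * g x) k x)
        - g x * divTerm G (fun x => fderiv ℝ f x k.toX) h x)
        + fderiv ℝ (fun y => fderiv ℝ f y k.toX) x h.toX * g x) ∂(weighted μ w) := by
    refine integral_congr_ae (Eventually.of_forall fun x => ?_)
    simp only [divTerm, hf.fderiv_mul_apply hg]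
    ring
  have i12 : Integrable (fun x => fderiv ℝ f x h.toX * divTerm G g k x
      + score G h x * divTerm G (fun x => f x * g x) k x) (weighted μ w) := i1.add i2
  have i123 : Integrable (fun x => fderiv ℝ f x h.toX * divTerm G g k x
      + score G h x * divTerm G (fun x => f x * g x) k x
      - g x * divTerm G (fun x => fderiv ℝ f x k.toX) h x) (weighted μ w) := i12.sub i3
  rw [key, integral_add i123 i4, integral_sub i12 i3, integral_add i1 i2, e1, e2, e3]
  have e4 : ∫ x, fderiv ℝ g x h.toX * fderiv ℝ f x k.toX ∂(weighted μ w) =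
      ∫ x, fderiv ℝ f x k.toX * fderiv ℝ g x h.toX ∂(weighted μ w) := by
    simp only [mul_comm]
  linarith

end AdmissibleWeight

end Energy

/-! ### The `L²` bound for divergences of cylindrical fields. -/

section Estimate

lemma eLpNorm_two_sq {Ω E : Type*} [MeasurableSpace Ω] [TopologicalSpace E]
    [ContinuousENorm E] (g : Ω → E) (ρ : Measure Ω) :
    eLpNorm g 2 ρ ^ 2 = ∫⁻ x, ‖g x‖ₑ ^ 2 ∂ρ := by
  rw [eLpNorm_eq_lintegral_rpow_enorm_toReal (by simp) (by simp), ← ENNReal.rpow_natCast,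
    ← ENNReal.rpow_mul]
  norm_num

lemma ofReal_integral_le_lintegral_ofReal {Ω : Type*} [MeasurableSpace Ω] {ρ : Measure Ω}
    {g : Ω → ℝ} (hg : Integrable g ρ) :
    ENNReal.ofReal (∫ x, g x ∂ρ) ≤ ∫⁻ x, ENNReal.ofReal (g x) ∂ρ := by
  have h1 : ∫ x, g x ∂ρ ≤ ∫ x, max (g x) 0 ∂ρ :=
    integral_mono hg hg.pos_part fun x => le_max_left _ _
  refine (ENNReal.ofReal_le_ofReal h1).trans (le_of_eq ?_)
  rw [ofReal_integral_eq_lintegral_ofReal hg.pos_part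
    (Eventually.of_forall fun x => le_max_right _ _)]
  refine lintegral_congr fun x => ?_
  rcases le_total (g x) 0 with h | h <;> simp [h]

/-- Boundedness of `A` sums the inner series to `⟨h, eᵢ⟩ ⟨eᵢ, h - A h⟩`; Parseval's identity sums
the outer one. -/
lemma tsum_tsum_eq_inner_sub {ι E : Type*} [DecidableEq ι] [NormedAddCommGroup E]
    [InnerProductSpace ℝ E] (e : HilbertBasis ι ℝ E) (A : E →L[ℝ] E) (h : E) :
    ∑' i, ∑' j, ((if i = j then (1 : ℝ) else 0) - ⟪A (e j), e i⟫_ℝ) * e.repr h i * e.repr h j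
      = ‖h‖ ^ 2 - ⟪A h, h⟫_ℝ := by
  have hinner : ∀ i j, (if i = j then (1 : ℝ) else 0) - ⟪A (e j), e i⟫_ℝ =
      ⟪e i, e j - A (e j)⟫_ℝ := by
    intro i j
    rw [inner_sub_right, orthonormal_iff_ite.1 e.orthonormal i j, real_inner_comm (A (e j)) (e i)]
  have h1 : ∀ i, HasSum (fun j => ((if i = j then (1 : ℝ) else 0) - ⟪A (e j), e i⟫_ℝ)
      * e.repr h i * e.repr h j) (⟪h, e i⟫_ℝ * ⟪e i, h - A h⟫_ℝ) := by
    intro i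
    have h2 := (e.hasSum_repr h).mapL
      ((innerSL ℝ (e i)).comp (ContinuousLinearMap.id ℝ E - A))
    have h3 := h2.mul_left ⟪h, e i⟫_ℝ
    have h4 : ∀ j, ((if i = j then (1 : ℝ) else 0) - ⟪A (e j), e i⟫_ℝ) * e.repr h i * e.repr h j =
        ⟪h, e i⟫_ℝ * ((innerSL ℝ (e i)).comp (ContinuousLinearMap.id ℝ E - A))
          (e.repr h j • e j) := by
      intro j
      rw [hinner, e.repr_apply_apply h i, real_inner_comm h (e i)]
      simp only [map_smul, smul_eq_mul, ContinuousLinearMap.comp_apply, innerSL_apply_apply,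
        sub_apply, ContinuousLinearMap.id_apply]
      ring
    simp only [h4]
    exact h3
  rw [tsum_congr fun i => (h1 i).tsum_eq, e.tsum_inner_mul_inner, inner_sub_right,
    real_inner_self_eq_norm_sq, real_inner_comm (A h) h]

lemma tsum_repr_sq {ι E : Type*} [NormedAddCommGroup E]
    [InnerProductSpace ℝ E] (e : HilbertBasis ι ℝ E) (h : E) :
    ∑' i, e.repr h i ^ 2 = ‖h‖ ^ 2 := by
  rw [← real_inner_self_eq_norm_sq, ← e.tsum_inner_mul_inner]
  refine tsum_congr fun i => ?_
  rw [e.repr_apply_apply, real_inner_comm h (e i), sq]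

variable [CompleteSpace X] [SecondCountableTopology X] {μ : Measure X} [IsGaussian μ]
  {ι : Type*}

/-- The exceptional null set in the hypothesis depends on `ξ`. A dense sequence in `H` gives a
single null set, and continuity in `h` extends the inequality to all of `H`; this is needed because
it is evaluated at `h = Φ(x)`. -/
lemma ae_forall_quadratic_le [DecidableEq ι] {e : HilbertBasis ι ℝ (CM μ)}
    {A : X → (CM μ →L[ℝ] CM μ)} {C : ℝ}
    (hbound : ∀ ξ : lp (fun _ : ι => ℝ) 2, ∀ᵐ x ∂μ,
      ∑' i, ∑' j, ((if i = j then (1 : ℝ) else 0) - ⟪A x (e j), e i⟫_ℝ) * ξ i * ξ j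
        ≤ C * ∑' i, ξ i ^ 2) :
    ∀ᵐ x ∂μ, ∀ h : CM μ, ‖h‖ ^ 2 - ⟪A x h, h⟫_ℝ ≤ C * ‖h‖ ^ 2 := by
  have h1 : ∀ n : ℕ, ∀ᵐ x ∂μ, ‖TopologicalSpace.denseSeq (CM μ) n‖ ^ 2
      - ⟪A x (TopologicalSpace.denseSeq (CM μ) n), TopologicalSpace.denseSeq (CM μ) n⟫_ℝ
      ≤ C * ‖TopologicalSpace.denseSeq (CM μ) n‖ ^ 2 := by
    intro n
    filter_upwards [hbound (e.repr (TopologicalSpace.denseSeq (CM μ) n))] with x hx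
    rwa [tsum_tsum_eq_inner_sub, tsum_repr_sq] at hx
  filter_upwards [ae_all_iff.2 h1] with x hx h
  refine (TopologicalSpace.denseRange_denseSeq (CM μ)).induction_on
    (p := fun h => ‖h‖ ^ 2 - ⟪A x h, h⟫_ℝ ≤ C * ‖h‖ ^ 2) h ?_ hx
  exact isClosed_le (by fun_prop) (by fun_prop)

variable {e : HilbertBasis ι ℝ (CM μ)} {w : X → ℝ} {s t : ℝ} {G : X → CM μ}
  {A : X → (CM μ →L[ℝ] CM μ)} {κ : Type*} [Fintype κ]

/-- The divergence with respect to `w μ` of the cylindrical field `∑ᵢ fᵢ hᵢ`. -/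
def cylDiv (G : X → CM μ) (f : κ → X → ℝ) (h : κ → CM μ) (x : X) : ℝ :=
  ∑ i, divTerm G (f i) (h i) x

namespace AdmissibleWeight

lemma memLp_cylDiv (H : AdmissibleWeight e w s t G A) {f : κ → X → ℝ}
    (hf : ∀ i, IsSmoothCyl (f i)) (h : κ → CM μ) : MemLp (cylDiv G f h) 2 (weighted μ w) :=
  memLp_finsetSum _ fun i _ => H.memLp_divTerm (hf i) (h i)

/-- Sum the polarised identity over all pairs `(i, j)`. The integrand `T` is the trace of `(∇_H Φ)²`
plus the form `I - ∇² log w` at `Φ`; the two parts are then estimated pointwise. -/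
lemma integral_cylDiv_sq (H : AdmissibleWeight e w s t G A) {f : κ → X → ℝ}
    (hf : ∀ i, IsSmoothCyl (f i)) (h : κ → CM μ) :
    ∃ T : X → ℝ, Integrable T (weighted μ w) ∧
      ∫ x, cylDiv G f h x ^ 2 ∂(weighted μ w) = ∫ x, T x ∂(weighted μ w) ∧
      ∀ x, T x = (∑ i, ∑ j, ⟪gradH μ (f i) x, h j⟫_ℝ * ⟪gradH μ (f j) x, h i⟫_ℝ)
        + (‖∑ i, f i x • h i‖ ^ 2 - ⟪A x (∑ i, f i x • h i), ∑ i, f i x • h i⟫_ℝ) := by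
  have := H.isFiniteMeasure
  let T₁ : κ → κ → X → ℝ := fun i j x => fderiv ℝ (f i) x (h j).toX * fderiv ℝ (f j) x (h i).toX
  let T₂ : κ → κ → X → ℝ := fun i j x =>
    (⟪h i, h j⟫_ℝ - ⟪A x (h j), h i⟫_ℝ) * (f i x * f j x)
  have i1 : ∀ i j, Integrable (T₁ i j) (weighted μ w) := fun i j =>
    integrable_mul_of_memLp (((hf i).fderiv_apply _).memLp 2) (((hf j).fderiv_apply _).memLp 2)
  have i2 : ∀ i j, Integrable (T₂ i j) (weighted μ w) := fun i j =>
    integrable_mul_of_memLp ((memLp_const _).sub (H.memLp_hess _ _)) (((hf i).mul (hf j)).memLp 2)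
  have i12 : ∀ i j, Integrable (fun x => T₁ i j x + T₂ i j x) (weighted μ w) := fun i j =>
    (i1 i j).add (i2 i j)
  refine ⟨fun x => ∑ i, ∑ j, (T₁ i j x + T₂ i j x),
    integrable_finsetSum _ fun i _ => integrable_finsetSum _ fun j _ => i12 i j,
    ?_, fun x => ?_⟩
  · have i3 : ∀ i j, Integrable (fun x => divTerm G (f i) (h i) x * divTerm G (f j) (h j) x)
        (weighted μ w) := fun i j =>
      integrable_mul_of_memLp (H.memLp_divTerm (hf i) _) (H.memLp_divTerm (hf j) _)
    simp only
    rw [integral_finsetSum _ fun i _ => integrable_finsetSum _ fun j _ => i12 i j]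
    simp only [cylDiv, sq, Finset.sum_mul_sum]
    rw [integral_finsetSum _ fun i _ => integrable_finsetSum _ fun j _ => i3 i j]
    refine Finset.sum_congr rfl fun i _ => ?_
    rw [integral_finsetSum _ fun j _ => i3 i j,
      integral_finsetSum _ fun j _ => i12 i j]
    refine Finset.sum_congr rfl fun j _ => ?_
    rw [integral_add (i1 i j) (i2 i j)]
    exact H.integral_divTerm_mul_divTerm (hf i) (hf j) (h i) (h j)
  · simp only [Finset.sum_add_distrib]
    congr 1
    · refine Finset.sum_congr rfl fun i _ => Finset.sum_congr rfl fun j _ => ?_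
      rw [inner_gradH ((hf i).differentiable x), inner_gradH ((hf j).differentiable x)]
    · rw [← real_inner_self_eq_norm_sq, ← inner_sub_left, map_sum, ← Finset.sum_sub_distrib,
        sum_inner, Finset.sum_comm]
      refine Finset.sum_congr rfl fun j _ => ?_
      rw [inner_sum]
      refine Finset.sum_congr rfl fun i _ => ?_
      simp only [T₂, map_smul, ← smul_sub, inner_smul_left, inner_smul_right, inner_sub_left,
        real_inner_comm (h i) (h j)]
      simp
      ring

/-- The `L²` estimate of the divergence of a cylindrical field. -/
lemma eLpNorm_cylDiv_le (H : AdmissibleWeight e w s t G A) {C : ℝ} (hC : 0 ≤ C)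
    (hA : ∀ᵐ x ∂μ, ∀ h : CM μ, ‖h‖ ^ 2 - ⟪A x h, h⟫_ℝ ≤ C * ‖h‖ ^ 2) {f : κ → X → ℝ}
    (hf : ∀ i, IsSmoothCyl (f i)) (h : κ → CM μ) :
    eLpNorm (cylDiv G f h) 2 (weighted μ w) ≤ ENNReal.ofReal (max (Real.sqrt C) 1) *
      normW1H (weighted μ w) e 2 (fun x => ∑ i, f i x • h i)
        (derivH (fun x => ∑ i, f i x • h i)) := by
  set Φ : X → CM μ := fun x => ∑ i, f i x • h i with hΦ
  obtain ⟨T, hTi, hT, hTx⟩ := H.integral_cylDiv_sq hf h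
  set M : ℝ := max (Real.sqrt C) 1 with hM
  have hM1 : 1 ≤ M := le_max_right _ _
  have hMC : C ≤ M ^ 2 := by
    rw [← Real.sq_sqrt hC]
    exact pow_le_pow_left₀ (Real.sqrt_nonneg _) (le_max_left _ _) 2
  have hΦc : Continuous Φ := by
    refine continuous_finsetSum _ fun i _ => ?_
    exact (hf i).continuous.smul continuous_const
  have hsq : eLpNorm (cylDiv G f h) 2 (weighted μ w) ^ 2 =
      ENNReal.ofReal (∫ x, T x ∂(weighted μ w)) := by
    rw [← hT, ofReal_integral_eq_lintegral_ofReal (H.memLp_cylDiv hf h).integrable_sq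
      (Eventually.of_forall fun x => sq_nonneg _), eLpNorm_two_sq]
    refine lintegral_congr fun x => ?_
    rw [← sq_abs, ENNReal.ofReal_pow (abs_nonneg _), ← Real.norm_eq_abs, ofReal_norm]
  -- The quadratic form costs the factor `C` and the trace the factor `1`; both are at most `M²`.
  have hpt : ∀ᵐ x ∂(weighted μ w), ENNReal.ofReal (T x) ≤
      ENNReal.ofReal (M ^ 2) * (‖Φ x‖ₑ ^ 2 + ‖hsNorm e (derivH Φ x)‖ₑ ^ 2) := by
    filter_upwards [weighted_absolutelyContinuous.ae_le hA] with x hx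
    have h1 : ENNReal.ofReal (∑ i, ∑ j, ⟪gradH μ (f i) x, h j⟫_ℝ * ⟪gradH μ (f j) x, h i⟫_ℝ)
        ≤ hsNorm e (derivH Φ x) ^ 2 := by
      refine ofReal_sum_inner_mul_inner_le e (fun i => gradH μ (f i) x) h _ fun k => ?_
      rw [hΦ, derivH_sum_apply hf]
      refine Finset.sum_congr rfl fun i _ => ?_
      rw [inner_gradH ((hf i).differentiable x)]
    have h2 : ENNReal.ofReal (‖Φ x‖ ^ 2 - ⟪A x (Φ x), Φ x⟫_ℝ) ≤
        ENNReal.ofReal (M ^ 2) * ‖Φ x‖ₑ ^ 2 := by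
      rw [← ofReal_norm, ← ENNReal.ofReal_pow (norm_nonneg _), ← ENNReal.ofReal_mul (by positivity)]
      refine ENNReal.ofReal_le_ofReal ((hx (Φ x)).trans ?_)
      gcongr
    have h3 : (1 : ℝ≥0∞) ≤ ENNReal.ofReal (M ^ 2) := by
      rw [ENNReal.one_le_ofReal]
      exact one_le_pow₀ hM1
    rw [hTx, mul_add, add_comm]
    refine ENNReal.ofReal_add_le.trans (add_le_add h2 (h1.trans ?_))
    rw [enorm_eq_self]
    exact le_mul_of_one_le_left zero_le h3
  have hfin : eLpNorm (cylDiv G f h) 2 (weighted μ w) ^ 2 ≤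
      (ENNReal.ofReal M * normW1H (weighted μ w) e 2 Φ (derivH Φ)) ^ 2 := by
    calc _ = ENNReal.ofReal (∫ x, T x ∂(weighted μ w)) := hsq
      _ ≤ ∫⁻ x, ENNReal.ofReal (T x) ∂(weighted μ w) := ofReal_integral_le_lintegral_ofReal hTi
      _ ≤ ∫⁻ x, ENNReal.ofReal (M ^ 2) * (‖Φ x‖ₑ ^ 2 + ‖hsNorm e (derivH Φ x)‖ₑ ^ 2)
          ∂(weighted μ w) := lintegral_mono_ae hpt
      _ = ENNReal.ofReal (M ^ 2) * (eLpNorm Φ 2 (weighted μ w) ^ 2 +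
          eLpNorm (fun x => hsNorm e (derivH Φ x)) 2 (weighted μ w) ^ 2) := by
        rw [lintegral_const_mul' _ _ ENNReal.ofReal_ne_top, lintegral_add_left
          (hΦc.enorm.measurable.pow_const 2), eLpNorm_two_sq, eLpNorm_two_sq]
      _ ≤ _ := by
        rw [mul_pow, normW1H, ENNReal.ofReal_pow (by positivity)]
        gcongr
        -- The norm of `W^{1,2}` is the sum of its two parts, hence `a² + b² ≤ (a + b)²`.
        rw [add_sq]
        exact add_le_add_left (le_self_add) _
  exact (ENNReal.pow_le_pow_left_iff (by norm_num)).1 hfin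

end AdmissibleWeight

end Estimate

/-! ### Extension of the divergence to the closure. -/

section Closure

variable [CompleteSpace X] [SecondCountableTopology X] {μ : Measure X} [IsGaussian μ]
  {ι : Type*}

lemma normW1H_sub_le [Countable ι] {e : HilbertBasis ι ℝ (CM μ)} {ρ : Measure X}
    {Φ Ψ : X → CM μ} {D B : X → (CM μ →L[ℝ] CM μ)}
    (hΦ : AEStronglyMeasurable Φ ρ) (hΨ : AEStronglyMeasurable Ψ ρ)
    (hD : AEStronglyMeasurable D ρ) (hB : AEStronglyMeasurable B ρ) :
    normW1H ρ e 2 (fun x => Φ x - Ψ x) (fun x => D x - B x)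
      ≤ normW1H ρ e 2 Φ D + normW1H ρ e 2 Ψ B := by
  have h1 : eLpNorm (fun x => Φ x - Ψ x) 2 ρ ≤ eLpNorm Φ 2 ρ + eLpNorm Ψ 2 ρ :=
    eLpNorm_sub_le hΦ hΨ (by norm_num)
  have h2 : eLpNorm (fun x => hsNorm e (D x - B x)) 2 ρ ≤
      eLpNorm (fun x => hsNorm e (D x)) 2 ρ + eLpNorm (fun x => hsNorm e (B x)) 2 ρ := by
    refine le_trans (eLpNorm_mono_enorm fun x => ?_)
      (eLpNorm_add_le (aemeasurable_hsNorm e hD).aestronglyMeasurable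
        (aemeasurable_hsNorm e hB).aestronglyMeasurable (by norm_num))
    simpa only [enorm_eq_self, Pi.add_apply] using hsNorm_sub_le e (D x) (B x)
  unfold normW1H
  calc _ ≤ _ := add_le_add h1 h2
    _ = _ := by abel

/-- `F` is a cylindrical field and `d` is its divergence with respect to `w μ`, where
`G = ∇_H log w`. -/
def IsCylDiv (G : X → CM μ) (F : X → CM μ) (d : X → ℝ) : Prop :=
  ∃ (n : ℕ) (f : Fin n → X → ℝ) (h : Fin n → CM μ), (∀ i, IsSmoothCyl (f i)) ∧
    (F = fun x => ∑ i, f i x • h i) ∧ d = cylDiv G f h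

namespace IsCylDiv

variable {G : X → CM μ} {F F' : X → CM μ} {d d' : X → ℝ}

/-- A field has many representations `∑ᵢ fᵢ hᵢ`. Any one serves to choose `d`; independence of the
choice is never needed, since `IsCylDiv` is a relation. -/
lemma of_isSmoothCylH (hF : IsSmoothCylH F) : ∃ d, IsCylDiv G F d := by
  obtain ⟨n, f, h, hf, rfl⟩ := hF.exists_sum
  exact ⟨_, n, f, h, hf, rfl, rfl⟩

lemma single {f : X → ℝ} (hf : IsSmoothCyl f) (h : CM μ) :
    IsCylDiv G (fun x => f x • h) (divTerm G f h) :=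
  ⟨1, fun _ => f, fun _ => h, fun _ => hf, by simp, by ext; simp [cylDiv]⟩

lemma zero : IsCylDiv G (fun _ => 0) (fun _ => 0) :=
  ⟨0, Fin.elim0, Fin.elim0, fun i => i.elim0, by simp, by ext; simp [cylDiv]⟩

lemma add (hF : IsCylDiv G F d) (hF' : IsCylDiv G F' d') :
    IsCylDiv G (fun x => F x + F' x) (fun x => d x + d' x) := by
  obtain ⟨n, f, h, hf, rfl, rfl⟩ := hF
  obtain ⟨m, f', h', hf', rfl, rfl⟩ := hF'
  refine ⟨n + m, Fin.append f f', Fin.append h h', fun i => ?_, ?_, ?_⟩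
  · refine Fin.addCases (fun i => ?_) (fun i => ?_) i
    · simpa using hf i
    · simpa using hf' i
  · ext x
    simp [Fin.sum_univ_add]
  · ext x
    simp [cylDiv, Fin.sum_univ_add]

lemma neg (hF : IsCylDiv G F d) : IsCylDiv G (fun x => - F x) (fun x => - d x) := by
  obtain ⟨n, f, h, hf, rfl, rfl⟩ := hF
  refine ⟨n, fun i x => - f i x, h, fun i => ?_, ?_, ?_⟩
  · simpa using (hf i).const_mul (-1)
  · ext x
    simp
  · ext x
    simp only [cylDiv, divTerm, fderiv_fun_neg, neg_apply, ← Finset.sum_neg_distrib]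
    refine Finset.sum_congr rfl fun i _ => ?_
    ring

lemma sub (hF : IsCylDiv G F d) (hF' : IsCylDiv G F' d') :
    IsCylDiv G (fun x => F x - F' x) (fun x => d x - d' x) := by
  simpa only [sub_eq_add_neg] using hF.add hF'.neg

lemma sum {κ : Type*} (S : Finset κ) {F : κ → X → CM μ} {d : κ → X → ℝ}
    (hF : ∀ i ∈ S, IsCylDiv G (F i) (d i)) :
    IsCylDiv G (fun x => ∑ i ∈ S, F i x) (fun x => ∑ i ∈ S, d i x) := by
  classical
  induction S using Finset.induction_on with
  | empty => simpa using zero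
  | insert a S ha ih =>
    simp only [Finset.sum_insert ha]
    exact (hF a (by simp)).add (ih fun i hi => hF i (by simp [hi]))

lemma continuous (hF : IsCylDiv G F d) : Continuous F := by
  obtain ⟨n, f, h, hf, rfl, rfl⟩ := hF
  exact continuous_finsetSum _ fun i _ => (hf i).continuous.smul continuous_const

lemma continuous_derivH (hF : IsCylDiv G F d) : Continuous (derivH F) := by
  obtain ⟨n, f, h, hf, rfl, rfl⟩ := hF
  exact continuous_derivH_sum hf h

lemma memLp (hF : IsCylDiv G F d) (ρ : Measure X) [IsFiniteMeasure ρ] : MemLp F 2 ρ := by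
  obtain ⟨n, f, h, hf, rfl, rfl⟩ := hF
  refine memLp_finsetSum _ fun i _ => ?_
  exact ((ContinuousLinearMap.id ℝ ℝ).smulRight (h i)).comp_memLp' ((hf i).memLp 2)

lemma isSmoothCyl_inner (hF : IsCylDiv G F d) (k : CM μ) :
    IsSmoothCyl (fun x => ⟪F x, k⟫_ℝ) := by
  obtain ⟨n, f, h, hf, rfl, rfl⟩ := hF
  simp only [sum_inner, inner_smul_left, RCLike.conj_to_real]
  refine IsSmoothCyl.sum _ fun i _ => ?_
  simpa only [mul_comm] using (hf i).const_mul ⟪h i, k⟫_ℝ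

lemma inner_derivH (hF : IsCylDiv G F d) (k l : CM μ) (x : X) :
    ⟪derivH F x l, k⟫_ℝ = fderiv ℝ (fun x => ⟪F x, k⟫_ℝ) x l.toX := by
  obtain ⟨n, f, h, hf, rfl, rfl⟩ := hF
  rw [derivH_sum_apply hf]
  simp only [sum_inner, inner_smul_left, RCLike.conj_to_real]
  rw [fderiv_fun_sum fun i _ => ((hf i).differentiable x).mul_const _]
  simp only [fderiv_mul_const ((hf _).differentiable x), sum_apply, smul_apply, smul_eq_mul]
  refine Finset.sum_congr rfl fun i _ => mul_comm _ _

/-- Testing against pairs of vectors reduces derivatives of fields to derivatives of the scalar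
functions `⟨F, k⟩`. -/
lemma derivH_ext (hF : IsCylDiv G F d) {x : X} {T : CM μ →L[ℝ] CM μ}
    (h : ∀ k l : CM μ, fderiv ℝ (fun x => ⟪F x, k⟫_ℝ) x l.toX = ⟪T l, k⟫_ℝ) :
    derivH F x = T := by
  ext l
  refine ext_inner_right ℝ fun k => ?_
  rw [hF.inner_derivH, h]

lemma derivH_sub (hF : IsCylDiv G F d) (hF' : IsCylDiv G F' d') (x : X) :
    derivH (fun x => F x - F' x) x = derivH F x - derivH F' x := by
  refine (hF.sub hF').derivH_ext fun k l => ?_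
  simp only [inner_sub_left, sub_apply]
  rw [fderiv_fun_sub ((hF.isSmoothCyl_inner k).differentiable x)
    ((hF'.isSmoothCyl_inner k).differentiable x), hF.inner_derivH, hF'.inner_derivH]
  rfl

/-- The operator `∇_H F` takes the direction of differentiation as its argument, whereas the
gradient of `⟨F, k⟩` is paired with that direction; hence the adjoint. -/
lemma gradH_inner (hF : IsCylDiv G F d) (k : CM μ) (x : X) :
    gradH μ (fun x => ⟪F x, k⟫_ℝ) x = ContinuousLinearMap.adjoint (derivH F x) k := by
  refine ext_inner_right ℝ fun l => ?_
  rw [inner_gradH ((hF.isSmoothCyl_inner k).differentiable x), ← hF.inner_derivH,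
    ContinuousLinearMap.adjoint_inner_left, real_inner_comm]

variable {e : HilbertBasis ι ℝ (CM μ)} {w : X → ℝ} {s t : ℝ} {A : X → (CM μ →L[ℝ] CM μ)}

lemma memLp_div (hF : IsCylDiv G F d) (H : AdmissibleWeight e w s t G A) :
    MemLp d 2 (weighted μ w) := by
  obtain ⟨n, f, h, hf, rfl, rfl⟩ := hF
  exact H.memLp_cylDiv hf h

lemma eLpNorm_le (hF : IsCylDiv G F d) (H : AdmissibleWeight e w s t G A) {C : ℝ} (hC : 0 ≤ C)
    (hA : ∀ᵐ x ∂μ, ∀ h : CM μ, ‖h‖ ^ 2 - ⟪A x h, h⟫_ℝ ≤ C * ‖h‖ ^ 2) :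
    eLpNorm d 2 (weighted μ w) ≤ ENNReal.ofReal (max (Real.sqrt C) 1) *
      normW1H (weighted μ w) e 2 F (derivH F) := by
  obtain ⟨n, f, h, hf, rfl, rfl⟩ := hF
  exact H.eLpNorm_cylDiv_le hC hA hf h

lemma integral_inner_gradH (hF : IsCylDiv G F d) (H : AdmissibleWeight e w s t G A) {f : X → ℝ}
    (hf : IsSmoothCyl f) :
    ∫ x, ⟪gradH μ f x, F x⟫_ℝ ∂(weighted μ w) = - ∫ x, f x * d x ∂(weighted μ w) := by
  have := H.isFiniteMeasure
  obtain ⟨n, φ, h, hφ, rfl, rfl⟩ := hF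
  simp only [cylDiv, Finset.mul_sum, inner_sum, inner_smul_right]
  rw [integral_finsetSum _ fun i _ => integrable_mul_of_memLp (hf.memLp 2)
      (H.memLp_divTerm (hφ i) (h i)),
    integral_finsetSum _ fun i _ => integrable_mul_of_memLp ((hφ i).memLp 2)
      ((memLp_gradH hf 2).inner_const (h i)), ← Finset.sum_neg_distrib]
  refine Finset.sum_congr rfl fun i _ => ?_
  rw [H.integral_mul_divTerm hf (hφ i), neg_neg]
  refine integral_congr_ae (Eventually.of_forall fun x => ?_)
  simp only [inner_gradH (hf.differentiable x)]
  ring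

end IsCylDiv

/-- `(Φ, D, g)` is a limit of cylindrical fields with their derivatives and divergences. -/
structure IsDivLimit (e : HilbertBasis ι ℝ (CM μ)) (w : X → ℝ) (G : X → CM μ) (Φ : X → CM μ)
    (D : X → (CM μ →L[ℝ] CM μ)) (g : X → ℝ) (F : ℕ → X → CM μ) (d : ℕ → X → ℝ) : Prop where
  memLp : MemLp Φ 2 (weighted μ w)
  aestronglyMeasurable : AEStronglyMeasurable D (weighted μ w)
  memLp_div : MemLp g 2 (weighted μ w)
  isCylDiv : ∀ k, IsCylDiv G (F k) (d k)
  tendsto_norm : Tendsto (fun k => normW1H (weighted μ w) e 2 (fun x => Φ x - F k x)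
    (fun x => D x - derivH (F k) x)) atTop (𝓝 0)
  tendsto_div : Tendsto (fun k => eLpNorm (fun x => g x - d k x) 2 (weighted μ w)) atTop (𝓝 0)

section

variable {e : HilbertBasis ι ℝ (CM μ)} {w : X → ℝ} {s t : ℝ} {G : X → CM μ}
  {A : X → (CM μ →L[ℝ] CM μ)} {C : ℝ} {Φ Φ' : X → CM μ} {D D' : X → (CM μ →L[ℝ] CM μ)}
  {g g' : X → ℝ} {F F' : ℕ → X → CM μ} {d d' : ℕ → X → ℝ}

/-- The cylindrical estimate applied to `F_k - F_l` makes the divergences a Cauchy sequence in the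
complete space `L²(ν)`. -/
lemma AdmissibleWeight.exists_isDivLimit [Countable ι] (H : AdmissibleWeight e w s t G A)
    (hC : 0 ≤ C) (hA : ∀ᵐ x ∂μ, ∀ h : CM μ, ‖h‖ ^ 2 - ⟪A x h, h⟫_ℝ ≤ C * ‖h‖ ^ 2)
    (hΦ : MemLp Φ 2 (weighted μ w)) (hD : AEStronglyMeasurable D (weighted μ w))
    (hF : ∀ k, IsCylDiv G (F k) (d k))
    (hl : Tendsto (fun k => normW1H (weighted μ w) e 2 (fun x => Φ x - F k x)
      (fun x => D x - derivH (F k) x)) atTop (𝓝 0)) :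
    ∃ g, IsDivLimit e w G Φ D g F d := by
  set M : ℝ≥0∞ := ENNReal.ofReal (max (Real.sqrt C) 1)
  set a : ℕ → ℝ≥0∞ := fun k => normW1H (weighted μ w) e 2 (fun x => Φ x - F k x)
      (fun x => D x - derivH (F k) x)
  have hdist : ∀ k l, eLpNorm (fun x => d k x - d l x) 2 (weighted μ w) ≤ M * (a k + a l) := by
    intro k l
    refine (((hF k).sub (hF l)).eLpNorm_le H hC hA).trans ?_
    gcongr
    have h1 : (fun x => F k x - F l x) = fun x => (Φ x - F l x) - (Φ x - F k x) := by
      ext x; simp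
    have h2 : derivH (fun x => F k x - F l x) =
        fun x => (D x - derivH (F l) x) - (D x - derivH (F k) x) := by
      ext1 x; rw [(hF k).derivH_sub (hF l)]; abel
    rw [h2, h1, add_comm (a k)]
    exact normW1H_sub_le (hΦ.1.sub (hF l).continuous.aestronglyMeasurable)
      (hΦ.1.sub (hF k).continuous.aestronglyMeasurable)
      (hD.sub (hF l).continuous_derivH.aestronglyMeasurable)
      (hD.sub (hF k).continuous_derivH.aestronglyMeasurable)
  have hm : ∀ k, MemLp (d k) 2 (weighted μ w) := fun k => (hF k).memLp_div H
  have hMa : Tendsto (fun k => M * a k) atTop (𝓝 0) := by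
    simpa using ENNReal.Tendsto.const_mul (a := M) hl (Or.inr ENNReal.ofReal_ne_top)
  have hcauchy : CauchySeq (fun k => (hm k).toLp (d k)) := by
    refine EMetric.cauchySeq_iff.2 fun ε hε => ?_
    have hev := hMa.eventually (gt_mem_nhds (ENNReal.half_pos hε.ne'))
    obtain ⟨N, hN⟩ := eventually_atTop.1 hev
    refine ⟨N, fun k hk l hl => ?_⟩
    rw [Lp.edist_toLp_toLp]
    calc _ ≤ M * (a k + a l) := hdist k l
      _ = M * a k + M * a l := mul_add _ _ _
      _ < ε / 2 + ε / 2 := ENNReal.add_lt_add (hN k hk) (hN l hl)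
      _ = ε := ENNReal.add_halves ε
  obtain ⟨g, hg⟩ := cauchySeq_tendsto_of_complete hcauchy
  refine ⟨g, hΦ, hD, Lp.memLp g, hF, hl, ?_⟩
  rw [← Lp.toLp_coeFn g (Lp.memLp g), Lp.tendsto_Lp_iff_tendsto_eLpNorm'' d hm g (Lp.memLp g)] at hg
  exact hg.congr fun k => eLpNorm_sub_comm (d k) g 2 _

namespace IsDivLimit

/-- Two triangle inequalities, one for `g = (g - d_k) + d_k` and one for `F_k = Φ - (Φ - F_k)`,
carry the cylindrical estimate to the limit with the same constant. -/
lemma eLpNorm_le [Countable ι] (h : IsDivLimit e w G Φ D g F d)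
    (H : AdmissibleWeight e w s t G A)
    (hC : 0 ≤ C) (hA : ∀ᵐ x ∂μ, ∀ h : CM μ, ‖h‖ ^ 2 - ⟪A x h, h⟫_ℝ ≤ C * ‖h‖ ^ 2) :
    eLpNorm g 2 (weighted μ w) ≤ ENNReal.ofReal (max (Real.sqrt C) 1) *
      normW1H (weighted μ w) e 2 Φ D := by
  set M : ℝ≥0∞ := ENNReal.ofReal (max (Real.sqrt C) 1)
  have hlim : Tendsto (fun k => eLpNorm (fun x => g x - d k x) 2 (weighted μ w) +
      M * (normW1H (weighted μ w) e 2 Φ D + normW1H (weighted μ w) e 2 (fun x => Φ x - F k x)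
        (fun x => D x - derivH (F k) x))) atTop
      (𝓝 (0 + M * (normW1H (weighted μ w) e 2 Φ D + 0))) :=
    h.tendsto_div.add (ENNReal.Tendsto.const_mul (tendsto_const_nhds.add h.tendsto_norm)
      (Or.inr ENNReal.ofReal_ne_top))
  rw [zero_add, add_zero] at hlim
  refine ge_of_tendsto' hlim fun k => ?_
  have hk := h.isCylDiv k
  have hdk := hk.memLp_div H
  have h1 : eLpNorm g 2 (weighted μ w) ≤
      eLpNorm (fun x => g x - d k x) 2 (weighted μ w) + eLpNorm (d k) 2 (weighted μ w) := by
    have h2 := eLpNorm_add_le (h.memLp_div.1.sub hdk.1) hdk.1 (p := 2) (by norm_num)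
    rwa [sub_add_cancel] at h2
  refine h1.trans (add_le_add le_rfl ((hk.eLpNorm_le H hC hA).trans ?_))
  gcongr
  have h2 : F k = fun x => Φ x - (Φ x - F k x) := by ext x; simp
  have h3 : derivH (F k) = fun x => D x - (D x - derivH (F k) x) := by ext1 x; abel
  calc normW1H (weighted μ w) e 2 (F k) (derivH (F k))
      = normW1H (weighted μ w) e 2 (fun x => Φ x - (Φ x - F k x))
        (fun x => D x - (D x - derivH (F k) x)) := by rw [← h2, ← h3]
    _ ≤ _ := normW1H_sub_le h.memLp.1 (h.memLp.1.sub hk.continuous.aestronglyMeasurable)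
      h.aestronglyMeasurable (h.aestronglyMeasurable.sub hk.continuous_derivH.aestronglyMeasurable)

/-- Linearity lets the estimate be applied to the difference between `Φ` and its truncations. -/
lemma sub [Countable ι] (h : IsDivLimit e w G Φ D g F d) (h' : IsDivLimit e w G Φ' D' g' F' d')
    (H : AdmissibleWeight e w s t G A) :
    IsDivLimit e w G (fun x => Φ x - Φ' x) (fun x => D x - D' x) (fun x => g x - g' x)
      (fun k x => F k x - F' k x) (fun k x => d k x - d' k x) where
  memLp := h.memLp.sub h'.memLp
  aestronglyMeasurable := h.aestronglyMeasurable.sub h'.aestronglyMeasurable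
  memLp_div := h.memLp_div.sub h'.memLp_div
  isCylDiv k := (h.isCylDiv k).sub (h'.isCylDiv k)
  tendsto_norm := by
    have hlim := h.tendsto_norm.add h'.tendsto_norm
    rw [add_zero] at hlim
    refine tendsto_of_tendsto_of_tendsto_of_le_of_le tendsto_const_nhds hlim (fun _ => zero_le)
      fun k => ?_
    have hk := h.isCylDiv k
    have hk' := h'.isCylDiv k
    have h1 : (fun x => Φ x - Φ' x - (F k x - F' k x)) =
        fun x => (Φ x - F k x) - (Φ' x - F' k x) := by ext x; abel_nf
    have h2 : (fun x => D x - D' x - derivH (fun x => F k x - F' k x) x) =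
        fun x => (D x - derivH (F k) x) - (D' x - derivH (F' k) x) := by
      ext1 x; rw [hk.derivH_sub hk']; abel
    simp only [h1, h2]
    exact normW1H_sub_le (h.memLp.1.sub hk.continuous.aestronglyMeasurable)
      (h'.memLp.1.sub hk'.continuous.aestronglyMeasurable)
      (h.aestronglyMeasurable.sub hk.continuous_derivH.aestronglyMeasurable)
      (h'.aestronglyMeasurable.sub hk'.continuous_derivH.aestronglyMeasurable)
  tendsto_div := by
    have hlim := h.tendsto_div.add h'.tendsto_div
    rw [add_zero] at hlim
    refine tendsto_of_tendsto_of_tendsto_of_le_of_le tendsto_const_nhds hlim (fun _ => zero_le)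
      fun k => ?_
    have h1 : (fun x => g x - g' x - (d k x - d' k x)) =
        (fun x => g x - d k x) - (fun x => g' x - d' k x) := by ext x; simp; ring
    rw [h1]
    exact eLpNorm_sub_le (h.memLp_div.1.sub ((h.isCylDiv k).memLp_div H).1)
      (h'.memLp_div.1.sub ((h'.isCylDiv k).memLp_div H).1) (by norm_num)

lemma tendsto_field (h : IsDivLimit e w G Φ D g F d) :
    Tendsto (fun k => eLpNorm (fun x => Φ x - F k x) 2 (weighted μ w)) atTop (𝓝 0) :=
  tendsto_of_tendsto_of_tendsto_of_le_of_le tendsto_const_nhds h.tendsto_norm (fun _ => zero_le)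
    fun _ => le_self_add

lemma integral_inner_gradH (h : IsDivLimit e w G Φ D g F d) (H : AdmissibleWeight e w s t G A)
    {f : X → ℝ} (hf : IsSmoothCyl f) :
    ∫ x, ⟪gradH μ f x, Φ x⟫_ℝ ∂(weighted μ w) = - ∫ x, f x * g x ∂(weighted μ w) := by
  have := H.isFiniteMeasure
  have h1 := tendsto_integral_inner (memLp_gradH hf 2) h.memLp (fun _ => memLp_gradH hf 2)
    (fun k => (h.isCylDiv k).memLp (weighted μ w)) (by simp) h.tendsto_field
  have h2 := tendsto_integral_mul (hf.memLp 2) h.memLp_div (fun _ => hf.memLp 2)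
    (fun k => (h.isCylDiv k).memLp_div H) (by simp) h.tendsto_div
  refine tendsto_nhds_unique h1 (h2.neg.congr fun k => ?_)
  rw [(h.isCylDiv k).integral_inner_gradH H hf]

/-- The field has already been passed to the limit; now `f` is approximated with `Φ` and `g` fixed.
-/
lemma integral_inner_of_isW1 (h : IsDivLimit e w G Φ D g F d) (H : AdmissibleWeight e w s t G A)
    {f : X → ℝ} {Gf : X → CM μ} (hf : IsW1 μ (weighted μ w) 2 f Gf) :
    ∫ x, ⟪Gf x, Φ x⟫_ℝ ∂(weighted μ w) = - ∫ x, f x * g x ∂(weighted μ w) := by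
  have := H.isFiniteMeasure
  obtain ⟨hfm, hGm, φ, hφ, hφf, hφG⟩ := hf
  have h1 := tendsto_integral_inner hGm h.memLp (fun k => memLp_gradH (hφ k) 2)
    (fun _ => h.memLp) hφG (by simp)
  have h2 := tendsto_integral_mul hfm h.memLp_div (fun k => (hφ k).memLp 2)
    (fun _ => h.memLp_div) hφf (by simp)
  refine tendsto_nhds_unique h1 (h2.neg.congr fun k => ?_)
  rw [h.integral_inner_gradH H (hφ k)]

end IsDivLimit

end

end Closure

/-! ### Projections onto finitely many basis vectors. -/

section Truncation

variable {ι E : Type*} [NormedAddCommGroup E] [InnerProductSpace ℝ E]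
  (e : HilbertBasis ι ℝ E) (S : Finset ι)

/-- The orthogonal projection onto the span of finitely many basis vectors. -/
def trunc : E →L[ℝ] E := ∑ n ∈ S, (innerSL ℝ (e n)).smulRight (e n)

lemma trunc_apply (y : E) : trunc e S y = ∑ n ∈ S, ⟪y, e n⟫_ℝ • e n := by
  simp [trunc, sum_apply, real_inner_comm]

lemma inner_trunc_comm (y z : E) : ⟪trunc e S y, z⟫_ℝ = ⟪y, trunc e S z⟫_ℝ := by
  rw [trunc_apply, trunc_apply, sum_inner, inner_sum]
  refine Finset.sum_congr rfl fun n _ => ?_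
  rw [inner_smul_left, inner_smul_right, real_inner_comm z (e n)]
  simp [mul_comm]

lemma inner_sub_trunc [DecidableEq ι] (y : E) (j : ι) :
    ⟪y - trunc e S y, e j⟫_ℝ = if j ∈ S then 0 else ⟪y, e j⟫_ℝ := by
  have h : trunc e S (e j) = if j ∈ S then e j else 0 := by
    rw [trunc_apply]
    simp only [orthonormal_iff_ite.1 e.orthonormal, ite_smul, one_smul, zero_smul,
      Finset.sum_ite_eq]
  rw [inner_sub_left, inner_trunc_comm, h]
  split_ifs <;> simp

lemma tsum_ite_notMem [DecidableEq ι] (a : ι → ℝ≥0∞) :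
    ∑' j, (if j ∈ S then 0 else a j) = ∑' j : {j // j ∉ S}, a j := by
  have h := tsum_subtype {j | j ∉ S} a
  refine Eq.trans (tsum_congr fun j => ?_) h.symm
  by_cases hj : j ∈ S <;> simp [Set.indicator, hj]

lemma enorm_sub_trunc_sq (y : E) :
    ‖y - trunc e S y‖ₑ ^ 2 = ∑' j : {j // j ∉ S}, ‖⟪y, e j⟫_ℝ‖ₑ ^ 2 := by
  classical
  rw [← tsum_enorm_inner_sq e, ← tsum_ite_notMem S fun j => ‖⟪y, e j⟫_ℝ‖ₑ ^ 2]
  refine tsum_congr fun j => ?_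
  rw [inner_sub_trunc]
  split_ifs <;> simp

/-- The projection acts on values of `A`, so what remains are the rows `A* e_j` with `j ∉ S`, not
the columns `A e_j`. -/
lemma hsNorm_sub_trunc_sq [CompleteSpace E] (A : E →L[ℝ] E) :
    hsNorm e (A - (trunc e S).comp A) ^ 2 =
      ∑' j : {j // j ∉ S}, ‖ContinuousLinearMap.adjoint A (e j)‖ₑ ^ 2 := by
  rw [hsNorm_sq]
  simp only [sub_apply, ContinuousLinearMap.comp_apply, enorm_sub_trunc_sq]
  rw [ENNReal.tsum_comm]
  refine tsum_congr fun j => ?_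
  rw [← tsum_enorm_inner_sq e]
  refine tsum_congr fun i => ?_
  rw [ContinuousLinearMap.adjoint_inner_left, real_inner_comm]

/-- Exchanging sum and integral leaves the tails of a convergent series in `[0, ∞]`. They vanish
along the directed set of finite subsets, which is the source of unconditional convergence. -/
lemma tendsto_lintegral_tsum_compl [Countable ι] {Ω : Type*} [MeasurableSpace Ω] {ρ : Measure Ω}
    {a : ι → Ω → ℝ≥0∞} (ha : ∀ j, AEMeasurable (a j) ρ) (hfin : ∫⁻ x, ∑' j, a j x ∂ρ ≠ ⊤) :
    Tendsto (fun S : Finset ι => ∫⁻ x, ∑' j : {j // j ∉ S}, a j x ∂ρ) atTop (𝓝 0) := by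
  rw [lintegral_tsum ha] at hfin
  refine (ENNReal.tendsto_tsum_compl_atTop_zero hfin).congr fun S => ?_
  rw [lintegral_tsum fun j : {j // j ∉ S} => ha j]

lemma tendsto_of_tendsto_sq {α : Type*} {l : Filter α} {u : α → ℝ≥0∞}
    (h : Tendsto (fun a => u a ^ 2) l (𝓝 0)) : Tendsto u l (𝓝 0) := by
  have h1 := (ENNReal.continuous_rpow_const (y := (1 / 2 : ℝ))).tendsto 0 |>.comp h
  rw [ENNReal.zero_rpow_of_pos (by norm_num)] at h1
  refine h1.congr fun a => ?_
  simp only [Function.comp]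
  rw [← ENNReal.rpow_natCast, ← ENNReal.rpow_mul]
  norm_num

end Truncation

/-! ### The divergence as a series. -/

section Series

variable [CompleteSpace X] [SecondCountableTopology X] {μ : Measure X} [IsGaussian μ]
  {ι : Type*} {e : HilbertBasis ι ℝ (CM μ)} {w : X → ℝ} {s t : ℝ} {G : X → CM μ}
  {A : X → (CM μ →L[ℝ] CM μ)} {C : ℝ} {Φ : X → CM μ} {D : X → (CM μ →L[ℝ] CM μ)}
  {g : X → ℝ} {F : ℕ → X → CM μ} {d : ℕ → X → ℝ}

lemma tendsto_normW1H_sub_trunc [Countable ι] {ρ : Measure X} (hΦ : MemLp Φ 2 ρ)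
    (hD : AEStronglyMeasurable D ρ) (hDfin : eLpNorm (fun x => hsNorm e (D x)) 2 ρ ≠ ⊤) :
    Tendsto (fun S : Finset ι => normW1H ρ e 2 (fun x => Φ x - trunc e S (Φ x))
      (fun x => D x - (trunc e S).comp (D x))) atTop (𝓝 0) := by
  have h1 : Tendsto (fun S : Finset ι => eLpNorm (fun x => Φ x - trunc e S (Φ x)) 2 ρ)
      atTop (𝓝 0) := by
    refine tendsto_of_tendsto_sq ?_
    simp only [eLpNorm_two_sq, enorm_sub_trunc_sq]
    refine tendsto_lintegral_tsum_compl (a := fun j x => ‖⟪Φ x, e j⟫_ℝ‖ₑ ^ 2)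
      (fun j => ((hΦ.inner_const (e j)).1.enorm.pow_const 2)) ?_
    simp only [tsum_enorm_inner_sq, ← eLpNorm_two_sq]
    exact ENNReal.pow_ne_top hΦ.2.ne
  have h2 : Tendsto (fun S : Finset ι =>
      eLpNorm (fun x => hsNorm e (D x - (trunc e S).comp (D x))) 2 ρ) atTop (𝓝 0) := by
    refine tendsto_of_tendsto_sq ?_
    simp only [eLpNorm_two_sq, enorm_eq_self, hsNorm_sub_trunc_sq]
    refine tendsto_lintegral_tsum_compl
      (a := fun j x => ‖ContinuousLinearMap.adjoint (D x) (e j)‖ₑ ^ 2) (fun j => ?_) ?_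
    · have h3 : AEStronglyMeasurable (fun x => ContinuousLinearMap.adjoint (D x)) ρ :=
        (ContinuousLinearMap.adjoint (𝕜 := ℝ) (E := CM μ)
          (F := CM μ)).continuous.comp_aestronglyMeasurable hD
      exact ((ContinuousLinearMap.apply ℝ (CM μ) (e j)).continuous.comp_aestronglyMeasurable
        h3).enorm.pow_const 2
    · have h4 : ∀ x, ∑' j, ‖ContinuousLinearMap.adjoint (D x) (e j)‖ₑ ^ 2 =
          ‖hsNorm e (D x)‖ₑ ^ 2 := fun x => by
        rw [← hsNorm_sq, hsNorm_adjoint, enorm_eq_self]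
      simp only [h4, ← eLpNorm_two_sq]
      exact ENNReal.pow_ne_top hDfin
  have h3 := h1.add h2
  rw [add_zero] at h3
  exact h3

lemma IsCylDiv.trunc {f : X → CM μ} {δ : X → ℝ} (hf : IsCylDiv G f δ) (S : Finset ι) :
    IsCylDiv G (fun x => trunc e S (f x))
      (fun x => ∑ n ∈ S, divTerm G (fun x => ⟪f x, e n⟫_ℝ) (e n) x) := by
  simp only [trunc_apply]
  exact IsCylDiv.sum S fun n _ => IsCylDiv.single (hf.isSmoothCyl_inner (e n)) (e n)

lemma IsCylDiv.derivH_trunc {f : X → CM μ} {δ : X → ℝ} (hf : IsCylDiv G f δ) (S : Finset ι)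
    (x : X) : derivH (fun x => WeightedGaussian.trunc e S (f x)) x =
      (WeightedGaussian.trunc e S).comp (derivH f x) := by
  refine (hf.trunc S).derivH_ext fun k l => ?_
  simp only [inner_trunc_comm, ContinuousLinearMap.comp_apply]
  rw [hf.inner_derivH]

/-- A crude bound by the operator norm is enough: `S` stays fixed while the approximants of `Φ`
vary. -/
lemma normW1H_trunc_le {ρ : Measure X} (S : Finset ι) (Ψ : X → CM μ)
    (B : X → (CM μ →L[ℝ] CM μ)) :
    normW1H ρ e 2 (fun x => trunc e S (Ψ x)) (fun x => (trunc e S).comp (B x)) ≤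
      ‖trunc e S‖ₑ * normW1H ρ e 2 Ψ B := by
  rw [normW1H, normW1H, mul_add]
  refine add_le_add ?_ ?_
  · exact eLpNorm_le_mul_eLpNorm_of_ae_le_mul' (c := ‖trunc e S‖₊)
      (Eventually.of_forall fun x => (trunc e S).le_opENorm _) 2
  · exact eLpNorm_le_mul_eLpNorm_of_ae_le_mul' (c := ‖trunc e S‖₊)
      (Eventually.of_forall fun x => hsNorm_comp_le e _ _) 2

namespace IsDivLimit

lemma tendsto_adjoint (h : IsDivLimit e w G Φ D g F d) (k : CM μ) :
    Tendsto (fun j => eLpNorm (fun x => ContinuousLinearMap.adjoint (D x) k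
      - gradH μ (fun x => ⟪F j x, k⟫_ℝ) x) 2 (weighted μ w)) atTop (𝓝 0) := by
  have h0 := ENNReal.Tendsto.const_mul (a := (‖k‖₊ : ℝ≥0∞)) h.tendsto_norm
    (Or.inr ENNReal.coe_ne_top)
  rw [mul_zero] at h0
  refine tendsto_of_tendsto_of_tendsto_of_le_of_le tendsto_const_nhds h0 (fun _ => zero_le)
    fun j => ?_
  have h1 : eLpNorm (fun x => ContinuousLinearMap.adjoint (D x) k
      - gradH μ (fun x => ⟪F j x, k⟫_ℝ) x) 2 (weighted μ w) ≤
      ‖k‖₊ * eLpNorm (fun x => hsNorm e (D x - derivH (F j) x)) 2 (weighted μ w) := by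
    refine eLpNorm_le_mul_eLpNorm_of_ae_le_mul' (Eventually.of_forall fun x => ?_) 2
    rw [(h.isCylDiv j).gradH_inner, ← sub_apply, ← map_sub, enorm_eq_self,
      ← hsNorm_adjoint e]
    exact enorm_apply_le_hsNorm e _ _
  refine h1.trans ?_
  gcongr
  exact le_add_self

lemma memLp_adjoint (h : IsDivLimit e w G Φ D g F d)
    (hD : eLpNorm (fun x => hsNorm e (D x)) 2 (weighted μ w) ≠ ⊤) (k : CM μ) :
    MemLp (fun x => ContinuousLinearMap.adjoint (D x) k) 2 (weighted μ w) := by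
  have h3 : AEStronglyMeasurable (fun x => ContinuousLinearMap.adjoint (D x)) (weighted μ w) :=
    (ContinuousLinearMap.adjoint (𝕜 := ℝ) (E := CM μ)
      (F := CM μ)).continuous.comp_aestronglyMeasurable h.aestronglyMeasurable
  refine ⟨(ContinuousLinearMap.apply ℝ (CM μ) k).continuous.comp_aestronglyMeasurable h3, ?_⟩
  have h1 : eLpNorm (fun x => ContinuousLinearMap.adjoint (D x) k) 2 (weighted μ w) ≤
      ‖k‖₊ * eLpNorm (fun x => hsNorm e (D x)) 2 (weighted μ w) := by
    refine eLpNorm_le_mul_eLpNorm_of_ae_le_mul' (Eventually.of_forall fun x => ?_) 2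
    rw [enorm_eq_self, ← hsNorm_adjoint e]
    exact enorm_apply_le_hsNorm e _ _
  exact h1.trans_lt (ENNReal.mul_lt_top ENNReal.coe_lt_top hD.lt_top)

/-- The coordinates of approximating cylindrical fields are cylindrical functions, and their
gradients converge because the Hilbert–Schmidt norm is invariant under adjoints. -/
lemma isW1_inner (h : IsDivLimit e w G Φ D g F d)
    (hD : eLpNorm (fun x => hsNorm e (D x)) 2 (weighted μ w) ≠ ⊤) (k : CM μ) :
    IsW1 μ (weighted μ w) 2 (fun x => ⟪Φ x, k⟫_ℝ)
      (fun x => ContinuousLinearMap.adjoint (D x) k) :=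
  ⟨h.memLp.inner_const k, h.memLp_adjoint hD k, fun j x => ⟪F j x, k⟫_ℝ,
    fun j => (h.isCylDiv j).isSmoothCyl_inner k, tendsto_eLpNorm_inner_sub h.tendsto_field k,
    h.tendsto_adjoint k⟩

/-- The divergence of the truncated field is a partial sum of the series. -/
lemma exists_trunc [Countable ι] (h : IsDivLimit e w G Φ D g F d)
    (H : AdmissibleWeight e w s t G A) (hC : 0 ≤ C)
    (hA : ∀ᵐ x ∂μ, ∀ h : CM μ, ‖h‖ ^ 2 - ⟪A x h, h⟫_ℝ ≤ C * ‖h‖ ^ 2)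
    (hD : eLpNorm (fun x => hsNorm e (D x)) 2 (weighted μ w) ≠ ⊤) (S : Finset ι) :
    ∃ g' F' d', IsDivLimit e w G (fun x => trunc e S (Φ x)) (fun x => (trunc e S).comp (D x))
      g' F' d' ∧ g' =ᵐ[weighted μ w] fun x => ∑ n ∈ S,
        (⟪ContinuousLinearMap.adjoint (D x) (e n), e n⟫_ℝ + ⟪Φ x, e n⟫_ℝ * score G (e n) x) := by
  have := H.isFiniteMeasure
  have hcyl := fun k => (h.isCylDiv k).trunc (e := e) S
  have hlim : Tendsto (fun k => normW1H (weighted μ w) e 2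
      (fun x => trunc e S (Φ x) - trunc e S (F k x))
      (fun x => (trunc e S).comp (D x) - derivH (fun x => trunc e S (F k x)) x)) atTop (𝓝 0) := by
    have h1 := ENNReal.Tendsto.const_mul (a := ‖trunc e S‖ₑ) h.tendsto_norm (Or.inr (by simp))
    rw [mul_zero] at h1
    refine tendsto_of_tendsto_of_tendsto_of_le_of_le tendsto_const_nhds h1 (fun _ => zero_le)
      fun k => ?_
    refine le_trans (le_of_eq ?_) (normW1H_trunc_le S (fun x => Φ x - F k x)
      (fun x => D x - derivH (F k) x))
    congr 1
    · ext1 x; rw [map_sub]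
    · ext1 x; rw [(h.isCylDiv k).derivH_trunc, ContinuousLinearMap.comp_sub]
  obtain ⟨g', hg'⟩ := H.exists_isDivLimit hC hA ((trunc e S).comp_memLp' h.memLp)
    (((ContinuousLinearMap.compL ℝ (CM μ) (CM μ) (CM μ)
      (trunc e S)).continuous).comp_aestronglyMeasurable h.aestronglyMeasurable) hcyl hlim
  refine ⟨g', _, _, hg', ?_⟩
  -- The products of `⟨Φ, e_n⟩` with the score are a priori only in `L¹(ν)`, so `g'` and `gS` are
  -- compared in `L¹(ν)`; since `ν` is finite, `L²(ν)` convergence of `dS` to `g'` implies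
  -- convergence there.
  set dS : ℕ → X → ℝ := fun k x => ∑ n ∈ S, divTerm G (fun x => ⟪F k x, e n⟫_ℝ) (e n) x
  set gS : X → ℝ := fun x => ∑ n ∈ S,
    (⟪ContinuousLinearMap.adjoint (D x) (e n), e n⟫_ℝ + ⟪Φ x, e n⟫_ℝ * score G (e n) x)
  have hterm1 : ∀ n k, AEStronglyMeasurable (fun x =>
      ⟪ContinuousLinearMap.adjoint (D x) (e n), e n⟫_ℝ
        - ⟪gradH μ (fun x => ⟪F k x, e n⟫_ℝ) x, e n⟫_ℝ) (weighted μ w) := fun n k =>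
    ((h.memLp_adjoint hD (e n)).inner_const (e n)).1.sub
      ((memLp_gradH ((h.isCylDiv k).isSmoothCyl_inner (e n)) 2).inner_const (e n)).1
  have hterm2 : ∀ n k, AEStronglyMeasurable (fun x => ⟪Φ x, e n⟫_ℝ - ⟪F k x, e n⟫_ℝ)
      (weighted μ w) := fun n k => (h.memLp.inner_const (e n)).1.sub
    ((h.isCylDiv k).isSmoothCyl_inner (e n)).continuous.aestronglyMeasurable
  -- convergence to `gS` in `L¹`
  have hL1 : Tendsto (fun k => eLpNorm (fun x => gS x - dS k x) 1 (weighted μ w)) atTop (𝓝 0) := by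
    have hle : ∀ k, eLpNorm (fun x => gS x - dS k x) 1 (weighted μ w) ≤ ∑ n ∈ S,
        (eLpNorm (fun x => ⟪ContinuousLinearMap.adjoint (D x) (e n), e n⟫_ℝ
          - ⟪gradH μ (fun x => ⟪F k x, e n⟫_ℝ) x, e n⟫_ℝ) 2 (weighted μ w)
            * (weighted μ w) Set.univ ^ (1 / (1 : ℝ≥0∞).toReal - 1 / (2 : ℝ≥0∞).toReal)
        + eLpNorm (fun x => ⟪Φ x, e n⟫_ℝ - ⟪F k x, e n⟫_ℝ) 2 (weighted μ w)
          * eLpNorm (score G (e n)) 2 (weighted μ w)) := by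
      intro k
      have h1 : (fun x => gS x - dS k x) = ∑ n ∈ S,
          ((fun x => ⟪ContinuousLinearMap.adjoint (D x) (e n), e n⟫_ℝ
            - ⟪gradH μ (fun x => ⟪F k x, e n⟫_ℝ) x, e n⟫_ℝ)
          + (fun x => ⟪Φ x, e n⟫_ℝ - ⟪F k x, e n⟫_ℝ) • score G (e n)) := by
        ext x
        simp only [gS, dS, divTerm, ← Finset.sum_sub_distrib, Finset.sum_apply, Pi.add_apply,
          smul_eq_mul, Pi.mul_apply]
        refine Finset.sum_congr rfl fun n _ => ?_
        rw [inner_gradH (((h.isCylDiv k).isSmoothCyl_inner (e n)).differentiable x)]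
        ring
      rw [h1]
      refine (eLpNorm_sum_le (fun n _ => (hterm1 n k).add
        ((hterm2 n k).smul (H.memLp_score (e n)).1)) le_rfl).trans (Finset.sum_le_sum fun n _ => ?_)
      refine (eLpNorm_add_le (hterm1 n k) ((hterm2 n k).smul (H.memLp_score (e n)).1)
        le_rfl).trans (add_le_add ?_ ?_)
      · exact eLpNorm_le_eLpNorm_mul_rpow_measure_univ (by norm_num) (hterm1 n k)
      · exact eLpNorm_smul_le_mul_eLpNorm (H.memLp_score (e n)).1 (hterm2 n k)
    have hzero : Tendsto (fun k => ∑ n ∈ S,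
        (eLpNorm (fun x => ⟪ContinuousLinearMap.adjoint (D x) (e n), e n⟫_ℝ
          - ⟪gradH μ (fun x => ⟪F k x, e n⟫_ℝ) x, e n⟫_ℝ) 2 (weighted μ w)
            * (weighted μ w) Set.univ ^ (1 / (1 : ℝ≥0∞).toReal - 1 / (2 : ℝ≥0∞).toReal)
        + eLpNorm (fun x => ⟪Φ x, e n⟫_ℝ - ⟪F k x, e n⟫_ℝ) 2 (weighted μ w)
          * eLpNorm (score G (e n)) 2 (weighted μ w))) atTop (𝓝 (∑ n ∈ S, (0 + 0))) := by
      refine tendsto_finsetSum _ fun n _ => Tendsto.add ?_ ?_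
      · have h2 := ENNReal.Tendsto.mul_const
          (tendsto_eLpNorm_inner_sub (h.tendsto_adjoint (e n)) (e n))
          (b := (weighted μ w) Set.univ ^ (1 / (1 : ℝ≥0∞).toReal - 1 / (2 : ℝ≥0∞).toReal))
          (Or.inr (ENNReal.rpow_ne_top_of_nonneg (by norm_num) (measure_ne_top _ _)))
        rwa [zero_mul] at h2
      · have h2 := ENNReal.Tendsto.mul_const
          (tendsto_eLpNorm_inner_sub h.tendsto_field (e n))
          (b := eLpNorm (score G (e n)) 2 (weighted μ w)) (Or.inr (H.memLp_score (e n)).2.ne)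
        rwa [zero_mul] at h2
    simp only [add_zero, Finset.sum_const_zero] at hzero
    exact tendsto_of_tendsto_of_tendsto_of_le_of_le tendsto_const_nhds hzero (fun _ => zero_le) hle
  have hdm : ∀ k, AEStronglyMeasurable (dS k) (weighted μ w) := fun k =>
    ((hcyl k).memLp_div H).1
  have hL1' : Tendsto (fun k => eLpNorm (fun x => g' x - dS k x) 1 (weighted μ w))
      atTop (𝓝 0) := by
    have h2 := ENNReal.Tendsto.mul_const hg'.tendsto_div
      (b := (weighted μ w) Set.univ ^ (1 / (1 : ℝ≥0∞).toReal - 1 / (2 : ℝ≥0∞).toReal))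
      (Or.inr (ENNReal.rpow_ne_top_of_nonneg (by norm_num) (measure_ne_top _ _)))
    rw [zero_mul] at h2
    exact tendsto_of_tendsto_of_tendsto_of_le_of_le tendsto_const_nhds h2 (fun _ => zero_le)
      fun k => eLpNorm_le_eLpNorm_mul_rpow_measure_univ (by norm_num)
        (hg'.memLp_div.1.sub (hdm k))
  have hgm : AEStronglyMeasurable gS (weighted μ w) := by
    refine Finset.aestronglyMeasurable_fun_sum _ fun n _ => ?_
    exact ((h.memLp_adjoint hD (e n)).inner_const (e n)).1.add
      ((h.memLp.inner_const (e n)).1.mul (H.memLp_score (e n)).1)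
  have hdiff : eLpNorm (g' - gS) 1 (weighted μ w) = 0 := by
    have h3 := hL1'.add hL1
    rw [add_zero] at h3
    refine le_antisymm (ge_of_tendsto' h3 fun k => ?_) zero_le
    have h4 : g' - gS = (fun x => g' x - dS k x) - (fun x => gS x - dS k x) := by
      ext x; simp
    rw [h4]
    exact eLpNorm_sub_le (hg'.memLp_div.1.sub (hdm k)) (hgm.sub (hdm k)) le_rfl
  rw [eLpNorm_eq_zero_iff (hg'.memLp_div.1.sub hgm) one_ne_zero] at hdiff
  filter_upwards [hdiff] with x hx
  exact sub_eq_zero.1 hx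

end IsDivLimit

end Series

/-- Every field in `W^{1,2}(w μ; H)` is the limit of cylindrical fields whose divergences
converge in `L²(w μ)`. -/
lemma IsW1H.exists_isDivLimit [CompleteSpace X] [SecondCountableTopology X] {μ : Measure X}
    [IsGaussian μ] {ι : Type*} [Countable ι] {e : HilbertBasis ι ℝ (CM μ)} {w : X → ℝ} {s t : ℝ}
    {G : X → CM μ} {A : X → (CM μ →L[ℝ] CM μ)} {C : ℝ} {Φ : X → CM μ}
    {D : X → (CM μ →L[ℝ] CM μ)} (hΦ : IsW1H (weighted μ w) e 2 Φ D)
    (H : AdmissibleWeight e w s t G A) (hC : 0 ≤ C)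
    (hA : ∀ᵐ x ∂μ, ∀ h : CM μ, ‖h‖ ^ 2 - ⟪A x h, h⟫_ℝ ≤ C * ‖h‖ ^ 2) :
    ∃ g F d, IsDivLimit e w G Φ D g F d := by
  obtain ⟨hΦm, hDm, -, F, hF, hFΦ, hFD⟩ := hΦ
  choose d hd using fun k => IsCylDiv.of_isSmoothCylH (G := G) (hF k)
  have hlim := hFΦ.add hFD
  rw [add_zero] at hlim
  obtain ⟨g, hg⟩ := H.exists_isDivLimit hC hA hΦm hDm hd hlim
  exact ⟨g, F, d, hg⟩

end WeightedGaussian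

end

/-! ### The main theorem. -/

theorem proposition3p2 {X : Type*} [NormedAddCommGroup X] [NormedSpace ℝ X] [CompleteSpace X]
    [SecondCountableTopology X] [MeasurableSpace X] [BorelSpace X]
    (μ : Measure X) [IsGaussian μ]
    (hcentered : ∀ L : StrongDual ℝ X, ∫ x, L x ∂μ = 0)
    (hnondeg : ∀ L : StrongDual ℝ X, L ≠ 0 → 0 < Var[L; μ])
    {ι : Type*} [DecidableEq ι] (e : HilbertBasis ι ℝ (WeightedGaussian.CM μ))
    (w : X → ℝ) (hw_pos : ∀ᵐ x ∂μ, 0 < w x)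
    (s t : ℝ) (hs : 1 < s) (ht : 2 * (s / (s - 1)) ≤ t)
    (hw : ∃ Gw, WeightedGaussian.IsW1 μ μ (ENNReal.ofReal s) w Gw)
    (G : X → WeightedGaussian.CM μ)
    (A : X → (WeightedGaussian.CM μ →L[ℝ] WeightedGaussian.CM μ))
    (hlog : WeightedGaussian.IsW2 μ e (ENNReal.ofReal t) (fun x => Real.log (w x)) G A)
    (C : ℝ) (hC : 0 ≤ C)
    (hbound : ∀ ξ : lp (fun _ : ι => ℝ) 2, ∀ᵐ x ∂μ,
      ∑' i, ∑' j, ((if i = j then (1 : ℝ) else 0) - ⟪A x (e j), e i⟫_ℝ) * ξ i * ξ j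
        ≤ C * ∑' i, ξ i ^ 2)
    (Φ : X → WeightedGaussian.CM μ)
    (D : X → (WeightedGaussian.CM μ →L[ℝ] WeightedGaussian.CM μ))
    (hΦ : WeightedGaussian.IsW1H (WeightedGaussian.weighted μ w) e 2 Φ D) :
    ∃ g : X → ℝ,
      WeightedGaussian.HasDivergence (WeightedGaussian.weighted μ w) (fun x => (Φ x).toX) g ∧
      MemLp g 2 (WeightedGaussian.weighted μ w) ∧
      (∀ (f : X → ℝ) (Gf : X → WeightedGaussian.CM μ),
        WeightedGaussian.IsW1 μ (WeightedGaussian.weighted μ w) 2 f Gf →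
        ∫ x, ⟪Gf x, Φ x⟫_ℝ ∂(WeightedGaussian.weighted μ w)
          = - ∫ x, f x * g x ∂(WeightedGaussian.weighted μ w)) ∧
      (∃ Gφ : ι → X → WeightedGaussian.CM μ,
        (∀ n, WeightedGaussian.IsW1 μ (WeightedGaussian.weighted μ w) 2
          (fun x => ⟪Φ x, e n⟫_ℝ) (Gφ n)) ∧
        Tendsto (fun S : Finset ι => eLpNorm (fun x => g x - ∑ n ∈ S,
            (⟪Gφ n x, e n⟫_ℝ + ⟪Φ x, e n⟫_ℝ * ⟪G x, e n⟫_ℝ - ⟪Φ x, e n⟫_ℝ * (e n).hat x))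
          2 (WeightedGaussian.weighted μ w)) atTop (𝓝 0)) ∧
      eLpNorm g 2 (WeightedGaussian.weighted μ w)
        ≤ ENNReal.ofReal (max (Real.sqrt C) 1) *
          WeightedGaussian.normW1H (WeightedGaussian.weighted μ w) e 2 Φ D := by
  have hcount : Countable ι := WeightedGaussian.countable_of_orthonormal e.orthonormal
  obtain ⟨Gw, hw⟩ := hw
  have H : WeightedGaussian.AdmissibleWeight e w s t G A :=
    ⟨hcentered, hw_pos, hs, ht, hw.1, hlog⟩
  have hA := WeightedGaussian.ae_forall_quadratic_le hbound
  have hfin := H.isFiniteMeasure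
  have hD := hΦ.2.2.1
  obtain ⟨g, F, d, hg⟩ := hΦ.exists_isDivLimit H hC hA
  refine ⟨g, ⟨?_, hg.memLp_div.integrable (by norm_num), fun f hf => ?_⟩, hg.memLp_div,
    fun f Gf hf => hg.integral_inner_of_isW1 H hf,
    ⟨fun n x => ContinuousLinearMap.adjoint (D x) (e n), fun n => hg.isW1_inner hD (e n), ?_⟩,
    hg.eLpNorm_le H hC hA⟩
  -- The inclusion `H → X` is bounded and `ν` is finite, so square integrability in `H` gives
  -- integrability in `X`.
  · exact ((WeightedGaussian.CM.toXL μ).comp_memLp' hg.memLp).integrable (by norm_num)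
  · rw [← hg.integral_inner_gradH H hf]
    refine integral_congr_ae (Eventually.of_forall fun x => ?_)
    simp only
    rw [WeightedGaussian.inner_gradH (hf.differentiable x),
      (hf.differentiable x).lineDeriv_eq_fderiv]
  -- The partial sum over `S` is almost everywhere the divergence of the projected field, so the
  -- remainder is bounded by `max(√C, 1)` times the `W^{1,2}` norm of `Φ` minus its projection.
  · have hlim := ENNReal.Tendsto.const_mul (a := ENNReal.ofReal (max (Real.sqrt C) 1))
      (WeightedGaussian.tendsto_normW1H_sub_trunc (e := e) hg.memLp hg.aestronglyMeasurable hD)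
      (Or.inr ENNReal.ofReal_ne_top)
    rw [mul_zero] at hlim
    refine tendsto_of_tendsto_of_tendsto_of_le_of_le tendsto_const_nhds hlim (fun _ => zero_le)
      fun S => ?_
    obtain ⟨g', F', d', hg', hae⟩ := hg.exists_trunc H hC hA hD S
    refine le_trans (le_of_eq ?_) ((hg.sub hg' H).eLpNorm_le H hC hA)
    refine eLpNorm_congr_ae ?_
    filter_upwards [hae] with x hx
    rw [hx]
    refine congrArg (g x - ·) (Finset.sum_congr rfl fun n _ => ?_)
    simp only [WeightedGaussian.score]
    ring
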